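/- Let $\mathfrak g_2=\mathfrak{sl}(3,\mathbb R)\oplus\mathbb R^3\oplus(\mathbb R^3)^*$ be the split real form of the exceptional Lie algebra of type $G_2$, with the skew-symmetric bilinear bracket determined by: $[A,B]=AB-BA$, $[A,v]=Av$, $[A,\alpha]=-\alpha\circ A$, $[u,v]=-\tfrac43\det(u,v,\cdot)$, $[\alpha,\beta]=\tfrac43 S(\alpha\wedge\beta)$ where $\gamma(S(\alpha\wedge\beta))=\det(\alpha,\beta,\gamma)$, and $[v,\alpha]=\tfrac43\big((v^i\alpha^j)_{ij}-\tfrac13\alpha(v)I_3\big)$, for $A,B\in\mathfrak{sl}(3,\mathbb R)$, $u,v\in\mathbb R^3$, $\alpha,\beta,\gamma\in(\mathbb R^3)^*$. Let $\mathfrak h$ be the Cartan subalgebra of diagonal traceless matrices, $\lambda_i(\mathrm{diag}(a_1,a_2,a_3))=a_i$, with roots $\Pi=\{\lambda_i-\lambda_j : i\ne j\}\cup\{\pm\lambda_i\}$, positive roots $\Pi^+=\{\lambda_i-\lambda_j : i<j\}\cup\{\lambda_1,\lambda_2,-\lambda_3\}$ and simple roots $\Sigma=\{\alpha_1=\lambda_1-\lambda_2,\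 \alpha_2=\lambda_2\}$. Let $G_2=\mathrm{Int}(\mathfrak g_2)$ be the connected group generated by all $e^{\mathrm{ad}X}$, $X\in\mathfrak g_2$. For $\Theta\subsetneq\Sigma$ let $\mathfrak p_\Theta$ be the sum of $\mathfrak h$, of the root spaces of all positive roots, and of the root spaces of the negative roots that are integral combinations of elements of $\Theta$, and let $P_\Theta=\{a\in G_2:\mathrm{Ad}(a)\mathfrak p_\Theta=\mathfrak p_\Theta\}$. Let $e_i$ be the canonical basis of $\mathbb R^3$, $\epsilon_i$ its dual basis, $X_1=E_{21}-E_{12}$, $X_2=E_{31}-E_{13}$, $X_3=E_{32}-E_{23}$, $Y_i=e_i-\epsilon_i$; let $\mathfrak k\cong\mathfrak{so}(4)$ be the span of the $X_i,Y_i$, and let $K\cong SO(4)$ be the connected subgroup of $G_2$ with Lie algebra $\mathfrak k$, a maximal compact subgroup. Let $(\cdot,\cdot)$ be the negative of the Killing form of $\mathfrak k$, let $K_\Theta=K\cap P_\Theta$, so that the flag manifold is $\mathbb F_\Theta=G_2/P_\Theta=K/K_\Theta$, and let $\mathfrak m_\Theta$ be the $(\cdot,\cdot)$-orthogonal complement in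 $\mathfrak k$ of the Lie algebra of $K_\Theta$. The $K$-invariant Riemannian metrics on $\mathbb F_\Theta$ correspond to the $\mathrm{Ad}(K_\Theta)$-invariant inner products $\langle\cdot,\cdot\rangle$ on $\mathfrak m_\Theta$. Put $$W_i=\tfrac12X_i,\qquad Z_1=\tfrac38Y_1-\tfrac14X_3,\quad Z_2=\tfrac38Y_2+\tfrac14X_2,\quad Z_3=\tfrac38Y_3-\tfrac14X_1 .$$ **Theorem.** For every $\Theta\subsetneq\Sigma$, $\mathrm{Ad}(K_\Theta)$ maps $\mathfrak m_\Theta$ into itself, and every $\mathrm{Ad}(K_\Theta)$-invariant inner product $\langle\cdot,\cdot\rangle$ on $\mathfrak m_\Theta$ has a unique metric operator, i.e. a unique linear map $A:\mathfrak m_\Theta\to\mathfrak m_\Theta$ with $\langle X,Y\rangle=(AX,Y)$ for all $X,Y\in\mathfrak m_\Theta$. Moreover: a) $\mathcal B_\emptyset=(W_1,Z_3,W_2,Z_2,W_3,Z_1)$ is a $(\cdot,\cdot)$-orthonormal basis of $\mathfrak m_\emptyset$, and a linear map $A:\mathfrak m_\emptyset\to\mathfrak m_\emptyset$ is the metric operator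 of an $\mathrm{Ad}(K_\emptyset)$-invariant inner product if and only if there are $\mu_1,\dots,\mu_6>0$ and real $a_1,a_2,a_3$ with $|a_i|<\sqrt{\mu_{2i-1}\mu_{2i}}$ such that $$[A]_{\mathcal B_\emptyset}=\begin{pmatrix}\mu_1&a_1&0&0&0&0\\a_1&\mu_2&0&0&0&0\\0&0&\mu_3&a_2&0&0\\0&0&a_2&\mu_4&0&0\\0&0&0&0&\mu_5&a_3\\0&0&0&0&a_3&\mu_6\end{pmatrix}.$$ b) $\mathcal B_{\{\alpha_1\}}=(Z_3,W_2,W_3,Z_2,-Z_1)$ is a $(\cdot,\cdot)$-orthonormal basis of $\mathfrak m_{\{\alpha_1\}}$, and a linear map $A$ on $\mathfrak m_{\{\alpha_1\}}$ is the metric operator of an $\mathrm{Ad}(K_{\{\alpha_1\}})$-invariant inner product if and only if there are $\mu_1,\mu_2,\mu_3>0$ and a real $a$ with $|a|<\sqrt{\mu_2\mu_3}$ such that $$[A]_{\mathcal B_{\{\alpha_1\}}}=\begin{pmatrix}\mu_1&0&0&0&0\\0&\mu_2&0&a&0\\0&0&\mu_2&0&a\\0&a&0&\mu_3&0\\0&0&a&0&\mu_3\end{pmatrix}.$$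 c) $\mathcal B_{\{\alpha_2\}}=\Big(\frac{2W_2+Z_2}{\sqrt5},\frac{W_1+Z_3}{\sqrt2},\frac{W_3+Z_1}{\sqrt2},\frac{W_1-Z_3}{\sqrt2},\frac{W_3-Z_1}{\sqrt2}\Big)$ is a $(\cdot,\cdot)$-orthonormal basis of $\mathfrak m_{\{\alpha_2\}}$, and a linear map $A$ on $\mathfrak m_{\{\alpha_2\}}$ is the metric operator of an $\mathrm{Ad}(K_{\{\alpha_2\}})$-invariant inner product if and only if there are $\mu_1,\mu_2,\mu_3>0$ such that $[A]_{\mathcal B_{\{\alpha_2\}}}=\mathrm{diag}(\mu_1,\mu_2,\mu_2,\mu_3,\mu_3)$. -/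

import Mathlib

open scoped Matrix

noncomputable section

/-- The underlying vector space `𝔰𝔩(3, ℝ) ⊕ ℝ³ ⊕ (ℝ³)*` of the split real form of the exceptional
Lie algebra `𝔤₂`. A covector is given by its coordinates with respect to the dual basis
`ε₁, ε₂, ε₃` of the canonical basis `e₁, e₂, e₃`. -/
def SplitG2 : Type :=
  ↥(LieAlgebra.SpecialLinear.sl (Fin 3) ℝ) × (Fin 3 → ℝ) × (Fin 3 → ℝ)

namespace SplitG2

instance : AddCommGroup SplitG2 :=
  inferInstanceAs (AddCommGroup
    (↥(LieAlgebra.SpecialLinear.sl (Fin 3) ℝ) × (Fin 3 → ℝ) × (Fin 3 → ℝ)))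

instance : Module ℝ SplitG2 :=
  inferInstanceAs (Module ℝ
    (↥(LieAlgebra.SpecialLinear.sl (Fin 3) ℝ) × (Fin 3 → ℝ) × (Fin 3 → ℝ)))

/-- The usual topology of a finite-dimensional real vector space (as a subspace of `ℝ^(9+3+3)`). -/
instance : TopologicalSpace SplitG2 :=
  inferInstanceAs (TopologicalSpace
    (↥(LieAlgebra.SpecialLinear.sl (Fin 3) ℝ) × (Fin 3 → ℝ) × (Fin 3 → ℝ)))

/-- The component in `𝔰𝔩(3, ℝ)`. -/
def mat (x : SplitG2) : Matrix (Fin 3) (Fin 3) ℝ := x.1.1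

/-- The component in `ℝ³`. -/
def vec (x : SplitG2) : Fin 3 → ℝ := x.2.1

/-- The component in `(ℝ³)*`. -/
def cov (x : SplitG2) : Fin 3 → ℝ := x.2.2

/-- The element with the given components. -/
def of (A : Matrix (Fin 3) (Fin 3) ℝ) (hA : A.trace = 0) (v α : Fin 3 → ℝ) : SplitG2 :=
  (⟨A, (LinearMap.mem_ker (f := Matrix.traceLinearMap (Fin 3) ℝ ℝ)).2 hA⟩, v, α)

theorem trace_mat (x : SplitG2) : x.mat.trace = 0 :=
  (LinearMap.mem_ker (f := Matrix.traceLinearMap (Fin 3) ℝ ℝ)).1 x.1.2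

theorem ext' {x y : SplitG2} (h₁ : x.mat = y.mat) (h₂ : x.vec = y.vec) (h₃ : x.cov = y.cov) :
    x = y :=
  Prod.ext (Subtype.ext h₁) (Prod.ext h₂ h₃)

@[simp] theorem mat_of (A hA v α) : (of A hA v α).mat = A := rfl
@[simp] theorem vec_of (A hA v α) : (of A hA v α).vec = v := rfl
@[simp] theorem cov_of (A hA v α) : (of A hA v α).cov = α := rfl
@[simp] theorem mat_zero : (0 : SplitG2).mat = 0 := rfl
@[simp] theorem vec_zero : (0 : SplitG2).vec = 0 := rfl
@[simp] theorem cov_zero : (0 : SplitG2).cov = 0 := rfl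
@[simp] theorem mat_add (x y : SplitG2) : (x + y).mat = x.mat + y.mat := rfl
@[simp] theorem vec_add (x y : SplitG2) : (x + y).vec = x.vec + y.vec := rfl
@[simp] theorem cov_add (x y : SplitG2) : (x + y).cov = x.cov + y.cov := rfl
@[simp] theorem mat_smul (c : ℝ) (x : SplitG2) : (c • x).mat = c • x.mat := rfl
@[simp] theorem vec_smul (c : ℝ) (x : SplitG2) : (c • x).vec = c • x.vec := rfl
@[simp] theorem cov_smul (c : ℝ) (x : SplitG2) : (c • x).cov = c • x.cov := rfl

/-- The `𝔰𝔩(3, ℝ)`-component of the bracket: `[A, B]` is the commutator of matrices and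
`[v, α] = (4/3) ((vⁱ αʲ)ᵢⱼ - (1/3) α(v) I)`. -/
def bracketMat (x y : SplitG2) : Matrix (Fin 3) (Fin 3) ℝ :=
  x.mat * y.mat - y.mat * x.mat
    + (4 / 3 : ℝ) • (Matrix.vecMulVec x.vec y.cov - (1 / 3 : ℝ) • (y.cov ⬝ᵥ x.vec) • 1)
    - (4 / 3 : ℝ) • (Matrix.vecMulVec y.vec x.cov - (1 / 3 : ℝ) • (x.cov ⬝ᵥ y.vec) • 1)

theorem trace_bracketMat (x y : SplitG2) : (bracketMat x y).trace = 0 := by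
  simp only [bracketMat, Matrix.trace, Matrix.diag, Matrix.mul_apply, Matrix.vecMulVec_apply,
    dotProduct, Fin.sum_univ_three, Matrix.sub_apply, Matrix.add_apply, Matrix.smul_apply,
    Matrix.one_apply, smul_eq_mul, if_true]
  ring

/-- The bracket of `𝔤₂`. Besides `bracketMat`, it is given by `[A, v] = A v`, `[A, α] = -α ∘ A`,
`[u, v] = -(4/3) T(u ∧ v)` and `[α, β] = (4/3) S(α ∧ β)`, where `T(u ∧ v) = det(u, v, ·)` and
`γ(S(α ∧ β)) = det(α, β, γ)`; in coordinates both `T` and `S` are the cross product. -/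
instance : Bracket SplitG2 SplitG2 where
  bracket x y := of (bracketMat x y) (trace_bracketMat x y)
    (x.mat *ᵥ y.vec - y.mat *ᵥ x.vec + (4 / 3 : ℝ) • (x.cov ⨯₃ y.cov))
    (-(y.cov ᵥ* x.mat) + x.cov ᵥ* y.mat - (4 / 3 : ℝ) • (x.vec ⨯₃ y.vec))

@[simp] theorem mat_lie (x y : SplitG2) : ⁅x, y⁆.mat = bracketMat x y := rfl
@[simp] theorem vec_lie (x y : SplitG2) : ⁅x, y⁆.vec =
    x.mat *ᵥ y.vec - y.mat *ᵥ x.vec + (4 / 3 : ℝ) • (x.cov ⨯₃ y.cov) := rfl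
@[simp] theorem cov_lie (x y : SplitG2) : ⁅x, y⁆.cov =
    -(y.cov ᵥ* x.mat) + x.cov ᵥ* y.mat - (4 / 3 : ℝ) • (x.vec ⨯₃ y.vec) := rfl

theorem mat_two_two (x : SplitG2) : x.mat 2 2 = -x.mat 0 0 - x.mat 1 1 := by
  have h := x.trace_mat
  simp only [Matrix.trace, Matrix.diag, Fin.sum_univ_three] at h
  linarith

theorem bracketMat_apply (x y : SplitG2) (i j : Fin 3) : bracketMat x y i j =
    x.mat i 0 * y.mat 0 j + x.mat i 1 * y.mat 1 j + x.mat i 2 * y.mat 2 j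
      - (y.mat i 0 * x.mat 0 j + y.mat i 1 * x.mat 1 j + y.mat i 2 * x.mat 2 j)
      + 4 / 3 * (x.vec i * y.cov j - y.vec i * x.cov j)
      - (if i = j then 4 / 9 * (y.cov 0 * x.vec 0 + y.cov 1 * x.vec 1 + y.cov 2 * x.vec 2
          - (x.cov 0 * y.vec 0 + x.cov 1 * y.vec 1 + x.cov 2 * y.vec 2)) else 0) := by
  simp only [bracketMat, Matrix.mul_apply, Matrix.vecMulVec_apply, dotProduct,
    Fin.sum_univ_three, Matrix.sub_apply, Matrix.add_apply, Matrix.smul_apply,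
    Matrix.one_apply, smul_eq_mul]
  split_ifs <;> ring

theorem vec_lie_apply (x y : SplitG2) (i : Fin 3) : ⁅x, y⁆.vec i =
    x.mat i 0 * y.vec 0 + x.mat i 1 * y.vec 1 + x.mat i 2 * y.vec 2
      - (y.mat i 0 * x.vec 0 + y.mat i 1 * x.vec 1 + y.mat i 2 * x.vec 2)
      + 4 / 3 * (x.cov (i + 1) * y.cov (i + 2) - x.cov (i + 2) * y.cov (i + 1)) := by
  simp only [vec_lie, Pi.add_apply, Pi.sub_apply, Pi.smul_apply, Matrix.mulVec, dotProduct,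
    Fin.sum_univ_three, smul_eq_mul, cross_apply]
  fin_cases i <;> rfl

theorem cov_lie_apply (x y : SplitG2) (i : Fin 3) : ⁅x, y⁆.cov i =
    -(y.cov 0 * x.mat 0 i + y.cov 1 * x.mat 1 i + y.cov 2 * x.mat 2 i)
      + (x.cov 0 * y.mat 0 i + x.cov 1 * y.mat 1 i + x.cov 2 * y.mat 2 i)
      - 4 / 3 * (x.vec (i + 1) * y.vec (i + 2) - x.vec (i + 2) * y.vec (i + 1)) := by
  simp only [cov_lie, Pi.add_apply, Pi.sub_apply, Pi.neg_apply, Pi.smul_apply, Matrix.vecMul,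
    dotProduct, Fin.sum_univ_three, smul_eq_mul, cross_apply]
  fin_cases i <;> rfl

theorem jacobi (x y z : SplitG2) : ⁅x, ⁅y, z⁆⁆ = ⁅⁅x, y⁆, z⁆ + ⁅y, ⁅x, z⁆⁆ := by
  have h1 : (1 : Fin 3) + 1 = 2 := rfl
  have h2 : (1 : Fin 3) + 2 = 0 := rfl
  have h3 : (2 : Fin 3) + 1 = 0 := rfl
  have h4 : (2 : Fin 3) + 2 = 1 := rfl
  apply ext'
  · ext i j
    fin_cases i <;> fin_cases j <;>
      simp only [Fin.zero_eta, Fin.mk_one, Fin.reduceFinMk, Fin.isValue, mat_add, mat_lie,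
        Matrix.add_apply, bracketMat_apply, vec_lie_apply, cov_lie_apply, zero_add, h1, h2, h3, h4,
        Fin.reduceEq, if_true, if_false, mat_two_two] <;> ring
  · ext i
    fin_cases i <;>
      simp only [Fin.zero_eta, Fin.mk_one, Fin.reduceFinMk, Fin.isValue, vec_add, mat_lie,
        Pi.add_apply, bracketMat_apply, vec_lie_apply, cov_lie_apply, zero_add, h1, h2, h3, h4,
        Fin.reduceEq, if_true, if_false, mat_two_two] <;> ring
  · ext i
    fin_cases i <;>
      simp only [Fin.zero_eta, Fin.mk_one, Fin.reduceFinMk, Fin.isValue, cov_add, mat_lie,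
        Pi.add_apply, bracketMat_apply, vec_lie_apply, cov_lie_apply, zero_add, h1, h2, h3, h4,
        Fin.reduceEq, if_true, if_false, mat_two_two] <;> ring

instance : LieRing SplitG2 where
  add_lie x y z := by
    apply ext'
    · ext i j
      simp [bracketMat, Matrix.mul_apply, Matrix.vecMulVec_apply, dotProduct,
        Fin.sum_univ_three]
      ring
    · simp [Matrix.add_mulVec, Matrix.mulVec_add]
      abel
    · simp [Matrix.add_vecMul, Matrix.vecMul_add]
      abel
  lie_add x y z := by
    apply ext'
    · ext i j
      simp [bracketMat, Matrix.mul_apply, Matrix.vecMulVec_apply, dotProduct,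
        Fin.sum_univ_three]
      ring
    · simp [Matrix.add_mulVec, Matrix.mulVec_add]
      abel
    · simp [Matrix.add_vecMul, Matrix.vecMul_add]
      abel
  lie_self x := by
    apply ext'
    · simp [bracketMat]
    · simp
    · simp
  leibniz_lie x y z := jacobi x y z

instance : LieAlgebra ℝ SplitG2 where
  lie_smul c x y := by
    apply ext'
    · ext i j
      simp [bracketMat, Matrix.mul_apply, Matrix.vecMulVec_apply, dotProduct,
        Fin.sum_univ_three]
      ring
    · simp [Matrix.smul_mulVec, Matrix.mulVec_smul, smul_sub, smul_smul, mul_comm]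
    · simp [Matrix.smul_vecMul, Matrix.vecMul_smul, smul_sub, smul_smul, mul_comm]

/-! ### Roots and parabolic subalgebras -/

/-- The Cartan subalgebra `𝔥` of diagonal traceless matrices. -/
def cartan : Submodule ℝ SplitG2 where
  carrier := {x | x.mat.IsDiag ∧ x.vec = 0 ∧ x.cov = 0}
  add_mem' := by
    rintro x y ⟨h₁, h₂, h₃⟩ ⟨k₁, k₂, k₃⟩
    exact ⟨h₁.add k₁, by simp [h₂, k₂], by simp [h₃, k₃]⟩
  zero_mem' := ⟨Matrix.isDiag_zero, rfl, rfl⟩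
  smul_mem' := by
    rintro c x ⟨h₁, h₂, h₃⟩
    exact ⟨h₁.smul c, by simp [h₂], by simp [h₃]⟩

/-- The functional `λᵢ : diag(a₁, a₂, a₃) ↦ aᵢ` on `𝔥`; the index `i : Fin 3` starts at `0`. -/
def lam (i : Fin 3) : Module.Dual ℝ cartan where
  toFun H := (H : SplitG2).mat i i
  map_add' _ _ := rfl
  map_smul' _ _ := rfl

/-- The root system `Π`. -/
def roots : Set (Module.Dual ℝ cartan) :=
  {φ | ∃ i j, i ≠ j ∧ φ = lam i - lam j} ∪ {φ | ∃ i, φ = lam i ∨ φ = -lam i}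

/-- The positive roots `Π⁺`: `λᵢ - λⱼ` for `i < j`, together with `λ₁, λ₂, -λ₃`. -/
def posRoots : Set (Module.Dual ℝ cartan) :=
  {φ | ∃ i j, i < j ∧ φ = lam i - lam j} ∪ {lam 0, lam 1, -lam 2}

/-- The long simple root `α₁ = λ₁ - λ₂`. -/
def alpha₁ : Module.Dual ℝ cartan := lam 0 - lam 1

/-- The short simple root `α₂ = λ₂`. -/
def alpha₂ : Module.Dual ℝ cartan := lam 1

/-- The set `Σ` of simple roots. -/
def simpleRoots : Set (Module.Dual ℝ cartan) := {alpha₁, alpha₂}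

/-- The root space of a functional on `𝔥`. -/
def rootSpace (φ : Module.Dual ℝ cartan) : Submodule ℝ SplitG2 where
  carrier := {x | ∀ H : cartan, ⁅(H : SplitG2), x⁆ = φ H • x}
  add_mem' := by
    intro x y hx hy H
    rw [lie_add, hx H, hy H, smul_add]
  zero_mem' := by
    intro H
    rw [lie_zero, smul_zero]
  smul_mem' := by
    intro c x hx H
    rw [lie_smul, hx H, smul_comm]

/-- `⟨Θ⟩⁻`: the negative roots that are integral linear combinations of elements of `Θ`. -/
def negSpan (Θ : Set (Module.Dual ℝ cartan)) : Set (Module.Dual ℝ cartan) :=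
  {φ | φ ∈ roots ∧ φ ∈ AddSubgroup.closure Θ ∧ -φ ∈ posRoots}

/-- The parabolic subalgebra `𝔭_Θ`: the sum of `𝔥`, of the root spaces of all positive roots and
of the root spaces of the roots in `⟨Θ⟩⁻`. -/
def parabolicAlgebra (Θ : Set (Module.Dual ℝ cartan)) : Submodule ℝ SplitG2 :=
  cartan ⊔ (⨆ φ ∈ posRoots, rootSpace φ) ⊔ ⨆ φ ∈ negSpan Θ, rootSpace φ

/-! ### Groups

The group `G₂` is realized as the group of inner automorphisms of its Lie algebra, so that `Ad` is
the tautological action on `SplitG2` and the exponential map is `X ↦ e^{ad X}`. -/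

/-- `a = e^{ad X} = ∑ (ad X)ⁿ / n!`, with (pointwise) convergence of the series. -/
def IsExpAd (X : SplitG2) (a : SplitG2 ≃ₗ[ℝ] SplitG2) : Prop :=
  ∀ v : SplitG2,
    HasSum (fun n : ℕ => ((n.factorial : ℝ)⁻¹) • ((LieAlgebra.ad ℝ SplitG2 X) ^ n) v) (a v)

/-- The connected simple Lie group `G₂ = Int(𝔤₂)`, generated by all `e^{ad X}`, `X ∈ 𝔤₂`. -/
def G₂ : Subgroup (SplitG2 ≃ₗ[ℝ] SplitG2) :=
  Subgroup.closure {a | ∃ X, IsExpAd X a}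

/-- The Lie algebra `{X | exp(tX) ∈ H for all t ∈ ℝ}` of a subgroup `H`. -/
def lieOf (H : Subgroup (SplitG2 ≃ₗ[ℝ] SplitG2)) : Set SplitG2 :=
  {X | ∀ t : ℝ, ∃ a ∈ H, IsExpAd (t • X) a}

/-- The parabolic subgroup `P_Θ = {a ∈ G₂ | Ad(a) 𝔭_Θ = 𝔭_Θ}`. -/
def parabolicSubgroup (Θ : Set (Module.Dual ℝ cartan)) :
    Subgroup (SplitG2 ≃ₗ[ℝ] SplitG2) where
  carrier := {a | a ∈ G₂ ∧ (parabolicAlgebra Θ).map (a : SplitG2 →ₗ[ℝ] SplitG2) =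
    parabolicAlgebra Θ}
  mul_mem' := by
    rintro a b ⟨ha, ha'⟩ ⟨hb, hb'⟩
    refine ⟨mul_mem ha hb, ?_⟩
    have h : ((a * b : SplitG2 ≃ₗ[ℝ] SplitG2) : SplitG2 →ₗ[ℝ] SplitG2) =
        (a : SplitG2 →ₗ[ℝ] SplitG2) ∘ₗ (b : SplitG2 →ₗ[ℝ] SplitG2) := rfl
    rw [h, Submodule.map_comp, hb', ha']
  one_mem' := ⟨one_mem _, Submodule.map_id _⟩
  inv_mem' := by
    rintro a ⟨ha, ha'⟩
    refine ⟨inv_mem ha, ?_⟩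
    have h : ((a⁻¹ : SplitG2 ≃ₗ[ℝ] SplitG2) : SplitG2 →ₗ[ℝ] SplitG2) ∘ₗ
        (a : SplitG2 →ₗ[ℝ] SplitG2) = LinearMap.id := by
      ext x
      exact a.symm_apply_apply x
    conv_lhs => rw [← ha']
    rw [← Submodule.map_comp, h, Submodule.map_id]

/-! ### The maximal compact subgroup and its Lie algebra -/

/-- `X₁ = E₂₁ - E₁₂`, `X₂ = E₃₁ - E₁₃`, `X₃ = E₃₂ - E₂₃` (as `X 0`, `X 1`, `X 2`). -/
def X : Fin 3 → SplitG2 :=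
  ![of !![0, -1, 0; 1, 0, 0; 0, 0, 0] (by simp [Matrix.trace_fin_three]) 0 0,
    of !![0, 0, -1; 0, 0, 0; 1, 0, 0] (by simp [Matrix.trace_fin_three]) 0 0,
    of !![0, 0, 0; 0, 0, -1; 0, 1, 0] (by simp [Matrix.trace_fin_three]) 0 0]

/-- `Yᵢ = eᵢ - εᵢ` (as `Y 0`, `Y 1`, `Y 2`). -/
def Y (i : Fin 3) : SplitG2 :=
  of 0 (Matrix.trace_zero _ _) (Pi.single i 1) (-Pi.single i 1)

/-- The span of the `Xᵢ` and `Yᵢ` consists of the fixed points `(A, v, -v)`, `Aᵀ = -A`, of the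
Cartan involution `(A, v, α) ↦ (-Aᵀ, -α, -v)`. -/
theorem mem_span_XY (x : SplitG2) :
    x ∈ Submodule.span ℝ (Set.range X ∪ Set.range Y) ↔ x.matᵀ = -x.mat ∧ x.cov = -x.vec := by
  constructor
  · intro h
    induction h using Submodule.span_induction with
    | mem x h =>
      rcases h with ⟨i, rfl⟩ | ⟨i, rfl⟩
      · fin_cases i <;> refine ⟨?_, by simp [X]⟩ <;> ext i j <;>
          fin_cases i <;> fin_cases j <;> simp [X]
      · simp [Y]
    | zero => simp
    | add x y _ _ hx hy =>
      refine ⟨by simp [hx.1, hy.1, add_comm], by simp [hx.2, hy.2, add_comm]⟩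
    | smul c x _ hx => simp [hx.1, hx.2]
  · rintro ⟨h₁, h₂⟩
    have e : ∀ i j, x.mat j i = -x.mat i j := fun i j => congrFun (congrFun h₁ i) j
    have hx : x = (x.mat 1 0) • X 0 + (x.mat 2 0) • X 1 + (x.mat 2 1) • X 2
        + ((x.vec 0) • Y 0 + (x.vec 1) • Y 1 + (x.vec 2) • Y 2) := by
      have e00 := e 0 0
      have e11 := e 1 1
      have e22 := e 2 2
      have e01 := e 1 0
      have e02 := e 2 0
      have e12 := e 2 1
      apply ext'
      · ext i j
        fin_cases i <;> fin_cases j <;> simp [X, Y] <;> linarith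
      · ext i
        fin_cases i <;> simp [X, Y]
      · rw [h₂]
        ext i
        fin_cases i <;> simp [X, Y]
    rw [hx]
    have hX : ∀ i, X i ∈ Submodule.span ℝ (Set.range X ∪ Set.range Y) := fun i =>
      Submodule.subset_span (Or.inl ⟨i, rfl⟩)
    have hY : ∀ i, Y i ∈ Submodule.span ℝ (Set.range X ∪ Set.range Y) := fun i =>
      Submodule.subset_span (Or.inr ⟨i, rfl⟩)
    exact add_mem
      (add_mem (add_mem (Submodule.smul_mem _ _ (hX 0)) (Submodule.smul_mem _ _ (hX 1)))
        (Submodule.smul_mem _ _ (hX 2)))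
      (add_mem (add_mem (Submodule.smul_mem _ _ (hY 0)) (Submodule.smul_mem _ _ (hY 1)))
        (Submodule.smul_mem _ _ (hY 2)))

/-- The maximal compact subalgebra `𝔨 ≅ 𝔰𝔬(4)`, spanned by the `Xᵢ` and the `Yᵢ`. -/
def compactAlgebra : LieSubalgebra ℝ SplitG2 where
  __ := Submodule.span ℝ (Set.range X ∪ Set.range Y)
  lie_mem' := by
    intro x y hx hy
    change x ∈ Submodule.span ℝ (Set.range X ∪ Set.range Y) at hx
    change y ∈ Submodule.span ℝ (Set.range X ∪ Set.range Y) at hy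
    change ⁅x, y⁆ ∈ Submodule.span ℝ (Set.range X ∪ Set.range Y)
    rw [mem_span_XY] at hx hy ⊢
    obtain ⟨h₁, h₂⟩ := hx
    obtain ⟨k₁, k₂⟩ := hy
    have e : ∀ i j, x.mat j i = -x.mat i j := fun i j => congrFun (congrFun h₁ i) j
    have f : ∀ i j, y.mat j i = -y.mat i j := fun i j => congrFun (congrFun k₁ i) j
    constructor
    · ext i j
      simp only [mat_lie, bracketMat, h₂, k₂, Matrix.transpose_apply, Matrix.neg_apply,
        Matrix.sub_apply, Matrix.add_apply, Matrix.smul_apply, Matrix.mul_apply,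
        Matrix.vecMulVec_apply, Pi.neg_apply, Matrix.one_apply, dotProduct, smul_eq_mul,
        Fin.sum_univ_three, eq_comm (a := j) (b := i)]
      rw [e i 0, e i 1, e i 2, e 0 j, e 1 j, e 2 j, f i 0, f i 1, f i 2, f 0 j, f 1 j, f 2 j]
      split_ifs <;> ring
    · have hx : ∀ v : Fin 3 → ℝ, v ᵥ* x.mat = -(x.mat *ᵥ v) := fun v => by
        rw [← Matrix.mulVec_transpose, h₁, Matrix.neg_mulVec]
      have hy : ∀ v : Fin 3 → ℝ, v ᵥ* y.mat = -(y.mat *ᵥ v) := fun v => by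
        rw [← Matrix.mulVec_transpose, k₁, Matrix.neg_mulVec]
      simp only [vec_lie, cov_lie, h₂, k₂, hx, hy, Matrix.mulVec_neg, map_neg,
        LinearMap.neg_apply, neg_neg]
      abel

/-- The maximal compact subgroup `K ≅ SO(4)`: the connected subgroup of `G₂` with Lie algebra
`𝔨`, generated by the `e^{ad X}` with `X ∈ 𝔨`. -/
def K : Subgroup (SplitG2 ≃ₗ[ℝ] SplitG2) :=
  Subgroup.closure {a | ∃ X ∈ compactAlgebra, IsExpAd X a}

/-- The isotropy subgroup `K_Θ = K ∩ P_Θ` of the flag manifold `𝔽_Θ = G₂ / P_Θ = K / K_Θ`. -/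
def isotropy (Θ : Set (Module.Dual ℝ cartan)) : Subgroup (SplitG2 ≃ₗ[ℝ] SplitG2) :=
  K ⊓ parabolicSubgroup Θ

/-- The inner product `(·,·)` on `𝔨`: the negative of the Killing form of `𝔨`. -/
def inn : LinearMap.BilinForm ℝ compactAlgebra := -killingForm ℝ compactAlgebra

/-- `𝔪_Θ`: the `(·,·)`-orthogonal complement in `𝔨` of the Lie algebra of `K_Θ`. -/
def m (Θ : Set (Module.Dual ℝ cartan)) : Submodule ℝ compactAlgebra where
  carrier := {x | ∀ y : compactAlgebra, (y : SplitG2) ∈ lieOf (isotropy Θ) → inn x y = 0}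
  add_mem' := by
    intro x x' hx hx' y hy
    rw [map_add, LinearMap.add_apply, hx y hy, hx' y hy, add_zero]
  zero_mem' := by
    intro y _
    rw [map_zero, LinearMap.zero_apply]
  smul_mem' := by
    intro c x hx y hy
    rw [map_smul, LinearMap.smul_apply, hx y hy, smul_zero]

/-! ### Invariant inner products and metric operators -/

/-- `Ad(a) x = x'` for `x, x' ∈ 𝔪_Θ`. -/
def AdEq {Θ : Set (Module.Dual ℝ cartan)} (a : SplitG2 ≃ₗ[ℝ] SplitG2) (x x' : m Θ) : Prop :=
  a ((x : compactAlgebra) : SplitG2) = ((x' : compactAlgebra) : SplitG2)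

/-- `b` is an `Ad(K_Θ)`-invariant inner product on `𝔪_Θ`, that is, the value at the base point of
a `K`-invariant Riemannian metric on `𝔽_Θ = K / K_Θ`. -/
structure IsInvariantInner (Θ : Set (Module.Dual ℝ cartan)) (b : LinearMap.BilinForm ℝ (m Θ)) :
    Prop where
  symm : ∀ x y, b x y = b y x
  pos : ∀ x, x ≠ 0 → 0 < b x x
  invariant : ∀ a ∈ isotropy Θ, ∀ x y x' y' : m Θ, AdEq a x x' → AdEq a y y' → b x' y' = b x y

/-- `A` is the metric operator associated with `b`: `b x y = (A x, y)` for all `x, y ∈ 𝔪_Θ`. -/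
def IsMetricOperatorOf {Θ : Set (Module.Dual ℝ cartan)} (b : LinearMap.BilinForm ℝ (m Θ))
    (A : m Θ →ₗ[ℝ] m Θ) : Prop :=
  ∀ x y : m Θ, b x y = inn (A x : compactAlgebra) (y : compactAlgebra)

/-- `A` is the metric operator associated with some `Ad(K_Θ)`-invariant inner product. -/
def IsMetricOperator (Θ : Set (Module.Dual ℝ cartan)) (A : m Θ →ₗ[ℝ] m Θ) : Prop :=
  ∃ b : LinearMap.BilinForm ℝ (m Θ), IsInvariantInner Θ b ∧ IsMetricOperatorOf b A

/-- `B` is a `(·,·)`-orthonormal basis of `𝔪_Θ` whose vectors are the elements `w i` of `𝔤₂`. -/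
def IsOrthonormalBasisOf {Θ : Set (Module.Dual ℝ cartan)} {n : ℕ}
    (B : Module.Basis (Fin n) ℝ (m Θ)) (w : Fin n → SplitG2) : Prop :=
  (∀ i, ((B i : compactAlgebra) : SplitG2) = w i) ∧
    ∀ i j, inn (B i : compactAlgebra) (B j : compactAlgebra) = if i = j then 1 else 0

/-- `Wᵢ = (1/2) Xᵢ` (as `W 0`, `W 1`, `W 2`). -/
def W (i : Fin 3) : SplitG2 := (1 / 2 : ℝ) • X i

/-- `Z₁ = (3/8) Y₁ - (1/4) X₃`, `Z₂ = (3/8) Y₂ + (1/4) X₂`, `Z₃ = (3/8) Y₃ - (1/4) X₁`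
(as `Z 0`, `Z 1`, `Z 2`). -/
def Z : Fin 3 → SplitG2 :=
  ![(3 / 8 : ℝ) • Y 0 - (1 / 4 : ℝ) • X 2,
    (3 / 8 : ℝ) • Y 1 + (1 / 4 : ℝ) • X 1,
    (3 / 8 : ℝ) • Y 2 - (1 / 4 : ℝ) • X 0]

end SplitG2

end

/-!
Let `H_Θ ∈ 𝔥` be `diag(4, 1, -5)`, `diag(1, 1, -2)`, `diag(1, 0, -1)` for `Θ = ∅`, `{α₁}`, `{α₂}`.
Then `𝔭_Θ` is the sum of the eigenspaces of `ad(H_Θ)` with nonnegative eigenvalue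
(`parabolicAlgebra_empty`, `parabolicAlgebra_alpha₁`, `parabolicAlgebra_alpha₂`), and `H_Θ` is
chosen so that it represents, up to a factor and with respect to the invariant form `κ` of `𝔤₂`, the
linear form `y ↦ tr(ad y|𝔭_Θ)` on `𝔭_Θ`. An element `a ∈ K_Θ` is an automorphism of `𝔤₂` that
preserves `κ` and `𝔭_Θ` and commutes with the Cartan involution. Hence `y = a H_Θ - H_Θ` lies in
`𝔭_Θ`, it is anti-fixed by the Cartan involution, and `κ(y, y) = κ(a H_Θ, y) - κ(H_Θ, y) = 0`, since
`tr(ad y|𝔭_Θ)` does not change when `y` is replaced by `a⁻¹ y`. As `κ` is positive definite on the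
anti-fixed space, `a` fixes `H_Θ` (`K_apply_eq_self_of_map_nonnegWeights`). This replaces the
structure theory of parabolic subgroups.

It follows that the Lie algebra of `K_Θ` is contained in the centralizer of `H_Θ` in `𝔨`, which is
`0`, `ℝX₁`, `ℝY₂`, and that determines `𝔪_Θ`. It also follows that `K_Θ` commutes with `ad(H_Θ)²`
on `𝔨`, which is diagonal in the basis `Xᵢ, Yᵢ`. For `Θ = ∅` its eigenvalues are distinct, so `K_∅`
acts by signs, and the signs on `X₁` and `Y₃` agree because these vectors are not orthogonal for
`(·,·)`; similarly for `X₂, Y₂` and `X₃, Y₁` (`isotropy_empty_apply`). For `{α₁}` the action is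
determined by that on the lines of `X₁`, `Y₃` and on the plane of `X₂, X₃`, through the brackets
(`isotropy_alpha₁_apply`). For `{α₂}` the group acts by the same sign on `X₂` and `Y₂`, hence
commutes with `ad(Y₂)²`, whose eigenspaces give the two planes of the theorem
(`isotropy_alpha₂_apply`).

In an orthonormal basis of `𝔪_Θ` the metric operators are the positive definite symmetric matrices
that commute with the isotropy representation (`IsOrthonormalBasisOf.isMetricOperator_iff`). The
description above shows that the listed matrices commute with it. Conversely, commuting with a few
explicit elements already forces the listed shape: `e^{π ad X₁}` and `e^{π ad X₃}`, which lie in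
every `K_Θ`, together with `e^{(π/2) ad X₁}` for `{α₁}` and `e^{(3π/8) ad Y₂}` for `{α₂}`. The
bounds on the off-diagonal entries say that the `2 × 2` blocks are positive definite.
-/

/-! ### Exponential series of endomorphisms of a finite-dimensional space -/

section ExpSeries

variable {V : Type*} [AddCommGroup V] [Module ℝ V] [TopologicalSpace V]

/-- `a = e^D = ∑ Dⁿ / n!`, with pointwise convergence. No norm on `V` is chosen, so that this
specializes definitionally to `SplitG2.IsExpAd`. -/
def HasExp (D a : V →ₗ[ℝ] V) : Prop :=
  ∀ v : V, HasSum (fun n : ℕ => ((n.factorial : ℝ)⁻¹) • (D ^ n) v) (a v)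

variable [IsTopologicalAddGroup V] [ContinuousSMul ℝ V]

/-- A linear map intertwining two endomorphisms intertwines their exponentials. -/
theorem HasExp.intertwine [T2Space V] {W : Type*} [AddCommGroup W] [Module ℝ W] [TopologicalSpace W]
    [IsTopologicalAddGroup W] [ContinuousSMul ℝ W] [T2Space W] [FiniteDimensional ℝ V]
    {D a : V →ₗ[ℝ] V} {D' a' : W →ₗ[ℝ] W} (ha : HasExp D a) (ha' : HasExp D' a')
    (T : V →ₗ[ℝ] W) (hT : ∀ v, T (D v) = D' (T v)) (v : V) : T (a v) = a' (T v) := by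
  have hpow : ∀ (n : ℕ) (v : V), T ((D ^ n) v) = (D' ^ n) (T v) := by
    intro n
    induction n with
    | zero => intro v; simp
    | succ n ih => intro v; rw [pow_succ, pow_succ, Module.End.mul_apply, Module.End.mul_apply,
        ih, hT]
  have h := (ha v).map T T.continuous_of_finiteDimensional
  refine h.unique ?_
  have h' := ha' (T v)
  convert h' using 2 with n
  simp [hpow]

/-- The exponential of `D` on a plane on which `D` acts as an infinitesimal rotation. -/
theorem HasExp.apply_of_rotation [T2Space V] {D a : V →ₗ[ℝ] V} (ha : HasExp D a) {ω : ℝ} {u w : V}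
    (hu : D u = ω • w) (hw : D w = -(ω • u)) :
    a u = Real.cos ω • u + Real.sin ω • w := by
  have he : ∀ n : ℕ, (D ^ (2 * n)) u = ((-1) ^ n * ω ^ (2 * n)) • u := by
    intro n
    induction n with
    | zero => simp
    | succ n ih =>
      rw [show 2 * (n + 1) = 2 + 2 * n by ring, pow_add, Module.End.mul_apply, ih, map_smul,
        pow_two, Module.End.mul_apply, hu, map_smul, hw, smul_neg, smul_neg, smul_smul, smul_smul,
        ← neg_smul]
      congr 1
      ring
  have ho : ∀ n : ℕ, (D ^ (2 * n + 1)) u = ((-1) ^ n * ω ^ (2 * n + 1)) • w := by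
    intro n
    rw [pow_succ', Module.End.mul_apply, he, map_smul, hu, smul_smul]
    congr 1
    ring
  refine (ha u).unique (HasSum.even_add_odd ?_ ?_)
  · have h := (Real.hasSum_cos ω).smul_const u
    convert h using 2 with n
    rw [he, smul_smul]
    congr 1
    field_simp
  · have h := (Real.hasSum_sin ω).smul_const w
    convert h using 2 with n
    rw [ho, smul_smul]
    congr 1
    field_simp

theorem HasExp.apply_of_eq_zero [T2Space V] {D a : V →ₗ[ℝ] V} (ha : HasExp D a) {u : V}
    (hu : D u = 0) : a u = u := by
  have h := ha.apply_of_rotation (ω := 0) (w := 0) (u := u) (by simpa using hu) (by simp)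
  simpa using h

/-- A subspace stable under `D` is stable under `e^D`. -/
theorem HasExp.mem [T2Space V] [FiniteDimensional ℝ V] {D a : V →ₗ[ℝ] V} (ha : HasExp D a)
    {p : Submodule ℝ V} (hp : ∀ v ∈ p, D v ∈ p) {v : V} (hv : v ∈ p) : a v ∈ p := by
  have hpow : ∀ n : ℕ, (D ^ n) v ∈ p := by
    intro n
    induction n with
    | zero => simpa using hv
    | succ n ih => rw [pow_succ', Module.End.mul_apply]; exact hp _ ih
  exact p.closed_of_finiteDimensional.mem_of_tendsto (ha v)
    (Filter.Eventually.of_forall fun s => sum_mem fun n _ => p.smul_mem _ (hpow n))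

variable [FiniteDimensional ℝ V]

/-- Every endomorphism `D` has an exponential: a one-parameter group `E` of automorphisms with
`E t = e^{tD}`, whose orbit through `v` is constant only if `D v = 0`. -/
theorem exists_hasExp_smul (D : V →ₗ[ℝ] V) : ∃ E : ℝ → V ≃ₗ[ℝ] V,
    (∀ t, HasExp (t • D) (E t)) ∧ (∀ t, (E t)⁻¹ = E (-t)) ∧
      ∀ v, (∀ t, E t v = v) → D v = 0 := by
  let F := Fin (Module.finrank ℝ V) → ℝ
  let φ : V ≃ₗ[ℝ] F := LinearEquiv.ofFinrankEq V F (by simp [F])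
  obtain ⟨M, hM⟩ : ∃ M : F →L[ℝ] F, ∀ v, M (φ v) = φ (D v) :=
    ⟨LinearMap.toContinuousLinearMap (φ.toLinearMap ∘ₗ D ∘ₗ φ.symm.toLinearMap), fun v => by simp⟩
  let e : ℝ → F →L[ℝ] F := fun t => NormedSpace.exp (t • M)
  have hMn : ∀ (t : ℝ) (n : ℕ) (v : V), ((t • M) ^ n) (φ v) = φ (((t • D) ^ n) v) := by
    intro t n
    induction n with
    | zero => intro v; simp
    | succ n ih =>
      intro v
      rw [pow_succ, pow_succ, mul_apply_eq_comp, Module.End.mul_apply,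
        smul_apply, hM, LinearMap.smul_apply, ← map_smul, ih]
  have he : ∀ t, e t * e (-t) = 1 := by
    intro t
    have h : Commute (t • M) ((-t) • M) := ((Commute.refl M).smul_left t).smul_right (-t)
    let _ : NormedAlgebra ℚ (F →L[ℝ] F) := NormedAlgebra.restrictScalars ℚ ℝ _
    rw [← NormedSpace.exp_add_of_commute h, ← add_smul, add_neg_cancel, zero_smul,
      NormedSpace.exp_zero]
  have he1 : ∀ t x, e t (e (-t) x) = x := fun t x => by
    rw [← mul_apply_eq_comp, he]; rfl
  let E : ℝ → V ≃ₗ[ℝ] V := fun t =>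
    LinearEquiv.ofLinearMap
      (φ.symm.toLinearMap ∘ₗ (e t).toLinearMap ∘ₗ φ.toLinearMap)
      (φ.symm.toLinearMap ∘ₗ (e (-t)).toLinearMap ∘ₗ φ.toLinearMap)
      (by ext v; simp [he1])
      (by
        ext v
        have := he1 (-t) (φ v)
        rw [neg_neg] at this
        simp [this])
  have hE : ∀ t v, φ (E t v) = e t (φ v) := fun t v => by simp [E]
  refine ⟨E, ?_, ?_, ?_⟩
  · intro t v
    have h := NormedSpace.exp_series_hasSum_exp' (𝕂 := ℝ) (t • M)
    have h1 := h.map (ContinuousLinearMap.apply ℝ F (φ v))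
      (ContinuousLinearMap.apply ℝ F (φ v)).continuous
    have h2 := h1.map φ.symm (LinearMap.continuous_of_finiteDimensional φ.symm.toLinearMap)
    convert h2 using 2 with n
    · simp [hMn]
    · exact (φ.symm_apply_eq.2 (hE t v).symm).symm
  · intro t
    ext v
    change (E t).symm v = E (-t) v
    apply φ.injective
    rw [hE]
    simp [E]
  · intro v hv
    have hd := hasDerivAt_exp_smul_const (𝕂 := ℝ) M (0 : ℝ)
    have hd' := ((ContinuousLinearMap.apply ℝ F (φ v)).hasFDerivAt.comp_hasDerivAt (0 : ℝ) hd)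
    have hc : (ContinuousLinearMap.apply ℝ F (φ v) : (F →L[ℝ] F) → F) ∘
        (fun u : ℝ => NormedSpace.exp (u • M)) = fun _ => φ v := by
      funext t
      have := hE t v
      rw [hv t] at this
      simpa [e] using this.symm
    rw [hc] at hd'
    have h0 := hd'.unique (hasDerivAt_const (0 : ℝ) (φ v))
    apply φ.injective
    rw [← hM, map_zero]
    simpa using h0

/-- Cauchy products for a bilinear map on a finite-dimensional space. -/
theorem HasSum.bilin_antidiagonal [T2Space V] (β : V →ₗ[ℝ] V →ₗ[ℝ] V) {f g : ℕ → V} {x y : V}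
    (hf : HasSum f x) (hg : HasSum g y) :
    HasSum (fun n => ∑ kl ∈ Finset.HasAntidiagonal.antidiagonal n, β (f kl.1) (g kl.2))
      (β x y) := by
  let b := Module.finBasis ℝ V
  have key : ∀ u w : V, β u w = ∑ i, ∑ j, (b.repr u i * b.repr w j) • β (b i) (b j) := by
    intro u w
    conv_lhs => rw [← b.sum_repr u, ← b.sum_repr w]
    simp only [map_sum, LinearMap.sum_apply, map_smul, LinearMap.smul_apply, Finset.smul_sum,
      smul_smul]
    rw [Finset.sum_comm]
    simp only [mul_comm]
  have hcoord : ∀ i {f : ℕ → V} {x : V}, HasSum f x →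
      HasSum (fun n => b.repr (f n) i) (b.repr x i) := fun i f x h =>
    h.map (b.coord i) (LinearMap.continuous_of_finiteDimensional _)
  have hprod : HasSum (fun p : ℕ × ℕ => β (f p.1) (g p.2)) (β x y) := by
    rw [key x y, funext fun p : ℕ × ℕ => key (f p.1) (g p.2)]
    refine hasSum_sum fun i _ => hasSum_sum fun j _ => ?_
    have h1 := hcoord i hf
    have h2 := hcoord j hg
    have h3 : Summable fun p : ℕ × ℕ => b.repr (f p.1) i * b.repr (g p.2) j :=
      summable_mul_of_summable_norm (f := fun n => b.repr (f n) i) (g := fun n => b.repr (g n) j)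
        h1.summable.norm h2.summable.norm
    exact (h1.mul h2 h3).smul_const (β (b i) (b j))
  rw [← Finset.HasAntidiagonal.sigmaAntidiagonalEquivProd.hasSum_iff] at hprod
  exact hprod.sigma fun n => Finset.hasSum (Finset.HasAntidiagonal.antidiagonal n)
    fun kl : ℕ × ℕ => β (f kl.1) (g kl.2)

end ExpSeries

/-! ### Inner automorphisms, the Cartan involution and the invariant form -/

namespace SplitG2

instance : IsTopologicalAddGroup SplitG2 :=
  haveI : IsTopologicalAddGroup ↥(LieAlgebra.SpecialLinear.sl (Fin 3) ℝ) :=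
    inferInstanceAs (IsTopologicalAddGroup (LinearMap.ker (Matrix.traceLinearMap (Fin 3) ℝ ℝ)))
  inferInstanceAs (IsTopologicalAddGroup
    (↥(LieAlgebra.SpecialLinear.sl (Fin 3) ℝ) × (Fin 3 → ℝ) × (Fin 3 → ℝ)))

instance : ContinuousSMul ℝ SplitG2 :=
  inferInstanceAs (ContinuousSMul ℝ
    (↥(LieAlgebra.SpecialLinear.sl (Fin 3) ℝ) × (Fin 3 → ℝ) × (Fin 3 → ℝ)))

instance : T2Space SplitG2 :=
  inferInstanceAs (T2Space
    (↥(LieAlgebra.SpecialLinear.sl (Fin 3) ℝ) × (Fin 3 → ℝ) × (Fin 3 → ℝ)))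

instance : FiniteDimensional ℝ SplitG2 :=
  inferInstanceAs (FiniteDimensional ℝ
    (↥(LieAlgebra.SpecialLinear.sl (Fin 3) ℝ) × (Fin 3 → ℝ) × (Fin 3 → ℝ)))

theorem IsExpAd.hasExp {x : SplitG2} {a : SplitG2 ≃ₗ[ℝ] SplitG2} (h : IsExpAd x a) :
    HasExp (LieAlgebra.ad ℝ SplitG2 x) a := h

/-- Each `x` generates a one-parameter group `t ↦ e^{t ad x}`. -/
theorem exists_isExpAd_smul (x : SplitG2) : ∃ E : ℝ → SplitG2 ≃ₗ[ℝ] SplitG2,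
    (∀ t, IsExpAd (t • x) (E t)) ∧ (∀ t, (E t)⁻¹ = E (-t)) ∧
      ∀ v, (∀ t, E t v = v) → ⁅x, v⁆ = 0 := by
  obtain ⟨E, h₁, h₂, h₃⟩ := exists_hasExp_smul (LieAlgebra.ad ℝ SplitG2 x)
  refine ⟨E, fun t v => ?_, h₂, h₃⟩
  rw [map_smul]
  exact h₁ t v

theorem IsExpAd.eq {x : SplitG2} {a b : SplitG2 ≃ₗ[ℝ] SplitG2} (ha : IsExpAd x a)
    (hb : IsExpAd x b) : a = b :=
  LinearEquiv.ext fun v => (ha v).unique (hb v)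

theorem IsExpAd.inv {x : SplitG2} {a : SplitG2 ≃ₗ[ℝ] SplitG2} (ha : IsExpAd x a) :
    IsExpAd (-x) a⁻¹ := by
  obtain ⟨E, h₁, h₂, -⟩ := exists_isExpAd_smul x
  have h := h₁ 1
  rw [one_smul] at h
  rw [ha.eq h, h₂, ← neg_one_smul ℝ x]
  exact h₁ (-1)

/-- The exponential of an inner derivation is an automorphism of the Lie algebra. -/
theorem IsExpAd.lie {x : SplitG2} {a : SplitG2 ≃ₗ[ℝ] SplitG2} (ha : IsExpAd x a) (y z : SplitG2) :
    a ⁅y, z⁆ = ⁅a y, a z⁆ := by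
  refine (ha ⁅y, z⁆).unique ?_
  have h := HasSum.bilin_antidiagonal (LieAlgebra.ad ℝ SplitG2 : SplitG2 →ₗ[ℝ] _) (ha y) (ha z)
  refine h.congr_fun fun n => ?_
  have hl := LieDerivation.iterate_apply_lie (LieDerivation.ad ℝ SplitG2 x) n y z
  have hp : ∀ (k : ℕ) (v : SplitG2), (LieDerivation.ad ℝ SplitG2 x)^[k] v =
      ((LieAlgebra.ad ℝ SplitG2 x) ^ k) v := fun k v => by
    rw [Module.End.pow_apply, show ⇑(LieDerivation.ad ℝ SplitG2 x) = LieAlgebra.ad ℝ SplitG2 x from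
      funext fun w => by simp]
  simp only [hp] at hl
  rw [hl, Finset.smul_sum]
  refine Finset.sum_congr rfl fun kl hkl => ?_
  have hn : kl.1 + kl.2 = n := by simpa using hkl
  subst hn
  have hc : ((kl.1 + kl.2).choose kl.1 : ℝ) * kl.1.factorial * kl.2.factorial =
      (kl.1 + kl.2).factorial := by
    rw [Nat.choose_symm_add]
    exact_mod_cast Nat.add_choose_mul_factorial_mul_factorial kl.1 kl.2
  simp only [LieHom.coe_toLinearMap, LieAlgebra.ad_apply, smul_lie, lie_smul, smul_smul]
  rw [← Nat.cast_smul_eq_nsmul ℝ, smul_smul]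
  congr 1
  rw [← hc]
  have h0 : ((kl.1 + kl.2).choose kl.1 : ℝ) ≠ 0 := by
    exact_mod_cast (Nat.choose_pos (Nat.le_add_right _ _)).ne'
  field_simp

theorem K_le_G₂ : K ≤ G₂ :=
  (Subgroup.closure_le _).2 fun _ ⟨x, _, hx⟩ => Subgroup.subset_closure ⟨x, hx⟩

theorem G₂_lie {a : SplitG2 ≃ₗ[ℝ] SplitG2} (ha : a ∈ G₂) (y z : SplitG2) :
    a ⁅y, z⁆ = ⁅a y, a z⁆ := by
  induction ha using Subgroup.closure_induction generalizing y z with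
  | mem a h => obtain ⟨x, hx⟩ := h; exact hx.lie y z
  | one => rfl
  | mul a b _ _ iha ihb =>
    change a (b _) = ⁅a (b _), a (b _)⁆
    rw [ihb, iha]
  | inv a _ ih =>
    apply a.injective
    rw [ih]
    simp

/-- Conjugation by an automorphism: `a e^{ad x} a⁻¹ = e^{ad (a x)}`. -/
theorem IsExpAd.conj {x : SplitG2} {a g : SplitG2 ≃ₗ[ℝ] SplitG2} (ha : IsExpAd x a) (hg : g ∈ G₂) :
    IsExpAd (g x) (g * a * g⁻¹) := by
  obtain ⟨E, h₁, -, -⟩ := exists_isExpAd_smul (g x)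
  have h := h₁ 1
  rw [one_smul] at h
  have he : g * a * g⁻¹ = E 1 := by
    ext v
    have := ha.hasExp.intertwine h.hasExp g.toLinearMap (fun v => G₂_lie hg x v) (g⁻¹ v)
    change g (a (g⁻¹ v)) = E 1 (g (g⁻¹ v)) at this
    rw [show g (g⁻¹ v) = v from g.apply_symm_apply v] at this
    exact this
  rw [he]
  exact h

/-- The Cartan involution `(A, v, α) ↦ (-Aᵀ, -α, -v)`, with fixed point set `𝔨`. -/
def cartanInvolution : SplitG2 →ₗ[ℝ] SplitG2 where
  toFun x := of (-x.matᵀ) (by rw [Matrix.trace_neg, Matrix.trace_transpose, x.trace_mat, neg_zero])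
    (-x.cov) (-x.vec)
  map_add' x y := by
    apply ext' <;> simp only [mat_of, vec_of, cov_of, mat_add, vec_add, cov_add, neg_add,
      Matrix.transpose_add]
  map_smul' c x := by
    apply ext' <;> simp

@[simp] theorem mat_cartanInvolution (x : SplitG2) : (cartanInvolution x).mat = -x.matᵀ := rfl
@[simp] theorem vec_cartanInvolution (x : SplitG2) : (cartanInvolution x).vec = -x.cov := rfl
@[simp] theorem cov_cartanInvolution (x : SplitG2) : (cartanInvolution x).cov = -x.vec := rfl

theorem cartanInvolution_lie (x y : SplitG2) :
    cartanInvolution ⁅x, y⁆ = ⁅cartanInvolution x, cartanInvolution y⁆ := by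
  apply ext'
  · ext i j
    simp only [mat_cartanInvolution, mat_lie, Matrix.neg_apply, Matrix.transpose_apply,
      bracketMat_apply, vec_cartanInvolution, cov_cartanInvolution, Pi.neg_apply,
      eq_comm (a := j) (b := i)]
    split_ifs <;> ring
  · ext i
    simp only [vec_cartanInvolution, vec_lie_apply, cov_lie_apply, mat_cartanInvolution,
      cov_cartanInvolution, Matrix.neg_apply, Matrix.transpose_apply, Pi.neg_apply]
    ring
  · ext i
    simp only [vec_cartanInvolution, vec_lie_apply, cov_lie_apply, mat_cartanInvolution,
      cov_cartanInvolution, Matrix.neg_apply, Matrix.transpose_apply, Pi.neg_apply]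
    ring

theorem mem_compactAlgebra {x : SplitG2} :
    x ∈ compactAlgebra ↔ x.matᵀ = -x.mat ∧ x.cov = -x.vec := mem_span_XY x

theorem mem_compactAlgebra_iff_cartanInvolution {x : SplitG2} :
    x ∈ compactAlgebra ↔ cartanInvolution x = x := by
  rw [mem_compactAlgebra]
  constructor
  · rintro ⟨h₁, h₂⟩
    apply ext' <;> simp [h₁, h₂]
  · intro h
    have h₁ := congrArg mat h
    have h₂ := congrArg cov h
    rw [mat_cartanInvolution] at h₁
    rw [cov_cartanInvolution] at h₂
    exact ⟨neg_eq_iff_eq_neg.1 h₁, h₂.symm⟩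

theorem K_cartanInvolution {a : SplitG2 ≃ₗ[ℝ] SplitG2} (ha : a ∈ K) (v : SplitG2) :
    cartanInvolution (a v) = a (cartanInvolution v) := by
  induction ha using Subgroup.closure_induction generalizing v with
  | mem a h =>
    obtain ⟨x, hx, hxa⟩ := h
    refine hxa.hasExp.intertwine hxa.hasExp cartanInvolution (fun v => ?_) v
    rw [LieAlgebra.ad_apply, cartanInvolution_lie, mem_compactAlgebra_iff_cartanInvolution.1 hx]
    rfl
  | one => rfl
  | mul a b _ _ iha ihb =>
    change cartanInvolution (a (b _)) = a (b _)
    rw [iha, ihb]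
  | inv a _ ih =>
    apply a.injective
    rw [← ih]
    simp

theorem K_mem_compactAlgebra {a : SplitG2 ≃ₗ[ℝ] SplitG2} (ha : a ∈ K) {v : SplitG2}
    (hv : v ∈ compactAlgebra) : a v ∈ compactAlgebra := by
  rw [mem_compactAlgebra_iff_cartanInvolution] at hv ⊢
  rw [K_cartanInvolution ha, hv]

/-- A positive multiple of the Killing form of `𝔤₂`. -/
def invForm : LinearMap.BilinForm ℝ SplitG2 :=
  LinearMap.mk₂ ℝ (fun x y => 3 * (x.mat * y.mat).trace + 4 * (x.cov ⬝ᵥ y.vec + y.cov ⬝ᵥ x.vec))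
    (fun x x' y => by simp [add_mul]; ring) (fun c x y => by simp; ring)
    (fun x y y' => by simp [mul_add]; ring) (fun c x y => by simp; ring)

theorem invForm_apply (x y : SplitG2) : invForm x y =
    3 * (x.mat * y.mat).trace + 4 * (x.cov ⬝ᵥ y.vec + y.cov ⬝ᵥ x.vec) := rfl

theorem invForm_lie (x y z : SplitG2) : invForm ⁅x, y⁆ z = -invForm y ⁅x, z⁆ := by
  simp only [invForm_apply, Matrix.trace, Matrix.diag, Matrix.mul_apply, dotProduct,
    Fin.sum_univ_three, mat_lie, bracketMat_apply, vec_lie_apply, cov_lie_apply, Fin.reduceEq,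
    if_true, if_false, mat_two_two, Fin.isValue, Fin.reduceAdd]
  ring

theorem G₂_invForm {a : SplitG2 ≃ₗ[ℝ] SplitG2} (ha : a ∈ G₂) (y z : SplitG2) :
    invForm (a y) (a z) = invForm y z := by
  induction ha using Subgroup.closure_induction generalizing y z with
  | mem a h =>
    obtain ⟨x, hx⟩ := h
    -- `ad x` is skew for the form, so the adjoint of `e^{ad x}` is `e^{-ad x}`, termwise.
    have hpow : ∀ (n : ℕ) (v w : SplitG2), invForm (((LieAlgebra.ad ℝ SplitG2 x) ^ n) v) w =
        invForm v (((LieAlgebra.ad ℝ SplitG2 (-x)) ^ n) w) := by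
      intro n
      induction n with
      | zero => intro v w; rfl
      | succ n ih =>
        intro v w
        rw [pow_succ, pow_succ', Module.End.mul_apply, Module.End.mul_apply, ih,
          LieAlgebra.ad_apply, LieAlgebra.ad_apply, invForm_lie, neg_lie, map_neg, map_neg]
    have h1 : ∀ v w, invForm (a v) w = invForm v (a⁻¹ w) := by
      intro v w
      have e1 := (hx v).map (invForm.flip w) (LinearMap.continuous_of_finiteDimensional _)
      have e2 := (hx.inv w).map (invForm v) (LinearMap.continuous_of_finiteDimensional _)
      refine e1.unique (e2.congr_fun fun n => ?_)
      simp only [Function.comp_apply, map_smul, LinearMap.BilinForm.flip_apply, hpow]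
    rw [h1]
    exact congrArg _ (a.symm_apply_apply z)
  | one => rfl
  | mul a b _ _ iha ihb => exact (iha _ _).trans (ihb _ _)
  | inv a _ ih =>
    rw [← ih]
    congr 1 <;> [exact congrArg _ (a.apply_symm_apply y); exact a.apply_symm_apply z]

end SplitG2

/-! ### Parabolic subalgebras as sums of nonnegative weight spaces -/

namespace SplitG2

@[simp] theorem mat_neg (x : SplitG2) : (-x).mat = -x.mat := rfl
@[simp] theorem vec_neg (x : SplitG2) : (-x).vec = -x.vec := rfl
@[simp] theorem cov_neg (x : SplitG2) : (-x).cov = -x.cov := rfl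
@[simp] theorem mat_sub (x y : SplitG2) : (x - y).mat = x.mat - y.mat := rfl
@[simp] theorem vec_sub (x y : SplitG2) : (x - y).vec = x.vec - y.vec := rfl
@[simp] theorem cov_sub (x y : SplitG2) : (x - y).cov = x.cov - y.cov := rfl

theorem sum_lam (H : cartan) : lam 0 H + lam 1 H + lam 2 H = 0 := by
  have h := (H : SplitG2).trace_mat
  rwa [Matrix.trace_fin_three] at h

theorem lam_add_add (H : cartan) (i : Fin 3) : lam i H + lam (i + 1) H + lam (i + 2) H = 0 := by
  have h := sum_lam H
  fin_cases i
  · exact h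
  · change lam 1 H + lam 2 H + lam 0 H = 0
    linarith
  · change lam 2 H + lam 0 H + lam 1 H = 0
    linarith

theorem cartan_mat (H : cartan) (i j : Fin 3) :
    (H : SplitG2).mat i j = if i = j then lam i H else 0 := by
  split_ifs with h
  · subst h; rfl
  · exact H.2.1 h

theorem mat_cartan_lie (H : cartan) (x : SplitG2) (i j : Fin 3) :
    ⁅(H : SplitG2), x⁆.mat i j = (lam i H - lam j H) * x.mat i j := by
  rw [mat_lie, bracketMat_apply]
  simp only [cartan_mat, H.2.2.1, H.2.2.2, Pi.zero_apply]
  fin_cases i <;> fin_cases j <;> simp <;> ring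

theorem vec_cartan_lie (H : cartan) (x : SplitG2) (i : Fin 3) :
    ⁅(H : SplitG2), x⁆.vec i = lam i H * x.vec i := by
  rw [vec_lie_apply]
  simp only [cartan_mat, H.2.2.1, H.2.2.2, Pi.zero_apply]
  fin_cases i <;> simp

theorem cov_cartan_lie (H : cartan) (x : SplitG2) (i : Fin 3) :
    ⁅(H : SplitG2), x⁆.cov i = -lam i H * x.cov i := by
  rw [cov_lie_apply]
  simp only [cartan_mat, H.2.2.1, H.2.2.2, Pi.zero_apply]
  fin_cases i <;> simp [mul_comm]

/-- The sum of the eigenspaces of `ad H` with nonnegative eigenvalue, for `H ∈ 𝔥`: the entries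
`(i, j)` of the matrix component have weight `λᵢ - λⱼ`, the coordinates of the vector component
weight `λᵢ` and those of the covector component weight `-λᵢ`. -/
def nonnegWeights (H : cartan) : Submodule ℝ SplitG2 where
  carrier := {x | (∀ i j, lam i H < lam j H → x.mat i j = 0) ∧ (∀ i, lam i H < 0 → x.vec i = 0) ∧
    ∀ i, 0 < lam i H → x.cov i = 0}
  add_mem' := by
    rintro x y ⟨h₁, h₂, h₃⟩ ⟨k₁, k₂, k₃⟩
    exact ⟨fun i j h => by simp [h₁ i j h, k₁ i j h], fun i h => by simp [h₂ i h, k₂ i h],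
      fun i h => by simp [h₃ i h, k₃ i h]⟩
  zero_mem' := by simp
  smul_mem' := by
    rintro c x ⟨h₁, h₂, h₃⟩
    exact ⟨fun i j h => by simp [h₁ i j h], fun i h => by simp [h₂ i h],
      fun i h => by simp [h₃ i h]⟩

/-- Weights add up under the bracket, so the nonnegative ones span a subalgebra. -/
theorem nonnegWeights_lie {H : cartan} {x y : SplitG2} (hx : x ∈ nonnegWeights H)
    (hy : y ∈ nonnegWeights H) : ⁅x, y⁆ ∈ nonnegWeights H := by
  have key : ∀ {x y : SplitG2}, x ∈ nonnegWeights H → y ∈ nonnegWeights H →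
      (∀ i j k, lam i H < lam j H → x.mat i k * y.mat k j = 0) ∧
      (∀ i j, lam i H < lam j H → x.vec i * y.cov j = 0) ∧
      (∀ i k, lam i H < 0 → x.mat i k * y.vec k = 0) ∧
      (∀ i k, 0 < lam i H → x.cov k * y.mat k i = 0) ∧
      (∀ i, lam i H < 0 → x.cov (i + 1) * y.cov (i + 2) = 0) ∧
      ∀ i, 0 < lam i H → x.vec (i + 1) * y.vec (i + 2) = 0 := by
    rintro x y ⟨h₁, h₂, h₃⟩ ⟨k₁, k₂, k₃⟩
    refine ⟨fun i j k h => ?_, fun i j h => ?_, fun i k h => ?_, fun i k h => ?_, fun i h => ?_,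
      fun i h => ?_⟩
    · rcases lt_or_ge (lam i H) (lam k H) with h' | h'
      · rw [h₁ i k h', zero_mul]
      · rw [k₁ k j (by linarith), mul_zero]
    · rcases lt_or_ge (lam i H) 0 with h' | h'
      · rw [h₂ i h', zero_mul]
      · rw [k₃ j (by linarith), mul_zero]
    · rcases lt_or_ge (lam i H) (lam k H) with h' | h'
      · rw [h₁ i k h', zero_mul]
      · rw [k₂ k (by linarith), mul_zero]
    · rcases lt_or_ge (lam k H) (lam i H) with h' | h'
      · rw [k₁ k i h', mul_zero]
      · rw [h₃ k (by linarith), zero_mul]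
    · have := lam_add_add H i
      rcases lt_or_ge 0 (lam (i + 1) H) with h' | h'
      · rw [h₃ _ h', zero_mul]
      · rw [k₃ _ (by linarith), mul_zero]
    · have := lam_add_add H i
      rcases lt_or_ge (lam (i + 1) H) 0 with h' | h'
      · rw [h₂ _ h', zero_mul]
      · rw [k₂ _ (by linarith), mul_zero]
  obtain ⟨a₁, a₂, a₃, a₄, a₅, a₆⟩ := key hx hy
  obtain ⟨b₁, b₂, b₃, b₄, b₅, b₆⟩ := key hy hx
  refine ⟨fun i j h => ?_, fun i h => ?_, fun i h => ?_⟩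
  · have hij : i ≠ j := fun e => by rw [e] at h; exact lt_irrefl _ h
    rw [mat_lie, bracketMat_apply, a₁ i j 0 h, a₁ i j 1 h, a₁ i j 2 h, b₁ i j 0 h, b₁ i j 1 h,
      b₁ i j 2 h, a₂ i j h, b₂ i j h, if_neg hij]
    ring
  · rw [vec_lie_apply, a₃ i 0 h, a₃ i 1 h, a₃ i 2 h, b₃ i 0 h, b₃ i 1 h, b₃ i 2 h, a₅ i h,
      mul_comm (x.cov (i + 2)), b₅ i h]
    ring
  · rw [cov_lie_apply, a₄ i 0 h, a₄ i 1 h, a₄ i 2 h, b₄ i 0 h, b₄ i 1 h, b₄ i 2 h, a₆ i h,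
      mul_comm (x.vec (i + 2)), b₆ i h]
    ring

/-- The matrix unit `E_{ij}` for `i ≠ j`, and `E_{ii} - E_{33}` for `i = j`. -/
def unitMat (i j : Fin 3) : SplitG2 :=
  of (Matrix.single i j 1 - if i = j then Matrix.single 2 2 1 else 0)
    (by rw [Matrix.trace_sub]; split_ifs with h <;> simp [h]) 0 0

/-- The vector `eᵢ`. -/
def unitVec (i : Fin 3) : SplitG2 := of 0 (Matrix.trace_zero _ _) (Pi.single i 1) 0

/-- The covector `εᵢ`. -/
def unitCov (i : Fin 3) : SplitG2 := of 0 (Matrix.trace_zero _ _) 0 (Pi.single i 1)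

theorem eq_sum_units (x : SplitG2) : x = (∑ i, ∑ j, x.mat i j • unitMat i j) +
    (∑ i, x.vec i • unitVec i) + ∑ i, x.cov i • unitCov i := by
  apply ext'
  · ext i j
    simp only [Fin.sum_univ_three, mat_add, mat_smul]
    fin_cases i <;> fin_cases j <;> simp [unitMat, unitVec, unitCov, mat_two_two]
    ring
  · ext i
    simp only [Fin.sum_univ_three, vec_add, vec_smul]
    fin_cases i <;> simp [unitMat, unitVec, unitCov]
  · ext i
    simp only [Fin.sum_univ_three, cov_add, cov_smul]
    fin_cases i <;> simp [unitMat, unitVec, unitCov]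

theorem unitMat_self_mem (i : Fin 3) : unitMat i i ∈ cartan := by
  refine ⟨fun j k hjk => ?_, rfl, rfl⟩
  simp only [unitMat, mat_of, if_true, Matrix.sub_apply, Matrix.single_apply]
  rw [if_neg, if_neg, sub_zero] <;> rintro ⟨rfl, rfl⟩ <;> exact hjk rfl

theorem unitMat_mem_rootSpace {i j : Fin 3} (h : i ≠ j) :
    unitMat i j ∈ rootSpace (lam i - lam j) := by
  intro H
  apply ext'
  · ext k l
    rw [mat_cartan_lie, mat_smul, Matrix.smul_apply, smul_eq_mul]
    simp only [unitMat, mat_of, if_neg h, sub_zero, Matrix.single_apply]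
    split_ifs with h'
    · rw [h'.1, h'.2]; rfl
    · simp
  · ext k
    rw [vec_cartan_lie]
    simp [unitMat]
  · ext k
    rw [cov_cartan_lie]
    simp [unitMat]

theorem unitVec_mem_rootSpace (i : Fin 3) : unitVec i ∈ rootSpace (lam i) := by
  intro H
  apply ext'
  · ext k l
    rw [mat_cartan_lie]
    simp [unitVec]
  · ext k
    rw [vec_cartan_lie]
    by_cases hk : k = i
    · simp [unitVec, hk]
    · simp [unitVec, hk]
  · ext k
    rw [cov_cartan_lie]
    simp [unitVec]

theorem unitCov_mem_rootSpace (i : Fin 3) : unitCov i ∈ rootSpace (-lam i) := by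
  intro H
  apply ext'
  · ext k l
    rw [mat_cartan_lie]
    simp [unitCov]
  · ext k
    rw [vec_cartan_lie]
    simp [unitCov]
  · ext k
    rw [cov_cartan_lie]
    by_cases hk : k = i
    · simp [unitCov, hk]
    · simp [unitCov, hk]

theorem rootSpace_le_nonnegWeights {φ : Module.Dual ℝ cartan} {H : cartan} (h : 0 ≤ φ H) :
    rootSpace φ ≤ nonnegWeights H := by
  intro x hx
  refine ⟨fun i j hij => ?_, fun i hi => ?_, fun i hi => ?_⟩
  · have e := congrFun (congrFun (congrArg mat (hx H)) i) j
    rw [mat_cartan_lie, mat_smul, Matrix.smul_apply, smul_eq_mul, ← sub_eq_zero, ← sub_mul] at e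
    exact (mul_eq_zero.1 e).resolve_left (by linarith : _ < (0 : ℝ)).ne
  · have e := congrFun (congrArg vec (hx H)) i
    rw [vec_cartan_lie, vec_smul, Pi.smul_apply, smul_eq_mul, ← sub_eq_zero, ← sub_mul] at e
    exact (mul_eq_zero.1 e).resolve_left (by linarith : _ < (0 : ℝ)).ne
  · have e := congrFun (congrArg cov (hx H)) i
    rw [cov_cartan_lie, cov_smul, Pi.smul_apply, smul_eq_mul, ← sub_eq_zero, ← sub_mul] at e
    exact (mul_eq_zero.1 e).resolve_left (by linarith : _ < (0 : ℝ)).ne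

theorem cartan_le_nonnegWeights (H : cartan) : cartan ≤ nonnegWeights H := by
  rintro x ⟨h₁, h₂, h₃⟩
  exact ⟨fun i j hij => h₁ fun e => by rw [e] at hij; exact lt_irrefl _ hij,
    fun i _ => congrFun h₂ i, fun i _ => congrFun h₃ i⟩

/-- If the roots that are nonnegative on `H` are exactly the positive roots and those of `⟨Θ⟩⁻`,
then `𝔭_Θ` is the sum of the nonnegative weight spaces of `H`. -/
theorem parabolicAlgebra_eq_nonnegWeights {Θ : Set (Module.Dual ℝ cartan)} {H : cartan}
    (hpos : ∀ φ ∈ posRoots, 0 ≤ φ H) (hΘ : ∀ φ ∈ Θ, φ H = 0)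
    (h₁ : ∀ i j, i ≠ j → lam j H ≤ lam i H → lam i - lam j ∈ posRoots ∪ negSpan Θ)
    (h₂ : ∀ i, 0 ≤ lam i H → lam i ∈ posRoots ∪ negSpan Θ)
    (h₃ : ∀ i, lam i H ≤ 0 → -lam i ∈ posRoots ∪ negSpan Θ) :
    parabolicAlgebra Θ = nonnegWeights H := by
  apply le_antisymm
  · refine sup_le (sup_le (cartan_le_nonnegWeights H) (iSup₂_le fun φ hφ =>
      rootSpace_le_nonnegWeights (hpos φ hφ))) (iSup₂_le fun φ hφ =>
      rootSpace_le_nonnegWeights (le_of_eq ?_))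
    obtain ⟨-, hφ, -⟩ := hφ
    induction hφ using AddSubgroup.closure_induction with
    | mem ψ h => exact (hΘ ψ h).symm
    | zero => rfl
    | add ψ χ _ _ iha ihb => rw [LinearMap.add_apply, ← iha, ← ihb, add_zero]
    | neg ψ _ ih => rw [LinearMap.neg_apply, ← ih, neg_zero]
  · have hroot : ∀ φ ∈ posRoots ∪ negSpan Θ, rootSpace φ ≤ parabolicAlgebra Θ := by
      rintro φ (hφ | hφ)
      · exact (le_iSup₂ (f := fun ψ (_ : ψ ∈ posRoots) => rootSpace ψ) φ hφ).trans
          (le_sup_right.trans le_sup_left)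
      · exact (le_iSup₂ (f := fun ψ (_ : ψ ∈ negSpan Θ) => rootSpace ψ) φ hφ).trans le_sup_right
    rintro x ⟨k₁, k₂, k₃⟩
    rw [eq_sum_units x]
    refine add_mem (add_mem (sum_mem fun i _ => sum_mem fun j _ => ?_) (sum_mem fun i _ => ?_))
      (sum_mem fun i _ => ?_)
    · rcases eq_or_ne i j with rfl | hij
      · exact Submodule.smul_mem _ _
          ((le_sup_left.trans le_sup_left : cartan ≤ parabolicAlgebra Θ) (unitMat_self_mem i))
      rcases lt_or_ge (lam i H) (lam j H) with h | h
      · rw [k₁ i j h, zero_smul]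
        exact zero_mem _
      · exact Submodule.smul_mem _ _ (hroot _ (h₁ i j hij h) (unitMat_mem_rootSpace hij))
    · rcases lt_or_ge (lam i H) 0 with h | h
      · rw [k₂ i h, zero_smul]
        exact zero_mem _
      · exact Submodule.smul_mem _ _ (hroot _ (h₂ i h) (unitVec_mem_rootSpace i))
    · rcases lt_or_ge 0 (lam i H) with h | h
      · rw [k₃ i h, zero_smul]
        exact zero_mem _
      · exact Submodule.smul_mem _ _ (hroot _ (h₃ i h) (unitCov_mem_rootSpace i))

/-- The element `diag(p, q, -p-q)` of `𝔥`. -/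
def diagElt (p q : ℝ) : cartan :=
  ⟨of (Matrix.diagonal ![p, q, -p - q]) (by simp [Fin.sum_univ_three]) 0 0,
    Matrix.isDiag_diagonal _, rfl, rfl⟩

@[simp] theorem lam_zero_diagElt (p q : ℝ) : lam 0 (diagElt p q) = p := by
  change Matrix.diagonal ![p, q, -p - q] 0 0 = _
  simp

@[simp] theorem lam_one_diagElt (p q : ℝ) : lam 1 (diagElt p q) = q := by
  change Matrix.diagonal ![p, q, -p - q] 1 1 = _
  simp

@[simp] theorem lam_two_diagElt (p q : ℝ) : lam 2 (diagElt p q) = -p - q := by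
  change Matrix.diagonal ![p, q, -p - q] 2 2 = _
  simp

theorem posRoots_diagElt_nonneg {p q : ℝ} (hq : 0 ≤ q) (hp : q ≤ p) (φ : Module.Dual ℝ cartan)
    (hφ : φ ∈ posRoots) : 0 ≤ φ (diagElt p q) := by
  rcases hφ with ⟨i, j, hij, rfl⟩ | rfl | rfl | rfl
  · fin_cases i <;> fin_cases j <;> simp at hij ⊢ <;> linarith
  · simp; linarith
  · simpa using hq
  · simp; linarith

theorem sub_mem_posRoots {i j : Fin 3} (h : i < j) : lam i - lam j ∈ posRoots :=
  Or.inl ⟨i, j, h, rfl⟩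

theorem lam_zero_mem_posRoots : lam 0 ∈ posRoots := Or.inr (Or.inl rfl)

theorem lam_one_mem_posRoots : lam 1 ∈ posRoots := Or.inr (Or.inr (Or.inl rfl))

theorem neg_lam_two_mem_posRoots : -lam 2 ∈ posRoots := Or.inr (Or.inr (Or.inr rfl))

theorem parabolicAlgebra_empty : parabolicAlgebra ∅ = nonnegWeights (diagElt 4 1) := by
  refine parabolicAlgebra_eq_nonnegWeights (posRoots_diagElt_nonneg (by norm_num) (by norm_num))
    (by simp) ?_ ?_ ?_
  · intro i j hij h
    refine Or.inl (sub_mem_posRoots ?_)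
    fin_cases i <;> fin_cases j <;> simp at hij h ⊢ <;> norm_num at h
  · intro i h
    fin_cases i
    · exact Or.inl lam_zero_mem_posRoots
    · exact Or.inl lam_one_mem_posRoots
    · simp at h; norm_num at h
  · intro i h
    fin_cases i
    · simp at h; norm_num at h
    · simp at h; norm_num at h
    · exact Or.inl neg_lam_two_mem_posRoots

theorem parabolicAlgebra_alpha₁ : parabolicAlgebra {alpha₁} = nonnegWeights (diagElt 1 1) := by
  refine parabolicAlgebra_eq_nonnegWeights (posRoots_diagElt_nonneg (by norm_num) (by norm_num))
    (by simp [alpha₁]) ?_ ?_ ?_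
  · intro i j hij h
    rcases lt_or_gt_of_ne hij with h' | h'
    · exact Or.inl (sub_mem_posRoots h')
    · fin_cases i <;> fin_cases j <;> simp at h' h <;> try norm_num at h
      refine Or.inr ⟨Or.inl ⟨1, 0, by decide, rfl⟩, ?_, ?_⟩
      · have := neg_mem (AddSubgroup.mem_closure_of_mem (Set.mem_singleton alpha₁))
        rwa [alpha₁, neg_sub] at this
      · rw [neg_sub]
        exact sub_mem_posRoots (by decide)
  · intro i h
    fin_cases i
    · exact Or.inl lam_zero_mem_posRoots
    · exact Or.inl lam_one_mem_posRoots
    · simp at h; norm_num at h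
  · intro i h
    fin_cases i
    · simp at h; norm_num at h
    · simp at h; norm_num at h
    · exact Or.inl neg_lam_two_mem_posRoots

theorem parabolicAlgebra_alpha₂ : parabolicAlgebra {alpha₂} = nonnegWeights (diagElt 1 0) := by
  refine parabolicAlgebra_eq_nonnegWeights (posRoots_diagElt_nonneg (by norm_num) (by norm_num))
    (by simp [alpha₂]) ?_ ?_ ?_
  · intro i j hij h
    refine Or.inl (sub_mem_posRoots ?_)
    fin_cases i <;> fin_cases j <;> simp at hij h ⊢ <;> norm_num at h
  · intro i h
    fin_cases i
    · exact Or.inl lam_zero_mem_posRoots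
    · exact Or.inl lam_one_mem_posRoots
    · simp at h; norm_num at h
  · intro i h
    fin_cases i
    · simp at h; norm_num at h
    · refine Or.inr ⟨Or.inr ⟨1, Or.inr rfl⟩, ?_, ?_⟩
      · exact neg_mem (AddSubgroup.mem_closure_of_mem (Set.mem_singleton alpha₂))
      · rw [neg_neg]
        exact lam_one_mem_posRoots
    · exact Or.inl neg_lam_two_mem_posRoots

end SplitG2

/-! ### The characteristic element of a parabolic subalgebra -/

/-- The trace of an endomorphism on a stable subspace `p`, computed with a projection `Q` onto `p`,
is invariant under conjugation by an automorphism preserving `p`. -/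
theorem LinearMap.trace_conj_comp_projection {V : Type*} [AddCommGroup V] [Module ℝ V]
    [FiniteDimensional ℝ V] {p : Submodule ℝ V} {Q : V →ₗ[ℝ] V} (hQ : ∀ v, Q v ∈ p)
    (hQp : ∀ v ∈ p, Q v = v) {T : V →ₗ[ℝ] V} (hT : ∀ v ∈ p, T v ∈ p) {a : V ≃ₗ[ℝ] V}
    (ha : ∀ v ∈ p, a v ∈ p) (ha' : ∀ v ∈ p, a.symm v ∈ p) :
    LinearMap.trace ℝ V ((a.symm.toLinearMap ∘ₗ T ∘ₗ a.toLinearMap) ∘ₗ Q) =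
      LinearMap.trace ℝ V (T ∘ₗ Q) := by
  -- `Q' = a Q a⁻¹` is another projection onto `p`, so `Q Q' = Q'` and `Q' Q = Q`.
  set Q' : V →ₗ[ℝ] V := a.toLinearMap ∘ₗ Q ∘ₗ a.symm.toLinearMap with hQ'
  have h₁ : (a.symm.toLinearMap ∘ₗ T ∘ₗ a.toLinearMap) ∘ₗ Q =
      (a.symm.toLinearMap ∘ₗ (T ∘ₗ Q')) ∘ₗ a.toLinearMap := by
    ext v; simp [hQ']
  have h₂ : T ∘ₗ Q' = Q ∘ₗ (T ∘ₗ Q') := by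
    ext v
    exact (hQp _ (hT _ (ha _ (hQ _)))).symm
  have h₃ : (T ∘ₗ Q') ∘ₗ Q = T ∘ₗ Q := by
    ext v
    simp [hQ', hQp _ (ha' _ (hQ v))]
  rw [h₁, LinearMap.trace_comp_comm', ← LinearMap.comp_assoc]
  have h₄ : a.toLinearMap ∘ₗ a.symm.toLinearMap = LinearMap.id := by ext v; simp
  rw [h₄, LinearMap.id_comp, h₂, LinearMap.trace_comp_comm', h₃]

namespace SplitG2

/-- The entry `(i, j)` of the matrix component. -/
def matCoord (i j : Fin 3) : Module.Dual ℝ SplitG2 where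
  toFun x := x.mat i j
  map_add' _ _ := rfl
  map_smul' _ _ := rfl

/-- The `i`-th coordinate of the vector component. -/
def vecCoord (i : Fin 3) : Module.Dual ℝ SplitG2 where
  toFun x := x.vec i
  map_add' _ _ := rfl
  map_smul' _ _ := rfl

/-- The `i`-th coordinate of the covector component. -/
def covCoord (i : Fin 3) : Module.Dual ℝ SplitG2 where
  toFun x := x.cov i
  map_add' _ _ := rfl
  map_smul' _ _ := rfl

/-- The projection onto `nonnegWeights H` along the weight spaces of negative weight, written as a
sum of operators of rank at most one. -/
noncomputable def nonnegProj (H : cartan) : SplitG2 →ₗ[ℝ] SplitG2 :=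
  (∑ i, ∑ j, (if lam i H < lam j H then 0 else matCoord i j).smulRight (unitMat i j)) +
    (∑ i, (if lam i H < 0 then 0 else vecCoord i).smulRight (unitVec i)) +
      ∑ i, (if 0 < lam i H then 0 else covCoord i).smulRight (unitCov i)

theorem nonnegProj_mem (H : cartan) (x : SplitG2) : nonnegProj H x ∈ nonnegWeights H := by
  simp only [nonnegProj, LinearMap.add_apply, LinearMap.sum_apply, LinearMap.smulRight_apply]
  refine add_mem (add_mem (sum_mem fun i _ => sum_mem fun j _ => ?_) (sum_mem fun i _ => ?_))
    (sum_mem fun i _ => ?_)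
  · split_ifs with h
    · simp
    · refine Submodule.smul_mem _ _ ?_
      rcases eq_or_ne i j with rfl | hij
      · exact cartan_le_nonnegWeights H (unitMat_self_mem i)
      · exact rootSpace_le_nonnegWeights (by simpa using h) (unitMat_mem_rootSpace hij)
  · split_ifs with h
    · simp
    · exact Submodule.smul_mem _ _
        (rootSpace_le_nonnegWeights (not_lt.1 h) (unitVec_mem_rootSpace i))
  · split_ifs with h
    · simp
    · exact Submodule.smul_mem _ _
        (rootSpace_le_nonnegWeights (by simpa using h) (unitCov_mem_rootSpace i))

theorem nonnegProj_of_mem {H : cartan} {x : SplitG2} (hx : x ∈ nonnegWeights H) :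
    nonnegProj H x = x := by
  obtain ⟨h₁, h₂, h₃⟩ := hx
  conv_rhs => rw [eq_sum_units x]
  simp only [nonnegProj, LinearMap.add_apply, LinearMap.sum_apply, LinearMap.smulRight_apply]
  congr 1
  · congr 1
    · refine Finset.sum_congr rfl fun i _ => Finset.sum_congr rfl fun j _ => ?_
      split_ifs with h
      · rw [h₁ i j h]; rfl
      · rfl
    · refine Finset.sum_congr rfl fun i _ => ?_
      split_ifs with h
      · rw [h₂ i h]; rfl
      · rfl
  · refine Finset.sum_congr rfl fun i _ => ?_
    split_ifs with h
    · rw [h₃ i h]; rfl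
    · rfl

theorem matCoord_lie_unitMat (x : SplitG2) (i j : Fin 3) :
    matCoord i j ⁅x, unitMat i j⁆ = x.mat i i - x.mat j j := by
  change ⁅x, unitMat i j⁆.mat i j = _
  rw [mat_lie, bracketMat_apply]
  fin_cases i <;> fin_cases j <;> simp [unitMat]

theorem vecCoord_lie_unitVec (x : SplitG2) (i : Fin 3) :
    vecCoord i ⁅x, unitVec i⁆ = x.mat i i := by
  change ⁅x, unitVec i⁆.vec i = _
  rw [vec_lie_apply]
  fin_cases i <;> simp [unitVec]

theorem covCoord_lie_unitCov (x : SplitG2) (i : Fin 3) :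
    covCoord i ⁅x, unitCov i⁆ = -x.mat i i := by
  change ⁅x, unitCov i⁆.cov i = _
  rw [cov_lie_apply]
  fin_cases i <;> simp [unitCov]

/-- The trace of `ad x` on the sum of the nonnegative weight spaces is the sum of the nonnegative
weights. -/
theorem trace_ad_comp_nonnegProj (H : cartan) (x : SplitG2) :
    LinearMap.trace ℝ SplitG2 (LieAlgebra.ad ℝ SplitG2 x ∘ₗ nonnegProj H) =
      (∑ i, ∑ j, if lam i H < lam j H then 0 else x.mat i i - x.mat j j) +
        (∑ i, if lam i H < 0 then 0 else x.mat i i) +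
          ∑ i, if 0 < lam i H then 0 else -x.mat i i := by
  have hc : LieAlgebra.ad ℝ SplitG2 x ∘ₗ nonnegProj H =
      (∑ i, ∑ j, (if lam i H < lam j H then 0 else matCoord i j).smulRight ⁅x, unitMat i j⁆) +
        (∑ i, (if lam i H < 0 then 0 else vecCoord i).smulRight ⁅x, unitVec i⁆) +
          ∑ i, (if 0 < lam i H then 0 else covCoord i).smulRight ⁅x, unitCov i⁆ := by
    refine LinearMap.ext fun w => ?_
    simp only [nonnegProj, LinearMap.comp_apply, LinearMap.add_apply, LinearMap.sum_apply, map_add,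
      map_sum, LinearMap.smulRight_apply, map_smul, LieAlgebra.ad_apply]
  rw [hc, map_add, map_add]
  simp only [map_sum, LinearMap.trace_smulRight]
  congr 1
  · congr 1
    · refine Finset.sum_congr rfl fun i _ => Finset.sum_congr rfl fun j _ => ?_
      split_ifs
      · rfl
      · exact matCoord_lie_unitMat x i j
    · refine Finset.sum_congr rfl fun i _ => ?_
      split_ifs
      · rfl
      · exact vecCoord_lie_unitVec x i
  · refine Finset.sum_congr rfl fun i _ => ?_
    split_ifs
    · rfl
    · exact covCoord_lie_unitCov x i

theorem invForm_cartan (H : cartan) (x : SplitG2) :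
    invForm H x = 3 * ∑ i, lam i H * x.mat i i := by
  rw [invForm_apply, H.2.2.1, H.2.2.2]
  simp [Matrix.trace, Matrix.mul_apply, cartan_mat]

theorem eq_zero_of_invForm_self {x : SplitG2} (hx : cartanInvolution x = -x) (h : invForm x x = 0) :
    x = 0 := by
  have h₁ : ∀ i j, x.mat j i = x.mat i j := fun i j => by
    simpa using congrFun (congrFun (congrArg mat hx) i) j
  have h₂ : x.cov = x.vec := by simpa using congrArg vec hx
  rw [invForm_apply, h₂] at h
  simp only [Matrix.trace, Matrix.diag, Matrix.mul_apply, dotProduct] at h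
  rw [Finset.sum_congr rfl fun i _ => Finset.sum_congr rfl fun j _ => by rw [h₁ i j]] at h
  have n₁ : 0 ≤ ∑ i, ∑ j, x.mat i j * x.mat i j :=
    Finset.sum_nonneg fun i _ => Finset.sum_nonneg fun j _ => mul_self_nonneg _
  have n₂ : 0 ≤ ∑ i, x.vec i * x.vec i := Finset.sum_nonneg fun i _ => mul_self_nonneg _
  have z₁ : ∑ i, ∑ j, x.mat i j * x.mat i j = 0 := by linarith
  have z₂ : ∑ i, x.vec i * x.vec i = 0 := by linarith
  have v : x.vec = 0 := dotProduct_self_eq_zero.1 z₂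
  refine ext' ?_ v (h₂.trans v)
  have z := (Finset.sum_eq_zero_iff_of_nonneg
    fun i _ => Finset.sum_nonneg fun j _ => mul_self_nonneg (x.mat i j)).1 z₁
  ext i j
  exact mul_self_eq_zero.1 ((Finset.sum_eq_zero_iff_of_nonneg
    fun j _ => mul_self_nonneg (x.mat i j)).1 (z i (Finset.mem_univ i)) j (Finset.mem_univ j))

/-- Suppose that `H` represents, with respect to the invariant form and up to a factor, the linear
form `x ↦ tr (ad x)` on the sum `𝔭` of its nonnegative weight spaces. Then every element of `K`
preserving `𝔭` fixes `H`. -/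
theorem K_apply_eq_self_of_map_nonnegWeights {H : cartan} {c : ℝ}
    (hc : ∀ x : SplitG2, invForm H x =
      c * LinearMap.trace ℝ SplitG2 (LieAlgebra.ad ℝ SplitG2 x ∘ₗ nonnegProj H))
    {a : SplitG2 ≃ₗ[ℝ] SplitG2} (ha : a ∈ K)
    (hmap : (nonnegWeights H).map (a : SplitG2 →ₗ[ℝ] SplitG2) = nonnegWeights H) :
    a (H : SplitG2) = H := by
  have hp : ∀ v ∈ nonnegWeights H, a v ∈ nonnegWeights H := fun v hv => by
    rw [← hmap]; exact Submodule.mem_map_of_mem hv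
  have hp' : ∀ v ∈ nonnegWeights H, a.symm v ∈ nonnegWeights H := fun v hv => by
    rw [← hmap] at hv
    obtain ⟨w, hw, rfl⟩ := hv
    simpa using hw
  have hG := K_le_G₂ ha
  set y : SplitG2 := a H - H with hy
  have hyp : y ∈ nonnegWeights H :=
    sub_mem (hp _ (cartan_le_nonnegWeights H H.2)) (cartan_le_nonnegWeights H H.2)
  have hH : cartanInvolution (H : SplitG2) = -(H : SplitG2) := by
    apply ext'
    · ext i j
      simp only [mat_cartanInvolution, mat_neg, Matrix.neg_apply, Matrix.transpose_apply,
        cartan_mat]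
      split_ifs with h₁ h₂ h₂
      · rw [h₁]
      · exact absurd h₁.symm h₂
      · exact absurd h₂.symm h₁
      · rfl
    · rw [vec_cartanInvolution, vec_neg, H.2.2.1, H.2.2.2]
    · rw [cov_cartanInvolution, cov_neg, H.2.2.1, H.2.2.2]
  have hθ : cartanInvolution y = -y := by
    rw [hy, map_sub, K_cartanInvolution ha, hH, map_neg]
    abel
  have key : invForm (a H) y = invForm H y := by
    have e₁ : invForm (a H) y = invForm H (a.symm y) := by
      rw [← G₂_invForm hG H (a.symm y), a.apply_symm_apply]
    rw [e₁, hc, hc, ← LinearMap.trace_conj_comp_projection (a := a) (nonnegProj_mem H)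
      (fun v hv => nonnegProj_of_mem hv)
      (T := LieAlgebra.ad ℝ SplitG2 y) (fun v hv => nonnegWeights_lie hyp hv) hp hp']
    congr 3
    ext v : 1
    apply a.injective
    simp [G₂_lie hG]
  have h0 : invForm y y = 0 := by
    have e : invForm y y = invForm (a H) y - invForm H y := by
      rw [← LinearMap.sub_apply, ← map_sub]
    rw [e, key, sub_self]
  exact sub_eq_zero.1 (eq_zero_of_invForm_self hθ h0)

theorem isotropy_diagElt {Θ : Set (Module.Dual ℝ cartan)} {p q c : ℝ}
    (hΘ : parabolicAlgebra Θ = nonnegWeights (diagElt p q))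
    (hc : ∀ x : SplitG2, invForm (diagElt p q : cartan) x =
      c * LinearMap.trace ℝ SplitG2 (LieAlgebra.ad ℝ SplitG2 x ∘ₗ nonnegProj (diagElt p q)))
    {a : SplitG2 ≃ₗ[ℝ] SplitG2} (ha : a ∈ isotropy Θ) :
    a (diagElt p q : SplitG2) = diagElt p q := by
  obtain ⟨hK, -, hP⟩ := ha
  rw [hΘ] at hP
  exact K_apply_eq_self_of_map_nonnegWeights hc hK hP

/-- The values `4, 1, -5` of the `λᵢ` are such that the trace on `𝔭_∅`, the sum of the positive
roots, is a multiple of `invForm H`; the factors `9 / 2` here and `9 / 5`, `1` below are the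
ratios. -/
theorem isotropy_empty_diagElt {a : SplitG2 ≃ₗ[ℝ] SplitG2} (ha : a ∈ isotropy ∅) :
    a (diagElt 4 1 : SplitG2) = diagElt 4 1 := by
  refine isotropy_diagElt (c := 9 / 2) parabolicAlgebra_empty (fun x => ?_) ha
  rw [trace_ad_comp_nonnegProj, invForm_cartan]
  simp only [Fin.sum_univ_three, lam_zero_diagElt, lam_one_diagElt, lam_two_diagElt, mat_two_two]
  norm_num
  ring

theorem isotropy_alpha₁_diagElt {a : SplitG2 ≃ₗ[ℝ] SplitG2} (ha : a ∈ isotropy {alpha₁}) :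
    a (diagElt 1 1 : SplitG2) = diagElt 1 1 := by
  refine isotropy_diagElt (c := 9 / 5) parabolicAlgebra_alpha₁ (fun x => ?_) ha
  rw [trace_ad_comp_nonnegProj, invForm_cartan]
  simp only [Fin.sum_univ_three, lam_zero_diagElt, lam_one_diagElt, lam_two_diagElt, mat_two_two]
  norm_num
  ring

theorem isotropy_alpha₂_diagElt {a : SplitG2 ≃ₗ[ℝ] SplitG2} (ha : a ∈ isotropy {alpha₂}) :
    a (diagElt 1 0 : SplitG2) = diagElt 1 0 := by
  refine isotropy_diagElt (c := 1) parabolicAlgebra_alpha₂ (fun x => ?_) ha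
  rw [trace_ad_comp_nonnegProj, invForm_cartan]
  simp only [Fin.sum_univ_three, lam_zero_diagElt, lam_one_diagElt, lam_two_diagElt, mat_two_two]
  norm_num
  ring

end SplitG2

/-! ### The compact subalgebra in coordinates -/

namespace SplitG2

/-- The element of `𝔨` with coordinates `c` in the basis `X₁, X₂, X₃, Y₁, Y₂, Y₃`. -/
def compactElt (c : Fin 6 → ℝ) : SplitG2 :=
  of !![0, -c 0, -c 1; c 0, 0, -c 2; c 1, c 2, 0] (by simp [Matrix.trace_fin_three])
    ![c 3, c 4, c 5] (-![c 3, c 4, c 5])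

theorem compactElt_mem (c : Fin 6 → ℝ) : compactElt c ∈ compactAlgebra := by
  rw [mem_compactAlgebra]
  refine ⟨?_, rfl⟩
  ext i j
  fin_cases i <;> fin_cases j <;> simp [compactElt]

/-- The coordinates of an element of `𝔨` in the basis `X₁, X₂, X₃, Y₁, Y₂, Y₃`. -/
def compactCoord : compactAlgebra ≃ₗ[ℝ] (Fin 6 → ℝ) where
  toFun x := ![(x : SplitG2).mat 1 0, (x : SplitG2).mat 2 0, (x : SplitG2).mat 2 1,
    (x : SplitG2).vec 0, (x : SplitG2).vec 1, (x : SplitG2).vec 2]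
  invFun c := ⟨compactElt c, compactElt_mem c⟩
  map_add' x y := by
    ext i
    fin_cases i <;> rfl
  map_smul' c x := by
    ext i
    fin_cases i <;> rfl
  left_inv x := by
    obtain ⟨h₁, h₂⟩ := mem_compactAlgebra.1 x.2
    have e : ∀ i j, (x : SplitG2).mat j i = -(x : SplitG2).mat i j :=
      fun i j => congrFun (congrFun h₁ i) j
    have e0 := e 0 0
    have e1 := e 1 1
    have e2 := e 2 2
    apply Subtype.ext
    apply ext'
    · ext i j
      fin_cases i <;> fin_cases j <;> simp [compactElt, e 0 1, e 0 2, e 1 2] <;> linarith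
    · ext i
      fin_cases i <;> rfl
    · rw [h₂]
      ext i
      fin_cases i <;> rfl
  right_inv c := by
    ext i
    fin_cases i <;> rfl

theorem coe_compactCoord_symm (c : Fin 6 → ℝ) :
    (compactCoord.symm c : SplitG2) = compactElt c := rfl

theorem compactElt_compactCoord (x : compactAlgebra) : compactElt (compactCoord x) = x :=
  congrArg Subtype.val (compactCoord.symm_apply_apply x)

theorem exists_eq_compactElt {x : SplitG2} (hx : x ∈ compactAlgebra) : ∃ c, x = compactElt c :=
  ⟨compactCoord ⟨x, hx⟩, (compactElt_compactCoord ⟨x, hx⟩).symm⟩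

theorem compactElt_injective : Function.Injective compactElt := fun _ _ h =>
  compactCoord.symm.injective (Subtype.ext h)

theorem compactElt_add (c d : Fin 6 → ℝ) : compactElt (c + d) = compactElt c + compactElt d :=
  congrArg Subtype.val (map_add compactCoord.symm c d)

theorem compactElt_smul (r : ℝ) (c : Fin 6 → ℝ) : compactElt (r • c) = r • compactElt c :=
  congrArg Subtype.val (map_smul compactCoord.symm r c)

/-- The bracket of `𝔨` in the coordinates with respect to `X₁, X₂, X₃, Y₁, Y₂, Y₃`. -/
noncomputable def compactBracket (c d : Fin 6 → ℝ) : Fin 6 → ℝ :=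
  let w : Fin 6 → Fin 6 → ℝ := fun i j => c i * d j - c j * d i
  ![w 1 2 + 4 / 3 * w 3 4, -w 0 2 + 4 / 3 * w 3 5, w 0 1 + 4 / 3 * w 4 5,
    -w 0 4 - w 1 5 + 4 / 3 * w 4 5, w 0 3 - w 2 5 - 4 / 3 * w 3 5, w 1 3 + w 2 4 + 4 / 3 * w 3 4]

theorem compactElt_lie (c d : Fin 6 → ℝ) :
    ⁅compactElt c, compactElt d⁆ = compactElt (compactBracket c d) := by
  apply ext'
  · ext i j
    rw [mat_lie, bracketMat_apply]
    fin_cases i <;> fin_cases j <;> simp [compactElt, compactBracket] <;> ring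
  · ext i
    rw [vec_lie_apply]
    fin_cases i <;> simp [compactElt, compactBracket] <;> ring
  · ext i
    rw [cov_lie_apply]
    fin_cases i <;> simp [compactElt, compactBracket] <;> ring

theorem compactCoord_lie (x y : compactAlgebra) :
    compactCoord ⁅x, y⁆ = compactBracket (compactCoord x) (compactCoord y) := by
  apply compactElt_injective
  rw [← compactElt_lie, compactElt_compactCoord, compactElt_compactCoord, compactElt_compactCoord]
  rfl

/-- The form `(·,·)` in coordinates. -/
theorem inn_eq (x y : compactAlgebra) : inn x y =
    4 * (compactCoord x 0 * compactCoord y 0 + compactCoord x 1 * compactCoord y 1 +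
      compactCoord x 2 * compactCoord y 2) +
    80 / 9 * (compactCoord x 3 * compactCoord y 3 + compactCoord x 4 * compactCoord y 4 +
      compactCoord x 5 * compactCoord y 5) +
    8 / 3 * (compactCoord x 0 * compactCoord y 5 + compactCoord x 5 * compactCoord y 0 -
      (compactCoord x 1 * compactCoord y 4 + compactCoord x 4 * compactCoord y 1) +
      (compactCoord x 2 * compactCoord y 3 + compactCoord x 3 * compactCoord y 2)) := by
  change -killingForm ℝ compactAlgebra x y = _
  rw [killingForm_apply_apply, LinearMap.trace_eq_matrix_trace ℝ
    (Module.Basis.ofEquivFun compactCoord), Matrix.trace]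
  simp only [Matrix.diag, LinearMap.toMatrix_apply, Module.Basis.ofEquivFun_repr_apply,
    LinearMap.comp_apply, LieAlgebra.ad_apply, compactCoord_lie, Module.Basis.coe_ofEquivFun,
    LinearEquiv.apply_symm_apply]
  generalize compactCoord x = c
  generalize compactCoord y = d
  simp [Fin.sum_univ_succ, compactBracket]
  ring

theorem inn_self_eq_zero {x : compactAlgebra} (h : inn x x = 0) : x = 0 := by
  rw [inn_eq] at h
  apply compactCoord.injective
  rw [map_zero]
  generalize compactCoord x = c at h ⊢
  -- Completing the squares in `c 0`, `c 1` and `c 2`.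
  have s : 4 * (c 0 + 2 / 3 * c 5) ^ 2 + 4 * (c 1 - 2 / 3 * c 4) ^ 2 +
      4 * (c 2 + 2 / 3 * c 3) ^ 2 + 64 / 9 * c 3 ^ 2 + 64 / 9 * c 4 ^ 2 + 64 / 9 * c 5 ^ 2 = 0 := by
    linarith
  have p0 := sq_nonneg (c 0 + 2 / 3 * c 5)
  have p1 := sq_nonneg (c 1 - 2 / 3 * c 4)
  have p2 := sq_nonneg (c 2 + 2 / 3 * c 3)
  have p3 := sq_nonneg (c 3)
  have p4 := sq_nonneg (c 4)
  have p5 := sq_nonneg (c 5)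
  have h3 : c 3 = 0 := pow_eq_zero_iff two_ne_zero |>.1 (by linarith)
  have h4 : c 4 = 0 := pow_eq_zero_iff two_ne_zero |>.1 (by linarith)
  have h5 : c 5 = 0 := pow_eq_zero_iff two_ne_zero |>.1 (by linarith)
  have h0 : c 0 + 2 / 3 * c 5 = 0 := pow_eq_zero_iff two_ne_zero |>.1 (by linarith)
  have h1 : c 1 - 2 / 3 * c 4 = 0 := pow_eq_zero_iff two_ne_zero |>.1 (by linarith)
  have h2 : c 2 + 2 / 3 * c 3 = 0 := pow_eq_zero_iff two_ne_zero |>.1 (by linarith)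
  ext i
  fin_cases i <;> simp <;> linarith

/-- The automorphism of `𝔨` given by an element of `K`. -/
def compactAut {a : SplitG2 ≃ₗ[ℝ] SplitG2} (ha : a ∈ K) : compactAlgebra ≃ₗ⁅ℝ⁆ compactAlgebra where
  toFun x := ⟨a x, K_mem_compactAlgebra ha x.2⟩
  map_add' _ _ := Subtype.ext (map_add a _ _)
  map_smul' _ _ := Subtype.ext (map_smul a _ _)
  map_lie' := Subtype.ext (G₂_lie (K_le_G₂ ha) _ _)
  invFun x := ⟨a⁻¹ x, K_mem_compactAlgebra (inv_mem ha) x.2⟩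
  left_inv _ := Subtype.ext (a.symm_apply_apply _)
  right_inv _ := Subtype.ext (a.apply_symm_apply _)

theorem inn_compactAut {a : SplitG2 ≃ₗ[ℝ] SplitG2} (ha : a ∈ K) (x y : compactAlgebra) :
    inn (compactAut ha x) (compactAut ha y) = inn x y :=
  congrArg Neg.neg (LieAlgebra.killingForm_of_equiv_apply (compactAut ha) x y)

/-! ### Invariant inner products and metric operators on `𝔪_Θ` -/

variable {Θ : Set (Module.Dual ℝ cartan)}

/-- `Ad(K_Θ)` preserves the Lie algebra of `K_Θ`, hence also its orthogonal complement `𝔪_Θ`. -/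
theorem lieOf_isotropy_conj {a : SplitG2 ≃ₗ[ℝ] SplitG2} (ha : a ∈ isotropy Θ) {x : SplitG2}
    (hx : x ∈ lieOf (isotropy Θ)) : a x ∈ lieOf (isotropy Θ) := by
  intro t
  obtain ⟨g, hg, hgx⟩ := hx t
  refine ⟨a * g * a⁻¹, mul_mem (mul_mem ha hg) (inv_mem ha), ?_⟩
  rw [← map_smul]
  exact hgx.conj (K_le_G₂ ha.1)

theorem compactAut_mem_m {a : SplitG2 ≃ₗ[ℝ] SplitG2} (ha : a ∈ isotropy Θ) {x : compactAlgebra}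
    (hx : x ∈ m Θ) : compactAut ha.1 x ∈ m Θ := by
  intro y hy
  have h := hx ((compactAut ha.1).symm y) (lieOf_isotropy_conj (inv_mem ha) hy)
  rw [← inn_compactAut ha.1, LieEquiv.apply_symm_apply] at h
  exact h

theorem exists_adEq {a : SplitG2 ≃ₗ[ℝ] SplitG2} (ha : a ∈ isotropy Θ) (x : m Θ) :
    ∃ x' : m Θ, AdEq a x x' :=
  ⟨⟨compactAut ha.1 x, compactAut_mem_m ha x.2⟩, rfl⟩

theorem AdEq.eq_compactAut {a : SplitG2 ≃ₗ[ℝ] SplitG2} (ha : a ∈ K) {x x' : m Θ}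
    (h : AdEq a x x') : (x' : compactAlgebra) = compactAut ha x := Subtype.ext h.symm

theorem existsUnique_isMetricOperatorOf (b : LinearMap.BilinForm ℝ (m Θ)) :
    ∃! A : m Θ →ₗ[ℝ] m Θ, IsMetricOperatorOf b A := by
  let β : LinearMap.BilinForm ℝ (m Θ) := inn.restrict (m Θ)
  have hβ : ∀ x y : m Θ, β x y = inn (x : compactAlgebra) (y : compactAlgebra) := fun _ _ => rfl
  have hinj : Function.Injective β := by
    rw [← LinearMap.ker_eq_bot, LinearMap.ker_eq_bot']
    intro x hx
    apply Subtype.ext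
    apply inn_self_eq_zero
    rw [← hβ, hx]
    rfl
  let e : m Θ ≃ₗ[ℝ] Module.Dual ℝ (m Θ) :=
    LinearEquiv.ofInjectiveOfFinrankEq β hinj (Subspace.dual_finrank_eq).symm
  have he : ∀ x y, e x y = inn (x : compactAlgebra) (y : compactAlgebra) := fun _ _ => rfl
  refine ⟨e.symm.toLinearMap ∘ₗ b, fun x y => ?_, fun A hA => ?_⟩
  · rw [← he]
    simp
  · ext x : 1
    apply e.injective
    ext y
    rw [he, ← hA]
    simp

/-- A `(·,·)`-orthonormal family in `𝔪_Θ` in which every element of `𝔪_Θ` can be expanded. -/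
theorem exists_isOrthonormalBasisOf {n : ℕ} {w : Fin n → SplitG2} (u : Fin n → compactAlgebra)
    (huw : ∀ i, (u i : SplitG2) = w i) (hm : ∀ i, u i ∈ m Θ)
    (hon : ∀ i j, inn (u i) (u j) = if i = j then 1 else 0)
    (hspan : ∀ x ∈ m Θ, x ∈ Submodule.span ℝ (Set.range u)) :
    ∃ B : Module.Basis (Fin n) ℝ (m Θ), IsOrthonormalBasisOf B w := by
  let u' : Fin n → m Θ := fun i => ⟨u i, hm i⟩
  have hli : LinearIndependent ℝ u' := by
    rw [Fintype.linearIndependent_iff]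
    intro g hg i
    have h := congrArg (fun z : m Θ => inn (z : compactAlgebra) (u i)) hg
    simpa [u', map_sum, LinearMap.sum_apply, hon] using h
  have hsp : ⊤ ≤ Submodule.span ℝ (Set.range u') := by
    rintro x -
    have h := hspan x x.2
    have hr : Set.range u = (m Θ).subtype '' Set.range u' := by
      rw [← Set.range_comp]
      rfl
    rw [hr, Submodule.span_image] at h
    obtain ⟨z, hz, hzx⟩ := h
    rwa [← Subtype.ext hzx]
  refine ⟨Module.Basis.mk hli hsp, fun i => ?_, fun i j => ?_⟩
  · rw [Module.Basis.mk_apply]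
    exact huw i
  · rw [Module.Basis.mk_apply, Module.Basis.mk_apply]
    exact hon i j

/-- The inclusion `𝔪_Θ → 𝔤₂`. -/
noncomputable def mIncl (Θ : Set (Module.Dual ℝ cartan)) : m Θ →ₗ[ℝ] SplitG2 :=
  compactAlgebra.toSubmodule.subtype ∘ₗ (m Θ).subtype

theorem mIncl_injective : Function.Injective (mIncl Θ) := fun _ _ h => Subtype.ext (Subtype.ext h)

section Criterion

variable {n : ℕ} {w : Fin n → SplitG2} {B : Module.Basis (Fin n) ℝ (m Θ)}

theorem IsOrthonormalBasisOf.inn_eq_dotProduct (hB : IsOrthonormalBasisOf B w) (x y : m Θ) :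
    inn (x : compactAlgebra) (y : compactAlgebra) = B.repr x ⬝ᵥ B.repr y := by
  conv_lhs => rw [← B.sum_repr x, ← B.sum_repr y]
  simp only [Submodule.coe_sum, Submodule.coe_smul, map_sum, LinearMap.sum_apply, map_smul,
    LinearMap.smul_apply, hB.2, smul_eq_mul, mul_ite, mul_one, mul_zero, dotProduct]
  refine Finset.sum_congr rfl fun i _ => ?_
  simp [mul_comm]

/-- An element of the isotropy group acts on `𝔪_Θ` by some matrix `R`. -/
theorem IsOrthonormalBasisOf.exists_matrix (hB : IsOrthonormalBasisOf B w)
    {a : SplitG2 ≃ₗ[ℝ] SplitG2} (ha : a ∈ isotropy Θ) :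
    ∃ R : Matrix (Fin n) (Fin n) ℝ, ∀ j, a (w j) = ∑ i, R i j • w i := by
  choose x hx using fun j => exists_adEq ha (B j)
  refine ⟨fun i j => B.repr (x j) i, fun j => ?_⟩
  rw [← hB.1 j, hx j]
  have h := congrArg (mIncl Θ) (B.sum_repr (x j))
  rw [map_sum] at h
  refine h.symm.trans (Finset.sum_congr rfl fun i _ => ?_)
  rw [map_smul, ← hB.1 i]
  rfl

theorem IsOrthonormalBasisOf.repr_of_adEq (hB : IsOrthonormalBasisOf B w)
    {a : SplitG2 ≃ₗ[ℝ] SplitG2} {R : Matrix (Fin n) (Fin n) ℝ}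
    (hR : ∀ j, a (w j) = ∑ i, R i j • w i) {x x' : m Θ} (h : AdEq a x x') :
    (B.repr x' : Fin n → ℝ) = R *ᵥ B.repr x := by
  have hw : ∀ i, w i = mIncl Θ (B i) := fun i => (hB.1 i).symm
  have e : x' = ∑ i, (R *ᵥ B.repr x) i • B i := by
    apply mIncl_injective
    have h1 : mIncl Θ x' = a (mIncl Θ x) := h.symm
    rw [h1]
    conv_lhs => rw [← B.sum_repr x]
    simp only [map_sum, map_smul, ← hw, hR, Finset.smul_sum, smul_smul, Matrix.mulVec, dotProduct,
      Finset.sum_smul]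
    rw [Finset.sum_comm]
    simp only [mul_comm]
  rw [e, B.repr_sum_self]

theorem eq_of_mulVec_dotProduct {P Q : Matrix (Fin n) (Fin n) ℝ}
    (h : ∀ v v', (P *ᵥ v) ⬝ᵥ v' = (Q *ᵥ v) ⬝ᵥ v') : P = Q := by
  ext i j
  simpa using h (Pi.single j 1) (Pi.single i 1)

/-- The isotropy representation is orthogonal for `(·,·)`. -/
theorem IsOrthonormalBasisOf.transpose_mul_self (hB : IsOrthonormalBasisOf B w)
    {a : SplitG2 ≃ₗ[ℝ] SplitG2} (ha : a ∈ isotropy Θ) {R : Matrix (Fin n) (Fin n) ℝ}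
    (hR : ∀ j, a (w j) = ∑ i, R i j • w i) : Rᵀ * R = 1 := by
  refine eq_of_mulVec_dotProduct fun v v' => ?_
  obtain ⟨x, rfl⟩ := B.equivFun.surjective v
  obtain ⟨y, rfl⟩ := B.equivFun.surjective v'
  obtain ⟨x', hx⟩ := exists_adEq ha x
  obtain ⟨y', hy⟩ := exists_adEq ha y
  have h := inn_compactAut ha.1 x y
  rw [← hx.eq_compactAut ha.1, ← hy.eq_compactAut ha.1, hB.inn_eq_dotProduct,
    hB.inn_eq_dotProduct, hB.repr_of_adEq hR hx, hB.repr_of_adEq hR hy] at h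
  rw [Matrix.one_mulVec, ← Matrix.mulVec_mulVec, Matrix.mulVec_transpose,
    ← Matrix.dotProduct_mulVec]
  exact h

/-- In an orthonormal basis, the metric operators are the symmetric positive definite matrices that
commute with the isotropy representation. -/
theorem IsOrthonormalBasisOf.isMetricOperator_iff (hB : IsOrthonormalBasisOf B w)
    (A : m Θ →ₗ[ℝ] m Θ) : IsMetricOperator Θ A ↔
      (LinearMap.toMatrix B B A)ᵀ = LinearMap.toMatrix B B A ∧
      (∀ v, v ≠ 0 → 0 < v ⬝ᵥ LinearMap.toMatrix B B A *ᵥ v) ∧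
      ∀ a ∈ isotropy Θ, ∀ R : Matrix (Fin n) (Fin n) ℝ, (∀ j, a (w j) = ∑ i, R i j • w i) →
        LinearMap.toMatrix B B A * R = R * LinearMap.toMatrix B B A := by
  set M := LinearMap.toMatrix B B A with hM
  have hA : ∀ x y : m Θ, inn (A x : compactAlgebra) (y : compactAlgebra) =
      (M *ᵥ B.repr x) ⬝ᵥ B.repr y := fun x y => by
    rw [hB.inn_eq_dotProduct, hM, LinearMap.toMatrix_mulVec_repr]
  constructor
  · rintro ⟨b, hb, hbA⟩
    have hbM : ∀ x y, b x y = (M *ᵥ B.repr x) ⬝ᵥ B.repr y := fun x y => by rw [hbA, hA]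
    refine ⟨eq_of_mulVec_dotProduct fun v v' => ?_, fun v hv => ?_, fun a ha R hR => ?_⟩
    · obtain ⟨x, rfl⟩ := B.equivFun.surjective v
      obtain ⟨y, rfl⟩ := B.equivFun.surjective v'
      rw [Matrix.mulVec_transpose, ← Matrix.dotProduct_mulVec, dotProduct_comm]
      change (M *ᵥ B.repr y) ⬝ᵥ B.repr x = (M *ᵥ B.repr x) ⬝ᵥ B.repr y
      rw [← hbM, ← hbM, hb.symm]
    · obtain ⟨x, rfl⟩ := B.equivFun.surjective v
      have h := hb.pos x (fun h => hv (by rw [h, map_zero]))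
      rw [hbM, dotProduct_comm] at h
      exact h
    · have h1 : Rᵀ * R = 1 := hB.transpose_mul_self ha hR
      have h2 : Rᵀ * M * R = M := by
        refine eq_of_mulVec_dotProduct fun v v' => ?_
        obtain ⟨x, rfl⟩ := B.equivFun.surjective v
        obtain ⟨y, rfl⟩ := B.equivFun.surjective v'
        obtain ⟨x', hx⟩ := exists_adEq ha x
        obtain ⟨y', hy⟩ := exists_adEq ha y
        have h := hb.invariant a ha x y x' y' hx hy
        rw [hbM, hbM, hB.repr_of_adEq hR hx, hB.repr_of_adEq hR hy] at h
        rw [← Matrix.mulVec_mulVec, ← Matrix.mulVec_mulVec, Matrix.mulVec_transpose,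
          ← Matrix.dotProduct_mulVec]
        exact h
      calc M * R = R * Rᵀ * (M * R) := by rw [mul_eq_one_comm.1 h1, one_mul]
        _ = R * (Rᵀ * M * R) := by simp only [Matrix.mul_assoc]
        _ = R * M := by rw [h2]
  · rintro ⟨hsymm, hpos, hcomm⟩
    have hswap : ∀ v v', (M *ᵥ v) ⬝ᵥ v' = (M *ᵥ v') ⬝ᵥ v := fun v v' => by
      conv_lhs => rw [← hsymm, Matrix.mulVec_transpose, ← Matrix.dotProduct_mulVec, dotProduct_comm]
    refine ⟨(inn.restrict (m Θ)) ∘ₗ A, ⟨fun x y => ?_, fun x hx => ?_,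
      fun a ha x y x' y' hx hy => ?_⟩, fun x y => rfl⟩
    · exact (hA x y).trans ((hswap _ _).trans (hA y x).symm)
    · refine lt_of_lt_of_eq (hpos (B.repr x) fun h => hx ?_) ?_
      · exact B.equivFun.injective (by rw [map_zero]; exact h)
      · rw [dotProduct_comm]
        exact (hA x x).symm
    · obtain ⟨R, hR⟩ := hB.exists_matrix ha
      refine (hA x' y').trans (Eq.trans ?_ (hA x y).symm)
      rw [hB.repr_of_adEq hR hx, hB.repr_of_adEq hR hy, Matrix.mulVec_mulVec, hcomm a ha R hR,
        ← Matrix.mulVec_mulVec, Matrix.dotProduct_mulVec, ← Matrix.mulVec_transpose,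
        Matrix.mulVec_mulVec, hB.transpose_mul_self ha hR, Matrix.one_mulVec]

end Criterion

end SplitG2

/-! ### Elements of the isotropy groups -/

namespace SplitG2

variable {Θ : Set (Module.Dual ℝ cartan)}

theorem mem_isotropy {a : SplitG2 ≃ₗ[ℝ] SplitG2} (ha : a ∈ K)
    (h : ∀ v ∈ parabolicAlgebra Θ, a v ∈ parabolicAlgebra Θ)
    (h' : ∀ v ∈ parabolicAlgebra Θ, a⁻¹ v ∈ parabolicAlgebra Θ) : a ∈ isotropy Θ := by
  refine ⟨ha, K_le_G₂ ha, le_antisymm ?_ fun v hv => ?_⟩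
  · rintro _ ⟨v, hv, rfl⟩
    exact h v hv
  · exact ⟨a⁻¹ v, h' v hv, a.apply_symm_apply v⟩

theorem IsExpAd.mem_K {x : SplitG2} {a : SplitG2 ≃ₗ[ℝ] SplitG2} (ha : IsExpAd x a)
    (hx : x ∈ compactAlgebra) : a ∈ K :=
  Subgroup.subset_closure ⟨x, hx, ha⟩

/-- `e^{ad x}` belongs to `K_Θ` for `x ∈ 𝔨 ∩ 𝔭_Θ`, since `𝔭_Θ` is a subalgebra. -/
theorem IsExpAd.mem_isotropy {x : SplitG2} {a : SplitG2 ≃ₗ[ℝ] SplitG2} (ha : IsExpAd x a)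
    (hx : x ∈ compactAlgebra) {H : cartan} (hΘ : parabolicAlgebra Θ = nonnegWeights H)
    (hxp : x ∈ nonnegWeights H) : a ∈ isotropy Θ := by
  refine SplitG2.mem_isotropy (ha.mem_K hx) (fun v hv => ?_) fun v hv => ?_
  · rw [hΘ] at hv ⊢
    exact ha.hasExp.mem (fun w hw => nonnegWeights_lie hxp hw) hv
  · rw [hΘ] at hv ⊢
    exact ha.inv.hasExp.mem (fun w hw => nonnegWeights_lie (neg_mem hxp) hw) hv

/-- An element of `K` centralizing `𝔥` preserves all root spaces. -/
theorem mem_isotropy_of_centralizes {a : SplitG2 ≃ₗ[ℝ] SplitG2} (ha : a ∈ K)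
    (h : ∀ H : cartan, a (H : SplitG2) = H) : a ∈ isotropy Θ := by
  have key : ∀ {g : SplitG2 ≃ₗ[ℝ] SplitG2}, g ∈ K → (∀ H : cartan, g (H : SplitG2) = H) →
      ∀ v ∈ parabolicAlgebra Θ, g v ∈ parabolicAlgebra Θ := by
    intro g hgK hg
    have hroot : ∀ φ, rootSpace φ ≤ (rootSpace φ).comap g.toLinearMap := by
      intro φ v hv H
      change ⁅(H : SplitG2), g v⁆ = φ H • g v
      rw [← map_smul, ← hv H, G₂_lie (K_le_G₂ hgK), hg]
    change parabolicAlgebra Θ ≤ (parabolicAlgebra Θ).comap g.toLinearMap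
    refine sup_le (sup_le ?_ ?_) ?_
    · intro v hv
      have e : g v = v := hg ⟨v, hv⟩
      change g v ∈ parabolicAlgebra Θ
      rw [e]
      exact (le_sup_left.trans le_sup_left : cartan ≤ parabolicAlgebra Θ) hv
    · refine iSup₂_le fun φ hφ => (hroot φ).trans (Submodule.comap_mono ?_)
      exact (le_iSup₂ (f := fun ψ (_ : ψ ∈ posRoots) => rootSpace ψ) φ hφ).trans
        (le_sup_right.trans le_sup_left)
    · refine iSup₂_le fun φ hφ => (hroot φ).trans (Submodule.comap_mono ?_)
      exact (le_iSup₂ (f := fun ψ (_ : ψ ∈ negSpan Θ) => rootSpace ψ) φ hφ).trans le_sup_right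
  exact mem_isotropy ha (key ha h) (key (inv_mem ha) fun H => a.symm_apply_eq.2 (h H).symm)

theorem IsExpAd.compactElt_of_rotation {k : Fin 6 → ℝ} {a : SplitG2 ≃ₗ[ℝ] SplitG2}
    (ha : IsExpAd (compactElt k) a) {ω : ℝ} {c d : Fin 6 → ℝ} (hc : compactBracket k c = ω • d)
    (hd : compactBracket k d = -(ω • c)) :
    a (compactElt c) = Real.cos ω • compactElt c + Real.sin ω • compactElt d := by
  refine ha.hasExp.apply_of_rotation ?_ ?_
  · rw [LieAlgebra.ad_apply, compactElt_lie, hc, compactElt_smul]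
  · rw [LieAlgebra.ad_apply, compactElt_lie, hd, ← neg_smul, compactElt_smul, neg_smul]

theorem exists_isExpAd (x : SplitG2) : ∃ a, IsExpAd x a := by
  obtain ⟨E, h, -⟩ := exists_isExpAd_smul x
  exact ⟨E 1, by simpa using h 1⟩

theorem IsExpAd.compactElt_X₁ {t : ℝ} {a : SplitG2 ≃ₗ[ℝ] SplitG2}
    (ha : IsExpAd (compactElt ![t, 0, 0, 0, 0, 0]) a) (c : Fin 6 → ℝ) :
    a (compactElt c) = compactElt ![c 0, Real.cos t * c 1 - Real.sin t * c 2,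
      Real.cos t * c 2 + Real.sin t * c 1, Real.cos t * c 3 - Real.sin t * c 4,
      Real.cos t * c 4 + Real.sin t * c 3, c 5] := by
  have h₁ : a (compactElt ![c 0, 0, 0, 0, 0, c 5]) = compactElt ![c 0, 0, 0, 0, 0, c 5] := by
    have := ha.compactElt_of_rotation (ω := 0) (c := ![c 0, 0, 0, 0, 0, c 5]) (d := 0)
      (by ext i; fin_cases i <;> simp [compactBracket])
      (by ext i; fin_cases i <;> simp [compactBracket])
    simpa using this
  have h₂ := ha.compactElt_of_rotation (ω := t) (c := ![0, c 1, c 2, c 3, c 4, 0])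
    (d := ![0, -c 2, c 1, -c 4, c 3, 0]) (by ext i; fin_cases i <;> simp [compactBracket])
      (by ext i; fin_cases i <;> simp [compactBracket])
  have e : c = ![c 0, 0, 0, 0, 0, c 5] + ![0, c 1, c 2, c 3, c 4, 0] := by
    ext i; fin_cases i <;> simp
  conv_lhs => rw [e, compactElt_add, map_add, h₁, h₂]
  simp only [← compactElt_smul, ← compactElt_add]
  congr 1
  ext i
  fin_cases i <;> simp <;> ring

theorem IsExpAd.compactElt_X₃ {t : ℝ} {a : SplitG2 ≃ₗ[ℝ] SplitG2}
    (ha : IsExpAd (compactElt ![0, 0, t, 0, 0, 0]) a) (c : Fin 6 → ℝ) :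
    a (compactElt c) = compactElt ![Real.cos t * c 0 - Real.sin t * c 1,
      Real.cos t * c 1 + Real.sin t * c 0, c 2, c 3, Real.cos t * c 4 - Real.sin t * c 5,
      Real.cos t * c 5 + Real.sin t * c 4] := by
  have h₁ : a (compactElt ![0, 0, c 2, c 3, 0, 0]) = compactElt ![0, 0, c 2, c 3, 0, 0] := by
    have := ha.compactElt_of_rotation (ω := 0) (c := ![0, 0, c 2, c 3, 0, 0]) (d := 0)
      (by ext i; fin_cases i <;> simp [compactBracket])
      (by ext i; fin_cases i <;> simp [compactBracket])
    simpa using this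
  have h₂ := ha.compactElt_of_rotation (ω := t) (c := ![c 0, c 1, 0, 0, c 4, c 5])
    (d := ![-c 1, c 0, 0, 0, -c 5, c 4]) (by ext i; fin_cases i <;> simp [compactBracket])
      (by ext i; fin_cases i <;> simp [compactBracket])
  have e : c = ![0, 0, c 2, c 3, 0, 0] + ![c 0, c 1, 0, 0, c 4, c 5] := by
    ext i; fin_cases i <;> simp
  conv_lhs => rw [e, compactElt_add, map_add, h₁, h₂]
  simp only [← compactElt_smul, ← compactElt_add]
  congr 1
  ext i
  fin_cases i <;> simp <;> ring

theorem lie_X₁_diagElt (t p q : ℝ) : ⁅compactElt ![t, 0, 0, 0, 0, 0], (diagElt p q : SplitG2)⁆ =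
    (t * (p - q)) • (unitMat 0 1 + unitMat 1 0) := by
  rw [← lie_skew]
  apply ext'
  · ext i j
    rw [mat_neg, Matrix.neg_apply, mat_cartan_lie]
    fin_cases i <;> fin_cases j <;> simp [compactElt, unitMat] <;> ring
  · ext i
    rw [vec_neg, Pi.neg_apply, vec_cartan_lie]
    fin_cases i <;> simp [compactElt, unitMat]
  · ext i
    rw [cov_neg, Pi.neg_apply, cov_cartan_lie]
    fin_cases i <;> simp [compactElt, unitMat]

theorem lie_X₃_diagElt (t p q : ℝ) : ⁅compactElt ![0, 0, t, 0, 0, 0], (diagElt p q : SplitG2)⁆ =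
    (t * (2 * q + p)) • (unitMat 1 2 + unitMat 2 1) := by
  rw [← lie_skew]
  apply ext'
  · ext i j
    rw [mat_neg, Matrix.neg_apply, mat_cartan_lie]
    fin_cases i <;> fin_cases j <;> simp [compactElt, unitMat] <;> ring
  · ext i
    rw [vec_neg, Pi.neg_apply, vec_cartan_lie]
    fin_cases i <;> simp [compactElt, unitMat]
  · ext i
    rw [cov_neg, Pi.neg_apply, cov_cartan_lie]
    fin_cases i <;> simp [compactElt, unitMat]

theorem lie_X₁_unitMat (t : ℝ) : ⁅compactElt ![t, 0, 0, 0, 0, 0], unitMat 0 1 + unitMat 1 0⁆ =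
    -((2 * t) • (diagElt 1 (-1) : SplitG2)) := by
  apply ext'
  · ext i j
    rw [mat_lie, bracketMat_apply]
    fin_cases i <;> fin_cases j <;> simp [compactElt, unitMat, diagElt] <;> ring
  · ext i
    rw [vec_lie_apply]
    fin_cases i <;> simp [compactElt, unitMat, diagElt]
  · ext i
    rw [cov_lie_apply]
    fin_cases i <;> simp [compactElt, unitMat, diagElt]

theorem lie_X₃_unitMat (t : ℝ) : ⁅compactElt ![0, 0, t, 0, 0, 0], unitMat 1 2 + unitMat 2 1⁆ =
    -((2 * t) • (diagElt 0 1 : SplitG2)) := by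
  apply ext'
  · ext i j
    rw [mat_lie, bracketMat_apply]
    fin_cases i <;> fin_cases j <;> simp [compactElt, unitMat, diagElt] <;> ring
  · ext i
    rw [vec_lie_apply]
    fin_cases i <;> simp [compactElt, unitMat, diagElt]
  · ext i
    rw [cov_lie_apply]
    fin_cases i <;> simp [compactElt, unitMat, diagElt]

theorem eq_diagElt (H : cartan) : H = diagElt (lam 0 H) (lam 1 H) := by
  have h := sum_lam H
  apply Subtype.ext
  apply ext'
  · ext i j
    rw [cartan_mat, cartan_mat]
    fin_cases i <;> fin_cases j <;> simp
    linarith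
  · rw [H.2.2.1]; rfl
  · rw [H.2.2.2]; rfl

theorem diagElt_add (p q p' q' : ℝ) : diagElt (p + p') (q + q') = diagElt p q + diagElt p' q' := by
  rw [eq_diagElt (diagElt p q + diagElt p' q')]
  simp

theorem diagElt_smul (r p q : ℝ) : diagElt (r * p) (r * q) = r • diagElt p q := by
  rw [eq_diagElt (r • diagElt p q)]
  simp

/-- `e^{π ad X₁}`, the automorphism induced by `diag(-1, -1, 1)`, lies in every `K_Θ`. -/
theorem exists_isotropy_X₁ : ∃ a : SplitG2 ≃ₗ[ℝ] SplitG2, (∀ Θ, a ∈ isotropy Θ) ∧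
    ∀ c, a (compactElt c) = compactElt ![c 0, -c 1, -c 2, -c 3, -c 4, c 5] := by
  obtain ⟨a, ha⟩ := exists_isExpAd (compactElt ![Real.pi, 0, 0, 0, 0, 0])
  refine ⟨a, fun Θ => mem_isotropy_of_centralizes (ha.mem_K (compactElt_mem _)) fun H => ?_,
    fun c => ?_⟩
  · have h₁ : a (diagElt 1 (-1) : SplitG2) = diagElt 1 (-1) := by
      have := ha.hasExp.apply_of_rotation (ω := 2 * Real.pi) (u := (diagElt 1 (-1) : SplitG2))
        (w := unitMat 0 1 + unitMat 1 0)
        (by rw [LieAlgebra.ad_apply, lie_X₁_diagElt]; congr 1; ring)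
        (by rw [LieAlgebra.ad_apply, lie_X₁_unitMat])
      simpa using this
    have h₂ : a (diagElt 1 1 : SplitG2) = diagElt 1 1 := by
      refine ha.hasExp.apply_of_eq_zero ?_
      rw [LieAlgebra.ad_apply, lie_X₁_diagElt, sub_self, mul_zero, zero_smul]
    have e : H = ((lam 0 H - lam 1 H) / 2) • diagElt 1 (-1) +
        ((lam 0 H + lam 1 H) / 2) • diagElt 1 1 := by
      rw [← diagElt_smul, ← diagElt_smul, ← diagElt_add]
      conv_lhs => rw [eq_diagElt H]
      congr 1 <;> ring
    rw [e, Submodule.coe_add, Submodule.coe_smul, Submodule.coe_smul, map_add, map_smul, map_smul,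
      h₁, h₂]
  · rw [ha.compactElt_X₁]
    simp

/-- `e^{π ad X₃}`, the automorphism induced by `diag(1, -1, -1)`, lies in every `K_Θ`. -/
theorem exists_isotropy_X₃ : ∃ a : SplitG2 ≃ₗ[ℝ] SplitG2, (∀ Θ, a ∈ isotropy Θ) ∧
    ∀ c, a (compactElt c) = compactElt ![-c 0, -c 1, c 2, c 3, -c 4, -c 5] := by
  obtain ⟨a, ha⟩ := exists_isExpAd (compactElt ![0, 0, Real.pi, 0, 0, 0])
  refine ⟨a, fun Θ => mem_isotropy_of_centralizes (ha.mem_K (compactElt_mem _)) fun H => ?_,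
    fun c => ?_⟩
  · have h₁ : a (diagElt 0 1 : SplitG2) = diagElt 0 1 := by
      have := ha.hasExp.apply_of_rotation (ω := 2 * Real.pi) (u := (diagElt 0 1 : SplitG2))
        (w := unitMat 1 2 + unitMat 2 1)
        (by rw [LieAlgebra.ad_apply, lie_X₃_diagElt]; congr 1; ring)
        (by rw [LieAlgebra.ad_apply, lie_X₃_unitMat])
      simpa using this
    have h₂ : a (diagElt (-2) 1 : SplitG2) = diagElt (-2) 1 := by
      refine ha.hasExp.apply_of_eq_zero ?_
      rw [LieAlgebra.ad_apply, lie_X₃_diagElt]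
      simp
    have e : H = (lam 1 H + lam 0 H / 2) • diagElt 0 1 + (-lam 0 H / 2) • diagElt (-2) 1 := by
      rw [← diagElt_smul, ← diagElt_smul, ← diagElt_add]
      conv_lhs => rw [eq_diagElt H]
      congr 1 <;> ring
    rw [e, Submodule.coe_add, Submodule.coe_smul, Submodule.coe_smul, map_add, map_smul, map_smul,
      h₁, h₂]
  · rw [ha.compactElt_X₃]
    simp

theorem X₁_mem_nonnegWeights (t : ℝ) :
    compactElt ![t, 0, 0, 0, 0, 0] ∈ nonnegWeights (diagElt 1 1) := by
  refine ⟨fun i j h => ?_, fun i h => ?_, fun i h => ?_⟩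
  · fin_cases i <;> fin_cases j <;> simp [compactElt] at h ⊢
  · fin_cases i <;> simp [compactElt]
  · fin_cases i <;> simp [compactElt]

theorem Y₂_mem_nonnegWeights (t : ℝ) :
    compactElt ![0, 0, 0, 0, t, 0] ∈ nonnegWeights (diagElt 1 0) := by
  refine ⟨fun i j h => ?_, fun i h => ?_, fun i h => ?_⟩
  · fin_cases i <;> fin_cases j <;> simp [compactElt]
  · fin_cases i <;> simp [compactElt] at h ⊢
  · fin_cases i <;> simp [compactElt] at h ⊢

/-- A quarter turn `e^{(π/2) ad X₁}`. -/
theorem exists_isotropy_alpha₁ : ∃ a ∈ isotropy {alpha₁},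
    ∀ c, a (compactElt c) = compactElt ![c 0, -c 2, c 1, -c 4, c 3, c 5] := by
  obtain ⟨a, ha⟩ := exists_isExpAd (compactElt ![Real.pi / 2, 0, 0, 0, 0, 0])
  refine ⟨a, ha.mem_isotropy (compactElt_mem _) parabolicAlgebra_alpha₁ (X₁_mem_nonnegWeights _),
    fun c => ?_⟩
  rw [ha.compactElt_X₁]
  simp

/-- `e^{(3π/8) ad Y₂}` turns the plane of `W₁ + Z₃, W₃ + Z₁` by the angle `3π/4` and the plane of
`W₁ - Z₃, W₃ - Z₁` by `-π/4`. -/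
theorem exists_isotropy_alpha₂ : ∃ a ∈ isotropy {alpha₂},
    a (compactElt ![0, 5 / 4, 0, 0, 3 / 8, 0]) = compactElt ![0, 5 / 4, 0, 0, 3 / 8, 0] ∧
    a (compactElt ![1 / 4, 0, 0, 0, 0, 3 / 8]) =
      -(√2 / 2) • compactElt ![1 / 4, 0, 0, 0, 0, 3 / 8] +
        (√2 / 2) • compactElt ![0, 0, 1 / 4, 3 / 8, 0, 0] ∧
    a (compactElt ![0, 0, 1 / 4, 3 / 8, 0, 0]) =
      -(√2 / 2) • compactElt ![1 / 4, 0, 0, 0, 0, 3 / 8] +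
        -(√2 / 2) • compactElt ![0, 0, 1 / 4, 3 / 8, 0, 0] ∧
    a (compactElt ![3 / 4, 0, 0, 0, 0, -(3 / 8)]) =
      (√2 / 2) • compactElt ![3 / 4, 0, 0, 0, 0, -(3 / 8)] +
        -(√2 / 2) • compactElt ![0, 0, 3 / 4, -(3 / 8), 0, 0] ∧
    a (compactElt ![0, 0, 3 / 4, -(3 / 8), 0, 0]) =
      (√2 / 2) • compactElt ![3 / 4, 0, 0, 0, 0, -(3 / 8)] +
        (√2 / 2) • compactElt ![0, 0, 3 / 4, -(3 / 8), 0, 0] := by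
  obtain ⟨a, ha⟩ := exists_isExpAd (compactElt ![0, 0, 0, 0, 3 * Real.pi / 8, 0])
  have hcos : Real.cos (3 * Real.pi / 4) = -(√2 / 2) := by
    rw [show 3 * Real.pi / 4 = Real.pi - Real.pi / 4 by ring, Real.cos_pi_sub, Real.cos_pi_div_four]
  have hsin : Real.sin (3 * Real.pi / 4) = √2 / 2 := by
    rw [show 3 * Real.pi / 4 = Real.pi - Real.pi / 4 by ring, Real.sin_pi_sub, Real.sin_pi_div_four]
  refine ⟨a, ha.mem_isotropy (compactElt_mem _) parabolicAlgebra_alpha₂ (Y₂_mem_nonnegWeights _),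
    ?_, ?_, ?_, ?_, ?_⟩
  · have := ha.compactElt_of_rotation (ω := 0) (c := ![0, 5 / 4, 0, 0, 3 / 8, 0]) (d := 0)
      (by ext i; fin_cases i <;> simp [compactBracket])
      (by ext i; fin_cases i <;> simp [compactBracket])
    simpa using this
  · have := ha.compactElt_of_rotation (ω := 3 * Real.pi / 4) (c := ![1 / 4, 0, 0, 0, 0, 3 / 8])
      (d := ![0, 0, 1 / 4, 3 / 8, 0, 0])
      (by ext i; fin_cases i <;> simp [compactBracket] <;> ring)
      (by ext i; fin_cases i <;> simp [compactBracket] <;> ring)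
    rwa [hcos, hsin] at this
  · have := ha.compactElt_of_rotation (ω := 3 * Real.pi / 4) (c := ![0, 0, 1 / 4, 3 / 8, 0, 0])
      (d := -![1 / 4, 0, 0, 0, 0, 3 / 8])
      (by ext i; fin_cases i <;> simp [compactBracket] <;> ring)
      (by ext i; fin_cases i <;> simp [compactBracket] <;> ring)
    rw [hcos, hsin, ← neg_one_smul ℝ ![_, _, _, _, _, _], compactElt_smul, smul_smul] at this
    rw [this, add_comm]
    simp
  · have := ha.compactElt_of_rotation (ω := Real.pi / 4) (c := ![3 / 4, 0, 0, 0, 0, -(3 / 8)])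
      (d := -![0, 0, 3 / 4, -(3 / 8), 0, 0])
      (by ext i; fin_cases i <;> simp [compactBracket] <;> ring)
      (by ext i; fin_cases i <;> simp [compactBracket] <;> ring)
    rw [Real.cos_pi_div_four, Real.sin_pi_div_four, ← neg_one_smul ℝ ![_, _, _, _, _, _],
      compactElt_smul, smul_smul] at this
    rw [this]
    simp
  · have := ha.compactElt_of_rotation (ω := Real.pi / 4) (c := ![0, 0, 3 / 4, -(3 / 8), 0, 0])
      (d := ![3 / 4, 0, 0, 0, 0, -(3 / 8)])
      (by ext i; fin_cases i <;> simp [compactBracket] <;> ring)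
      (by ext i; fin_cases i <;> simp [compactBracket] <;> ring)
    rw [Real.cos_pi_div_four, Real.sin_pi_div_four] at this
    rw [this, add_comm]

end SplitG2

/-! ### The Lie algebras of the isotropy groups and the spaces `𝔪_Θ` -/

namespace SplitG2

variable {Θ : Set (Module.Dual ℝ cartan)}

/-- `ad(H)²` is diagonal on `𝔨` in the basis `X₁, X₂, X₃, Y₁, Y₂, Y₃`. -/
theorem lie_lie_compactElt (H : cartan) (c : Fin 6 → ℝ) :
    ⁅(H : SplitG2), ⁅(H : SplitG2), compactElt c⁆⁆ =
      compactElt ![(lam 0 H - lam 1 H) ^ 2 * c 0, (lam 0 H - lam 2 H) ^ 2 * c 1,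
        (lam 1 H - lam 2 H) ^ 2 * c 2, lam 0 H ^ 2 * c 3, lam 1 H ^ 2 * c 4,
        lam 2 H ^ 2 * c 5] := by
  apply ext'
  · ext i j
    rw [mat_cartan_lie, mat_cartan_lie]
    fin_cases i <;> fin_cases j <;> simp [compactElt] <;> ring
  · ext i
    rw [vec_cartan_lie, vec_cartan_lie]
    fin_cases i <;> simp [compactElt] <;> ring
  · ext i
    rw [cov_cartan_lie, cov_cartan_lie]
    fin_cases i <;> simp [compactElt] <;> ring

theorem lie_eq_zero_of_mem_lieOf {S : Subgroup (SplitG2 ≃ₗ[ℝ] SplitG2)} {x v : SplitG2}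
    (hx : x ∈ lieOf S) (hv : ∀ a ∈ S, a v = v) : ⁅x, v⁆ = 0 := by
  obtain ⟨E, h₁, -, h₃⟩ := exists_isExpAd_smul x
  refine h₃ v fun t => ?_
  obtain ⟨a, haS, ha⟩ := hx t
  rw [← ha.eq (h₁ t)]
  exact hv a haS

/-- The components of an element of the Lie algebra of `K_Θ` are killed by the weights of any
`H ∈ 𝔥` fixed by `K_Θ`. -/
theorem compactElt_of_mem_lieOf {c : Fin 6 → ℝ} (hc : compactElt c ∈ lieOf (isotropy Θ))
    {H : cartan} (hH : ∀ a ∈ isotropy Θ, a (H : SplitG2) = H) :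
    (lam 0 H - lam 1 H) ^ 2 * c 0 = 0 ∧ (lam 0 H - lam 2 H) ^ 2 * c 1 = 0 ∧
      (lam 1 H - lam 2 H) ^ 2 * c 2 = 0 ∧ lam 0 H ^ 2 * c 3 = 0 ∧ lam 1 H ^ 2 * c 4 = 0 ∧
        lam 2 H ^ 2 * c 5 = 0 := by
  have h := lie_eq_zero_of_mem_lieOf hc hH
  have h' := lie_lie_compactElt H c
  rw [show ⁅(H : SplitG2), compactElt c⁆ = 0 by rw [← lie_skew, h, neg_zero], lie_zero] at h'
  have h0 : compactElt 0 = 0 := by simpa using compactElt_smul 0 0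
  rw [← h0] at h'
  have e := compactElt_injective h'
  exact ⟨(congrFun e 0).symm, (congrFun e 1).symm, (congrFun e 2).symm, (congrFun e 3).symm,
    (congrFun e 4).symm, (congrFun e 5).symm⟩

theorem mem_m_empty (x : compactAlgebra) : x ∈ m ∅ := by
  intro y hy
  obtain ⟨c, rfl⟩ := compactCoord.symm.surjective y
  obtain ⟨h0, h1, h2, h3, h4, h5⟩ := compactElt_of_mem_lieOf (H := diagElt 4 1) hy
    fun a ha => isotropy_empty_diagElt ha
  simp only [lam_zero_diagElt, lam_one_diagElt, lam_two_diagElt] at h0 h1 h2 h3 h4 h5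
  have hc : c = 0 := by
    ext i
    fin_cases i <;> simp <;> linarith
  rw [hc, map_zero, map_zero]

theorem mem_m_alpha₁ {x : compactAlgebra} :
    x ∈ m {alpha₁} ↔ 3 * compactCoord x 0 + 2 * compactCoord x 5 = 0 := by
  constructor
  · intro hx
    have h := hx (compactCoord.symm ![1, 0, 0, 0, 0, 0]) fun t => by
      obtain ⟨a, ha⟩ := exists_isExpAd (compactElt ![t, 0, 0, 0, 0, 0])
      refine ⟨a, ha.mem_isotropy (compactElt_mem _) parabolicAlgebra_alpha₁
        (X₁_mem_nonnegWeights _), ?_⟩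
      rw [coe_compactCoord_symm, ← compactElt_smul]
      simpa using ha
    rw [inn_eq, LinearEquiv.apply_symm_apply] at h
    simp at h
    linarith
  · intro hx y hy
    obtain ⟨c, rfl⟩ := compactCoord.symm.surjective y
    obtain ⟨h0, h1, h2, h3, h4, h5⟩ := compactElt_of_mem_lieOf (H := diagElt 1 1) hy
      fun a ha => isotropy_alpha₁_diagElt ha
    simp only [lam_zero_diagElt, lam_one_diagElt, lam_two_diagElt] at h0 h1 h2 h3 h4 h5
    rw [inn_eq, LinearEquiv.apply_symm_apply, show c 1 = 0 by linarith, show c 2 = 0 by linarith,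
      show c 3 = 0 by linarith, show c 4 = 0 by linarith, show c 5 = 0 by linarith]
    linear_combination 4 / 3 * c 0 * hx

theorem mem_m_alpha₂ {x : compactAlgebra} :
    x ∈ m {alpha₂} ↔ 10 * compactCoord x 4 = 3 * compactCoord x 1 := by
  constructor
  · intro hx
    have h := hx (compactCoord.symm ![0, 0, 0, 0, 1, 0]) fun t => by
      obtain ⟨a, ha⟩ := exists_isExpAd (compactElt ![0, 0, 0, 0, t, 0])
      refine ⟨a, ha.mem_isotropy (compactElt_mem _) parabolicAlgebra_alpha₂
        (Y₂_mem_nonnegWeights _), ?_⟩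
      rw [coe_compactCoord_symm, ← compactElt_smul]
      simpa using ha
    rw [inn_eq, LinearEquiv.apply_symm_apply] at h
    simp at h
    linarith
  · intro hx y hy
    obtain ⟨c, rfl⟩ := compactCoord.symm.surjective y
    obtain ⟨h0, h1, h2, h3, h4, h5⟩ := compactElt_of_mem_lieOf (H := diagElt 1 0) hy
      fun a ha => isotropy_alpha₂_diagElt ha
    simp only [lam_zero_diagElt, lam_one_diagElt, lam_two_diagElt] at h0 h1 h2 h3 h4 h5
    rw [inn_eq, LinearEquiv.apply_symm_apply, show c 0 = 0 by linarith, show c 1 = 0 by linarith,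
      show c 2 = 0 by linarith, show c 3 = 0 by linarith, show c 5 = 0 by linarith]
    linear_combination 8 / 9 * c 4 * hx

/-! ### The isotropy representations -/

theorem K_inn {a : SplitG2 ≃ₗ[ℝ] SplitG2} (ha : a ∈ K) {c d c' d' : Fin 6 → ℝ}
    (hc : a (compactElt c) = compactElt c') (hd : a (compactElt d) = compactElt d') :
    inn (compactCoord.symm c') (compactCoord.symm d') =
      inn (compactCoord.symm c) (compactCoord.symm d) := by
  have e₁ : compactAut ha (compactCoord.symm c) = compactCoord.symm c' := Subtype.ext hc
  have e₂ : compactAut ha (compactCoord.symm d) = compactCoord.symm d' := Subtype.ext hd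
  rw [← e₁, ← e₂, inn_compactAut]

theorem compactElt_eq_sum (c : Fin 6 → ℝ) : compactElt c =
    c 0 • compactElt ![1, 0, 0, 0, 0, 0] + c 1 • compactElt ![0, 1, 0, 0, 0, 0] +
      c 2 • compactElt ![0, 0, 1, 0, 0, 0] + c 3 • compactElt ![0, 0, 0, 1, 0, 0] +
      c 4 • compactElt ![0, 0, 0, 0, 1, 0] + c 5 • compactElt ![0, 0, 0, 0, 0, 1] := by
  simp only [← compactElt_smul, ← compactElt_add]
  congr 1
  ext i
  fin_cases i <;> simp

/-- An automorphism in `K` fixing `H` preserves the eigenspaces of `ad(H)²` in `𝔨`. -/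
theorem exists_compactElt_of_fixes {a : SplitG2 ≃ₗ[ℝ] SplitG2} (ha : a ∈ K) {H : cartan}
    (hH : a (H : SplitG2) = H) {s : ℝ} {c : Fin 6 → ℝ}
    (hc : ![(lam 0 H - lam 1 H) ^ 2 * c 0, (lam 0 H - lam 2 H) ^ 2 * c 1,
        (lam 1 H - lam 2 H) ^ 2 * c 2, lam 0 H ^ 2 * c 3, lam 1 H ^ 2 * c 4, lam 2 H ^ 2 * c 5] =
      s • c) :
    ∃ d, a (compactElt c) = compactElt d ∧
      ((lam 0 H - lam 1 H) ^ 2 - s) * d 0 = 0 ∧ ((lam 0 H - lam 2 H) ^ 2 - s) * d 1 = 0 ∧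
      ((lam 1 H - lam 2 H) ^ 2 - s) * d 2 = 0 ∧ (lam 0 H ^ 2 - s) * d 3 = 0 ∧
      (lam 1 H ^ 2 - s) * d 4 = 0 ∧ (lam 2 H ^ 2 - s) * d 5 = 0 := by
  obtain ⟨d, hd⟩ := exists_eq_compactElt (K_mem_compactAlgebra ha (compactElt_mem c))
  refine ⟨d, hd, ?_⟩
  have h := congrArg a (lie_lie_compactElt H c)
  rw [hc, G₂_lie (K_le_G₂ ha), G₂_lie (K_le_G₂ ha), hH, compactElt_smul, map_smul, hd,
    lie_lie_compactElt, ← compactElt_smul] at h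
  have e := compactElt_injective h
  have e0 : (lam 0 H - lam 1 H) ^ 2 * d 0 = s * d 0 := congrFun e 0
  have e1 : (lam 0 H - lam 2 H) ^ 2 * d 1 = s * d 1 := congrFun e 1
  have e2 : (lam 1 H - lam 2 H) ^ 2 * d 2 = s * d 2 := congrFun e 2
  have e3 : lam 0 H ^ 2 * d 3 = s * d 3 := congrFun e 3
  have e4 : lam 1 H ^ 2 * d 4 = s * d 4 := congrFun e 4
  have e5 : lam 2 H ^ 2 * d 5 = s * d 5 := congrFun e 5
  refine ⟨?_, ?_, ?_, ?_, ?_, ?_⟩ <;> linarith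

theorem K_lie_compactElt {a : SplitG2 ≃ₗ[ℝ] SplitG2} (ha : a ∈ K) {c d c' d' : Fin 6 → ℝ}
    (hc : a (compactElt c) = compactElt c') (hd : a (compactElt d) = compactElt d') :
    a (compactElt (compactBracket c d)) = compactElt (compactBracket c' d') := by
  rw [← compactElt_lie, G₂_lie (K_le_G₂ ha), hc, hd, compactElt_lie]

theorem compactBracket_smul_left (r : ℝ) (c d : Fin 6 → ℝ) :
    compactBracket (r • c) d = r • compactBracket c d := by
  ext i
  fin_cases i <;> simp [compactBracket] <;> ring

theorem compactBracket_smul_right (r : ℝ) (c d : Fin 6 → ℝ) :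
    compactBracket c (r • d) = r • compactBracket c d := by
  ext i
  fin_cases i <;> simp [compactBracket] <;> ring

/-- Two preserved lines that are not orthogonal to each other are multiplied by the same sign. -/
theorem eq_of_inn_ne_zero {a : SplitG2 ≃ₗ[ℝ] SplitG2} (ha : a ∈ K) {c d : Fin 6 → ℝ} {r s : ℝ}
    (hc : a (compactElt c) = compactElt (r • c)) (hd : a (compactElt d) = compactElt (s • d))
    (h : inn (compactCoord.symm c) (compactCoord.symm d) ≠ 0) : r ^ 2 = 1 ∧ s = r := by
  have h₁ := K_inn ha hc hc
  have h₂ := K_inn ha hc hd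
  simp only [map_smul, LinearMap.smul_apply, smul_eq_mul] at h₁ h₂
  have hne : inn (compactCoord.symm c) (compactCoord.symm c) ≠ 0 := fun h0 => by
    rw [inn_self_eq_zero h0] at h
    simp at h
  have hr : r * r = 1 := mul_right_cancel₀ hne (by rw [one_mul, mul_assoc]; exact h₁)
  have hs : r * s = 1 := mul_right_cancel₀ h (by linear_combination h₂)
  exact ⟨by rw [sq, hr], by linear_combination r * hs - s * hr⟩

/-- The group `K_∅` acts on `𝔨` by signs. They agree on `X₁, Y₃`, on `X₂, Y₂` and on `X₃, Y₁`, as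
these pairs are not orthogonal. -/
theorem isotropy_empty_apply {a : SplitG2 ≃ₗ[ℝ] SplitG2} (ha : a ∈ isotropy ∅) :
    ∃ r₁ r₂ r₃ : ℝ, ∀ c, a (compactElt c) =
      compactElt ![r₁ * c 0, r₂ * c 1, r₃ * c 2, r₃ * c 3, r₂ * c 4, r₁ * c 5] := by
  have hH := isotropy_empty_diagElt ha
  -- `ad(H)²` has the distinct eigenvalues `9, 81, 36, 16, 1, 25` for `H = diag(4, 1, -5)`.
  obtain ⟨d₀, h₀, p⟩ := exists_compactElt_of_fixes ha.1 hH (s := 9) (c := ![1, 0, 0, 0, 0, 0])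
    (by ext i; fin_cases i <;> simp; norm_num)
  obtain ⟨d₁, h₁, p₁⟩ := exists_compactElt_of_fixes ha.1 hH (s := 81) (c := ![0, 1, 0, 0, 0, 0])
    (by ext i; fin_cases i <;> simp; norm_num)
  obtain ⟨d₂, h₂, p₂⟩ := exists_compactElt_of_fixes ha.1 hH (s := 36) (c := ![0, 0, 1, 0, 0, 0])
    (by ext i; fin_cases i <;> simp; norm_num)
  obtain ⟨d₃, h₃, p₃⟩ := exists_compactElt_of_fixes ha.1 hH (s := 16) (c := ![0, 0, 0, 1, 0, 0])
    (by ext i; fin_cases i <;> simp; norm_num)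
  obtain ⟨d₄, h₄, p₄⟩ := exists_compactElt_of_fixes ha.1 hH (s := 1) (c := ![0, 0, 0, 0, 1, 0])
    (by ext i; fin_cases i <;> simp)
  obtain ⟨d₅, h₅, p₅⟩ := exists_compactElt_of_fixes ha.1 hH (s := 25) (c := ![0, 0, 0, 0, 0, 1])
    (by ext i; fin_cases i <;> simp; norm_num)
  simp only [lam_zero_diagElt, lam_one_diagElt, lam_two_diagElt] at p p₁ p₂ p₃ p₄ p₅
  have e₀ : d₀ = d₀ 0 • ![1, 0, 0, 0, 0, 0] := by ext i; fin_cases i <;> simp <;> linarith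
  have e₁ : d₁ = d₁ 1 • ![0, 1, 0, 0, 0, 0] := by ext i; fin_cases i <;> simp <;> linarith
  have e₂ : d₂ = d₂ 2 • ![0, 0, 1, 0, 0, 0] := by ext i; fin_cases i <;> simp <;> linarith
  have e₃ : d₃ = d₃ 3 • ![0, 0, 0, 1, 0, 0] := by ext i; fin_cases i <;> simp <;> linarith
  have e₄ : d₄ = d₄ 4 • ![0, 0, 0, 0, 1, 0] := by ext i; fin_cases i <;> simp <;> linarith
  have e₅ : d₅ = d₅ 5 • ![0, 0, 0, 0, 0, 1] := by ext i; fin_cases i <;> simp <;> linarith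
  rw [e₀] at h₀
  rw [e₁] at h₁
  rw [e₂] at h₂
  rw [e₃] at h₃
  rw [e₄] at h₄
  rw [e₅] at h₅
  obtain ⟨-, q₀⟩ := eq_of_inn_ne_zero ha.1 h₀ h₅ (by
    rw [inn_eq, LinearEquiv.apply_symm_apply, LinearEquiv.apply_symm_apply]; simp)
  obtain ⟨-, q₁⟩ := eq_of_inn_ne_zero ha.1 h₁ h₄ (by
    rw [inn_eq, LinearEquiv.apply_symm_apply, LinearEquiv.apply_symm_apply]; simp)
  obtain ⟨-, q₂⟩ := eq_of_inn_ne_zero ha.1 h₂ h₃ (by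
    rw [inn_eq, LinearEquiv.apply_symm_apply, LinearEquiv.apply_symm_apply]; simp)
  refine ⟨d₀ 0, d₁ 1, d₂ 2, fun c => ?_⟩
  rw [compactElt_eq_sum c]
  simp only [map_add, map_smul, h₀, h₁, h₂, h₃, h₄, h₅, q₀, q₁, q₂]
  simp only [← compactElt_smul, ← compactElt_add]
  congr 1
  ext i
  fin_cases i <;> simp [mul_comm]

/-- The group `K_{α₁}` acts on `𝔨` through a sign `δ` and an element of `O(2)` of determinant
`δ`. -/
theorem isotropy_alpha₁_apply {a : SplitG2 ≃ₗ[ℝ] SplitG2} (ha : a ∈ isotropy {alpha₁}) :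
    ∃ δ p q : ℝ, ∀ c, a (compactElt c) =
      compactElt ![δ * c 0, p * c 1 - δ * q * c 2, q * c 1 + δ * p * c 2, δ * p * c 3 - q * c 4,
        δ * q * c 3 + p * c 4, δ * c 5] := by
  have hH := isotropy_alpha₁_diagElt ha
  obtain ⟨d₀, h₀, p⟩ := exists_compactElt_of_fixes ha.1 hH (s := 0) (c := ![1, 0, 0, 0, 0, 0])
    (by ext i; fin_cases i <;> simp)
  obtain ⟨d₁, h₁, p₁⟩ := exists_compactElt_of_fixes ha.1 hH (s := 9) (c := ![0, 1, 0, 0, 0, 0])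
    (by ext i; fin_cases i <;> simp; norm_num)
  obtain ⟨d₅, h₅, p₅⟩ := exists_compactElt_of_fixes ha.1 hH (s := 4) (c := ![0, 0, 0, 0, 0, 1])
    (by ext i; fin_cases i <;> simp; norm_num)
  simp only [lam_zero_diagElt, lam_one_diagElt, lam_two_diagElt] at p p₁ p₅
  have e₀ : d₀ = d₀ 0 • ![1, 0, 0, 0, 0, 0] := by ext i; fin_cases i <;> simp <;> linarith
  have e₁ : d₁ = ![0, d₁ 1, d₁ 2, 0, 0, 0] := by ext i; fin_cases i <;> simp <;> linarith
  have e₅ : d₅ = d₅ 5 • ![0, 0, 0, 0, 0, 1] := by ext i; fin_cases i <;> simp <;> linarith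
  rw [e₀] at h₀
  rw [e₁] at h₁
  rw [e₅] at h₅
  obtain ⟨hδ, q₀⟩ := eq_of_inn_ne_zero ha.1 h₀ h₅ (by
    rw [inn_eq, LinearEquiv.apply_symm_apply, LinearEquiv.apply_symm_apply]; simp)
  rw [q₀] at h₅
  generalize d₀ 0 = δ at *
  generalize d₁ 1 = p at *
  generalize d₁ 2 = q at *
  -- `X₃ = [X₁, X₂]`, `Y₂ = [Y₃, X₃]` and `Y₁ = [Y₃, X₂]`.
  have h₂ : a (compactElt ![0, 0, 1, 0, 0, 0]) = compactElt ![0, -(δ * q), δ * p, 0, 0, 0] := by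
    convert K_lie_compactElt ha.1 h₀ h₁ using 2
    · congr 1; ext i; fin_cases i <;> simp [compactBracket]
    · ext i; fin_cases i <;> simp [compactBracket]
  have h₄ : a (compactElt ![0, 0, 0, 0, 1, 0]) = compactElt ![0, 0, 0, -q, p, 0] := by
    convert K_lie_compactElt ha.1 h₅ h₂ using 2
    · congr 1; ext i; fin_cases i <;> simp [compactBracket]
    · ext i; fin_cases i <;> simp [compactBracket]
      · linear_combination -q * hδ
      · linear_combination -p * hδ
  have h₃ : a (compactElt ![0, 0, 0, 1, 0, 0]) = compactElt ![0, 0, 0, δ * p, δ * q, 0] := by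
    convert K_lie_compactElt ha.1 h₅ h₁ using 2
    · congr 1; ext i; fin_cases i <;> simp [compactBracket]
    · ext i; fin_cases i <;> simp [compactBracket]
  refine ⟨δ, p, q, fun c => ?_⟩
  rw [compactElt_eq_sum c]
  simp only [map_add, map_smul, h₀, h₁, h₂, h₃, h₄, h₅]
  simp only [← compactElt_smul, ← compactElt_add]
  congr 1
  ext i
  fin_cases i <;> simp <;> ring

/-- The isotropy group of `{α₂}` multiplies `2W₂ + Z₂` by a sign and preserves the two planes on
which `ad(Y₂)²` acts by `-4` and by `-4/9`. -/
theorem isotropy_alpha₂_apply {a : SplitG2 ≃ₗ[ℝ] SplitG2} (ha : a ∈ isotropy {alpha₂}) :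
    (∃ δ : ℝ, a (compactElt ![0, 5 / 4, 0, 0, 3 / 8, 0]) =
      δ • compactElt ![0, 5 / 4, 0, 0, 3 / 8, 0]) ∧
    (∀ s t : ℝ, ∃ s' t' : ℝ, a (compactElt ![1 / 4 * s, 0, 1 / 4 * t, 3 / 8 * t, 0, 3 / 8 * s]) =
      s' • compactElt ![1 / 4, 0, 0, 0, 0, 3 / 8] + t' • compactElt ![0, 0, 1 / 4, 3 / 8, 0, 0]) ∧
    ∀ s t : ℝ, ∃ s' t' : ℝ,
      a (compactElt ![3 / 4 * s, 0, 3 / 4 * t, -(3 / 8 * t), 0, -(3 / 8 * s)]) =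
        s' • compactElt ![3 / 4, 0, 0, 0, 0, -(3 / 8)] +
          t' • compactElt ![0, 0, 3 / 4, -(3 / 8), 0, 0] := by
  have hH := isotropy_alpha₂_diagElt ha
  obtain ⟨d₁, h₁, p₁⟩ := exists_compactElt_of_fixes ha.1 hH (s := 4) (c := ![0, 1, 0, 0, 0, 0])
    (by ext i; fin_cases i <;> simp; norm_num)
  obtain ⟨d₄, h₄, p₄⟩ := exists_compactElt_of_fixes ha.1 hH (s := 0) (c := ![0, 0, 0, 0, 1, 0])
    (by ext i; fin_cases i <;> simp)
  simp only [lam_zero_diagElt, lam_one_diagElt, lam_two_diagElt] at p₁ p₄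
  have e₁ : d₁ = d₁ 1 • ![0, 1, 0, 0, 0, 0] := by ext i; fin_cases i <;> simp <;> linarith
  have e₄ : d₄ = d₄ 4 • ![0, 0, 0, 0, 1, 0] := by ext i; fin_cases i <;> simp <;> linarith
  rw [e₁] at h₁
  rw [e₄] at h₄
  obtain ⟨hδ, q₄⟩ := eq_of_inn_ne_zero ha.1 h₁ h₄ (by
    rw [inn_eq, LinearEquiv.apply_symm_apply, LinearEquiv.apply_symm_apply]; simp)
  rw [q₄] at h₄
  generalize d₁ 1 = δ at *
  -- Since `a Y₂ = δ Y₂` with `δ² = 1`, the automorphism `a` commutes with `ad(Y₂)²`.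
  have hplane : ∀ {c d : Fin 6 → ℝ} {s : ℝ}, a (compactElt c) = compactElt d →
      compactBracket ![0, 0, 0, 0, 1, 0] (compactBracket ![0, 0, 0, 0, 1, 0] c) = s • c →
      compactBracket ![0, 0, 0, 0, 1, 0] (compactBracket ![0, 0, 0, 0, 1, 0] d) = s • d := by
    intro c d s hcd hc
    have h := K_lie_compactElt ha.1 h₄ (K_lie_compactElt ha.1 h₄ hcd)
    rw [hc, compactElt_smul, map_smul, hcd, ← compactElt_smul] at h
    rw [compactElt_injective h, compactBracket_smul_left, compactBracket_smul_left,
      compactBracket_smul_right, smul_smul, ← sq, hδ, one_smul]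
  refine ⟨⟨δ, ?_⟩, fun s t => ?_, fun s t => ?_⟩
  · have e : (![0, 5 / 4, 0, 0, 3 / 8, 0] : Fin 6 → ℝ) =
        (5 / 4 : ℝ) • ![0, 1, 0, 0, 0, 0] + (3 / 8 : ℝ) • ![0, 0, 0, 0, 1, 0] := by
      ext i; fin_cases i <;> simp
    rw [e, compactElt_add, compactElt_smul, compactElt_smul, map_add, map_smul, map_smul, h₁, h₄,
      compactElt_smul, compactElt_smul, smul_add, smul_comm δ, smul_comm δ]
  · obtain ⟨d, hd⟩ := exists_eq_compactElt (K_mem_compactAlgebra ha.1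
      (compactElt_mem ![1 / 4 * s, 0, 1 / 4 * t, 3 / 8 * t, 0, 3 / 8 * s]))
    have h := hplane (s := -4) hd
      (by ext i; fin_cases i <;> simp [compactBracket] <;> ring)
    have h0 := congrFun h 0
    have h1 := congrFun h 1
    have h2 := congrFun h 2
    have h4 := congrFun h 4
    simp [compactBracket] at h0 h1 h2 h4
    refine ⟨4 * d 0, 4 * d 2, ?_⟩
    rw [hd, ← compactElt_smul, ← compactElt_smul, ← compactElt_add]
    congr 1
    ext i
    fin_cases i <;> simp <;> linarith
  · obtain ⟨d, hd⟩ := exists_eq_compactElt (K_mem_compactAlgebra ha.1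
      (compactElt_mem ![3 / 4 * s, 0, 3 / 4 * t, -(3 / 8 * t), 0, -(3 / 8 * s)]))
    have h := hplane (s := -4 / 9) hd
      (by ext i; fin_cases i <;> simp [compactBracket] <;> ring)
    have h0 := congrFun h 0
    have h1 := congrFun h 1
    have h2 := congrFun h 2
    have h4 := congrFun h 4
    simp [compactBracket] at h0 h1 h2 h4
    refine ⟨4 / 3 * d 0, 4 / 3 * d 2, ?_⟩
    rw [hd, ← compactElt_smul, ← compactElt_smul, ← compactElt_add]
    congr 1
    ext i
    fin_cases i <;> simp <;> linarith

end SplitG2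

/-! ### Positive definite matrices commuting with given matrices -/

section Matrices

theorem quadratic_pos {μ ν a : ℝ} (hμ : 0 < μ) (ha : a ∈ Set.Ioo (-√(μ * ν)) (√(μ * ν)))
    (x y : ℝ) (h : x ≠ 0 ∨ y ≠ 0) : 0 < μ * x ^ 2 + 2 * a * x * y + ν * y ^ 2 := by
  have ha' : a ^ 2 < μ * ν := Real.sq_lt.2 ha
  have key : μ * (μ * x ^ 2 + 2 * a * x * y + ν * y ^ 2) =
      (μ * x + a * y) ^ 2 + (μ * ν - a ^ 2) * y ^ 2 := by ring
  refine pos_of_mul_pos_right (a := μ) ?_ hμ.le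
  rw [key]
  by_cases hy : y = 0
  · have hx : x ≠ 0 := h.resolve_right (not_not.2 hy)
    subst hy
    have : μ * x ≠ 0 := mul_ne_zero hμ.ne' hx
    simpa using (by positivity : 0 < (μ * x) ^ 2)
  · have := sub_pos.2 ha'
    positivity

theorem quadratic_nonneg {μ ν a : ℝ} (hμ : 0 < μ) (ha : a ∈ Set.Ioo (-√(μ * ν)) (√(μ * ν)))
    (x y : ℝ) : 0 ≤ μ * x ^ 2 + 2 * a * x * y + ν * y ^ 2 := by
  by_cases h : x ≠ 0 ∨ y ≠ 0
  · exact (quadratic_pos hμ ha x y h).le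
  · push Not at h
    simp [h.1, h.2]

variable {n : ℕ} {M : Matrix (Fin n) (Fin n) ℝ}

theorem Matrix.diag_pos_of_forall_pos (hM : ∀ v, v ≠ 0 → 0 < v ⬝ᵥ M *ᵥ v) (i : Fin n) :
    0 < M i i := by
  have h := hM (Pi.single i 1) (by simp)
  simpa using h

/-- The principal `2 × 2` minors of a positive definite matrix are positive. -/
theorem Matrix.mem_Ioo_of_forall_pos (hsymm : Mᵀ = M) (hM : ∀ v, v ≠ 0 → 0 < v ⬝ᵥ M *ᵥ v)
    {i j : Fin n} (hij : i ≠ j) :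
    M i j ∈ Set.Ioo (-√(M i i * M j j)) (√(M i i * M j j)) := by
  have hj := Matrix.diag_pos_of_forall_pos hM j
  have hs : M j i = M i j := congrFun (congrFun hsymm i) j
  have h := hM (Pi.single i (M j j) + Pi.single j (-M i j)) fun h0 => by
    have := congrFun h0 i
    simp [hij] at this
    exact hj.ne' this
  simp [Matrix.mulVec_add, add_dotProduct, Matrix.mulVec_single, hs] at h
  refine Real.sq_lt.1 ?_
  have h' : 0 < M j j * (M i i * M j j - M i j ^ 2) := by linarith
  linarith [pos_of_mul_pos_right h' hj.le]

theorem Matrix.apply_eq_zero_of_commute_diagonal {r : Fin n → ℝ}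
    (h : M * Matrix.diagonal r = Matrix.diagonal r * M) {i j : Fin n} (hij : r i ≠ r j) :
    M i j = 0 := by
  have e := congrFun (congrFun h i) j
  rw [Matrix.mul_diagonal, Matrix.diagonal_mul] at e
  exact (mul_eq_zero.1 (show (r i - r j) * M i j = 0 by linarith)).resolve_left (sub_ne_zero.2 hij)

/-- The two diagonal matrices are those by which `e^{π ad X₁}` and `e^{π ad X₃}` act on `𝔪_∅`. -/
theorem matrix_form_empty {M : Matrix (Fin 6) (Fin 6) ℝ} (hsymm : Mᵀ = M)
    (h₁ : M * Matrix.diagonal ![1, 1, -1, -1, -1, -1] =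
      Matrix.diagonal ![1, 1, -1, -1, -1, -1] * M)
    (h₃ : M * Matrix.diagonal ![-1, -1, -1, -1, 1, 1] =
      Matrix.diagonal ![-1, -1, -1, -1, 1, 1] * M) :
    M = !![M 0 0, M 0 1, 0, 0, 0, 0;
           M 0 1, M 1 1, 0, 0, 0, 0;
           0, 0, M 2 2, M 2 3, 0, 0;
           0, 0, M 2 3, M 3 3, 0, 0;
           0, 0, 0, 0, M 4 4, M 4 5;
           0, 0, 0, 0, M 4 5, M 5 5] := by
  have hs : ∀ i j, M i j = M j i := fun i j => congrFun (congrFun hsymm j) i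
  have hne : (-1 : ℝ) ≠ 1 := by norm_num
  ext i j
  fin_cases i <;> fin_cases j <;>
    first
    | rfl
    | exact hs _ _
    | exact Matrix.apply_eq_zero_of_commute_diagonal h₁ hne.symm
    | exact Matrix.apply_eq_zero_of_commute_diagonal h₁ hne
    | exact Matrix.apply_eq_zero_of_commute_diagonal h₃ hne.symm
    | exact Matrix.apply_eq_zero_of_commute_diagonal h₃ hne

end Matrices

namespace SplitG2

variable {Θ : Set (Module.Dual ℝ cartan)}

/-! ### The metric operators of the three flag manifolds -/

section Criterion

variable {n : ℕ} {w : Fin n → SplitG2} {B : Module.Basis (Fin n) ℝ (m Θ)}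

theorem IsOrthonormalBasisOf.matrix_unique (hB : IsOrthonormalBasisOf B w)
    {a : SplitG2 ≃ₗ[ℝ] SplitG2} {R R' : Matrix (Fin n) (Fin n) ℝ}
    (hR : ∀ j, a (w j) = ∑ i, R i j • w i) (hR' : ∀ j, a (w j) = ∑ i, R' i j • w i) : R = R' := by
  have hw : ∀ i, w i = mIncl Θ (B i) := fun i => (hB.1 i).symm
  ext i j
  have h := (hR j).symm.trans (hR' j)
  simp only [hw, ← map_smul, ← map_sum] at h
  have h' := congrArg (fun z => B.repr z i) (mIncl_injective h)
  simpa only [B.repr_sum_self] using h'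

theorem apply_eq_sum_diagonal {a : SplitG2 ≃ₗ[ℝ] SplitG2} {r : Fin n → ℝ}
    (h : ∀ j, a (w j) = r j • w j) (j : Fin n) :
    a (w j) = ∑ i, Matrix.diagonal r i j • w i := by
  rw [h, Finset.sum_eq_single j]
  · rw [Matrix.diagonal_apply_eq]
  · intro i _ hij
    rw [Matrix.diagonal_apply_ne _ hij, zero_smul]
  · simp

/-- A version of `exists_isOrthonormalBasisOf` in coordinates. -/
theorem exists_isOrthonormalBasisOf_compactElt {v : Fin n → Fin 6 → ℝ}
    (hvw : ∀ i, w i = compactElt (v i)) (hm : ∀ i, compactCoord.symm (v i) ∈ m Θ)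
    (hon : ∀ i j, inn (compactCoord.symm (v i)) (compactCoord.symm (v j)) = if i = j then 1 else 0)
    (hspan : ∀ x ∈ m Θ, ∃ g : Fin n → ℝ, compactCoord x = ∑ i, g i • v i) :
    ∃ B : Module.Basis (Fin n) ℝ (m Θ), IsOrthonormalBasisOf B w := by
  refine exists_isOrthonormalBasisOf (fun i => compactCoord.symm (v i))
    (fun i => (hvw i).symm) hm hon fun x hx => ?_
  obtain ⟨g, hg⟩ := hspan x hx
  rw [← compactCoord.symm_apply_apply x, hg, map_sum]
  refine sum_mem fun i _ => ?_
  rw [map_smul]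
  exact Submodule.smul_mem _ _ (Submodule.subset_span ⟨i, rfl⟩)

end Criterion

theorem W_zero : W 0 = compactElt ![1 / 2, 0, 0, 0, 0, 0] := by
  apply ext'
  · ext i j; fin_cases i <;> fin_cases j <;> simp [W, X, compactElt]
  · ext i; fin_cases i <;> simp [W, X, compactElt]
  · ext i; fin_cases i <;> simp [W, X, compactElt]

theorem W_one : W 1 = compactElt ![0, 1 / 2, 0, 0, 0, 0] := by
  apply ext'
  · ext i j; fin_cases i <;> fin_cases j <;> simp [W, X, compactElt]
  · ext i; fin_cases i <;> simp [W, X, compactElt]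
  · ext i; fin_cases i <;> simp [W, X, compactElt]

theorem W_two : W 2 = compactElt ![0, 0, 1 / 2, 0, 0, 0] := by
  apply ext'
  · ext i j; fin_cases i <;> fin_cases j <;> simp [W, X, compactElt]
  · ext i; fin_cases i <;> simp [W, X, compactElt]
  · ext i; fin_cases i <;> simp [W, X, compactElt]

theorem Z_zero : Z 0 = compactElt ![0, 0, -1 / 4, 3 / 8, 0, 0] := by
  apply ext'
  · ext i j; fin_cases i <;> fin_cases j <;> simp [Z, X, Y, compactElt] <;> norm_num
  · ext i; fin_cases i <;> simp [Z, X, Y, compactElt]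
  · ext i; fin_cases i <;> simp [Z, X, Y, compactElt]

theorem Z_one : Z 1 = compactElt ![0, 1 / 4, 0, 0, 3 / 8, 0] := by
  apply ext'
  · ext i j; fin_cases i <;> fin_cases j <;> simp [Z, X, Y, compactElt]
  · ext i; fin_cases i <;> simp [Z, X, Y, compactElt]
  · ext i; fin_cases i <;> simp [Z, X, Y, compactElt]

theorem Z_two : Z 2 = compactElt ![-1 / 4, 0, 0, 0, 0, 3 / 8] := by
  apply ext'
  · ext i j; fin_cases i <;> fin_cases j <;> simp [Z, X, Y, compactElt] <;> norm_num
  · ext i; fin_cases i <;> simp [Z, X, Y, compactElt]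
  · ext i; fin_cases i <;> simp [Z, X, Y, compactElt]

/-- The coordinates of the basis of `𝔪_∅`. -/
noncomputable def basisEmpty : Fin 6 → Fin 6 → ℝ :=
  ![![1 / 2, 0, 0, 0, 0, 0], ![-1 / 4, 0, 0, 0, 0, 3 / 8], ![0, 1 / 2, 0, 0, 0, 0],
    ![0, 1 / 4, 0, 0, 3 / 8, 0], ![0, 0, 1 / 2, 0, 0, 0], ![0, 0, -1 / 4, 3 / 8, 0, 0]]

theorem compactElt_basisEmpty (i : Fin 6) :
    ![W 0, Z 2, W 1, Z 1, W 2, Z 0] i = compactElt (basisEmpty i) := by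
  rw [W_zero, W_one, W_two, Z_zero, Z_one, Z_two]
  fin_cases i <;> rfl

theorem exists_basis_empty : ∃ B : Module.Basis (Fin 6) ℝ (m ∅),
    IsOrthonormalBasisOf B ![W 0, Z 2, W 1, Z 1, W 2, Z 0] := by
  refine exists_isOrthonormalBasisOf_compactElt compactElt_basisEmpty (fun i => mem_m_empty _)
    (fun i j => ?_) fun x _ => ?_
  · rw [inn_eq, LinearEquiv.apply_symm_apply, LinearEquiv.apply_symm_apply]
    fin_cases i <;> fin_cases j <;> simp [basisEmpty] <;> norm_num
  · generalize compactCoord x = c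
    refine ⟨![2 * c 0 + 4 / 3 * c 5, 8 / 3 * c 5, 2 * c 1 - 4 / 3 * c 4, 8 / 3 * c 4,
      2 * c 2 + 4 / 3 * c 3, 8 / 3 * c 3], ?_⟩
    ext i
    fin_cases i <;> simp [Fin.sum_univ_succ, basisEmpty] <;> ring

theorem isMetricOperator_empty_iff {B : Module.Basis (Fin 6) ℝ (m ∅)}
    (hB : IsOrthonormalBasisOf B ![W 0, Z 2, W 1, Z 1, W 2, Z 0]) (A : m ∅ →ₗ[ℝ] m ∅) :
    IsMetricOperator ∅ A ↔
      ∃ μ₁ μ₂ μ₃ μ₄ μ₅ μ₆ a₁ a₂ a₃ : ℝ,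
        0 < μ₁ ∧ 0 < μ₂ ∧ 0 < μ₃ ∧ 0 < μ₄ ∧ 0 < μ₅ ∧ 0 < μ₆ ∧
        a₁ ∈ Set.Ioo (-√(μ₁ * μ₂)) (√(μ₁ * μ₂)) ∧
        a₂ ∈ Set.Ioo (-√(μ₃ * μ₄)) (√(μ₃ * μ₄)) ∧
        a₃ ∈ Set.Ioo (-√(μ₅ * μ₆)) (√(μ₅ * μ₆)) ∧
        LinearMap.toMatrix B B A =
          !![μ₁, a₁, 0, 0, 0, 0;
             a₁, μ₂, 0, 0, 0, 0;
             0, 0, μ₃, a₂, 0, 0;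
             0, 0, a₂, μ₄, 0, 0;
             0, 0, 0, 0, μ₅, a₃;
             0, 0, 0, 0, a₃, μ₆] := by
  rw [hB.isMetricOperator_iff]
  generalize LinearMap.toMatrix B B A = M
  constructor
  · rintro ⟨hsymm, hpos, hcomm⟩
    obtain ⟨g₁, hg₁, hg₁c⟩ := exists_isotropy_X₁
    obtain ⟨g₃, hg₃, hg₃c⟩ := exists_isotropy_X₃
    have h₁ := hcomm g₁ (hg₁ ∅) (Matrix.diagonal ![1, 1, -1, -1, -1, -1])
      (apply_eq_sum_diagonal fun j => by
        rw [compactElt_basisEmpty, hg₁c, ← compactElt_smul]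
        congr 1
        ext i
        fin_cases j <;> fin_cases i <;> simp [basisEmpty])
    have h₃ := hcomm g₃ (hg₃ ∅) (Matrix.diagonal ![-1, -1, -1, -1, 1, 1])
      (apply_eq_sum_diagonal fun j => by
        rw [compactElt_basisEmpty, hg₃c, ← compactElt_smul]
        congr 1
        ext i
        fin_cases j <;> fin_cases i <;> simp [basisEmpty])
    have hd := Matrix.diag_pos_of_forall_pos hpos
    exact ⟨_, _, _, _, _, _, _, _, _, hd 0, hd 1, hd 2, hd 3, hd 4, hd 5,
      Matrix.mem_Ioo_of_forall_pos hsymm hpos (by decide),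
      Matrix.mem_Ioo_of_forall_pos hsymm hpos (by decide),
      Matrix.mem_Ioo_of_forall_pos hsymm hpos (by decide), matrix_form_empty hsymm h₁ h₃⟩
  · rintro ⟨μ₁, μ₂, μ₃, μ₄, μ₅, μ₆, a₁, a₂, a₃, h₁, h₂, h₃, h₄, h₅, h₆, ha₁, ha₂, ha₃, rfl⟩
    refine ⟨?_, fun v hv => ?_, fun a ha R hR => ?_⟩
    · ext i j
      fin_cases i <;> fin_cases j <;> rfl
    · have e : v ⬝ᵥ !![μ₁, a₁, 0, 0, 0, 0; a₁, μ₂, 0, 0, 0, 0; 0, 0, μ₃, a₂, 0, 0;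
          0, 0, a₂, μ₄, 0, 0; 0, 0, 0, 0, μ₅, a₃; 0, 0, 0, 0, a₃, μ₆] *ᵥ v =
          (μ₁ * v 0 ^ 2 + 2 * a₁ * v 0 * v 1 + μ₂ * v 1 ^ 2) +
          (μ₃ * v 2 ^ 2 + 2 * a₂ * v 2 * v 3 + μ₄ * v 3 ^ 2) +
          (μ₅ * v 4 ^ 2 + 2 * a₃ * v 4 * v 5 + μ₆ * v 5 ^ 2) := by
        simp [Matrix.mulVec, dotProduct, Fin.sum_univ_succ]
        ring
      rw [e]
      have n₁ := quadratic_nonneg h₁ ha₁ (v 0) (v 1)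
      have n₂ := quadratic_nonneg h₃ ha₂ (v 2) (v 3)
      have n₃ := quadratic_nonneg h₅ ha₃ (v 4) (v 5)
      by_cases k₁ : v 0 ≠ 0 ∨ v 1 ≠ 0
      · linarith [quadratic_pos h₁ ha₁ _ _ k₁]
      by_cases k₂ : v 2 ≠ 0 ∨ v 3 ≠ 0
      · linarith [quadratic_pos h₃ ha₂ _ _ k₂]
      by_cases k₃ : v 4 ≠ 0 ∨ v 5 ≠ 0
      · linarith [quadratic_pos h₅ ha₃ _ _ k₃]
      push Not at k₁ k₂ k₃
      refine absurd ?_ hv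
      ext i
      fin_cases i
      exacts [k₁.1, k₁.2, k₂.1, k₂.2, k₃.1, k₃.2]
    · obtain ⟨r₁, r₂, r₃, hr⟩ := isotropy_empty_apply ha
      have hR' := apply_eq_sum_diagonal (a := a) (w := ![W 0, Z 2, W 1, Z 1, W 2, Z 0])
        (r := ![r₁, r₁, r₂, r₂, r₃, r₃]) fun j => by
          rw [compactElt_basisEmpty, hr, ← compactElt_smul]
          congr 1
          ext i
          fin_cases j <;> fin_cases i <;> simp [basisEmpty]
      rw [hB.matrix_unique hR hR']
      ext i j
      rw [Matrix.mul_diagonal, Matrix.diagonal_mul]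
      fin_cases i <;> fin_cases j <;> simp [mul_comm]

/-- The coordinates of the basis of `𝔪_{α₁}`. -/
noncomputable def basisAlpha₁ : Fin 5 → Fin 6 → ℝ :=
  ![![-1 / 4, 0, 0, 0, 0, 3 / 8], ![0, 1 / 2, 0, 0, 0, 0], ![0, 0, 1 / 2, 0, 0, 0],
    ![0, 1 / 4, 0, 0, 3 / 8, 0], ![0, 0, 1 / 4, -3 / 8, 0, 0]]

theorem compactElt_basisAlpha₁ (i : Fin 5) :
    ![Z 2, W 1, W 2, Z 1, -Z 0] i = compactElt (basisAlpha₁ i) := by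
  have h : -Z 0 = compactElt ![0, 0, 1 / 4, -3 / 8, 0, 0] := by
    rw [Z_zero, ← neg_one_smul ℝ, ← compactElt_smul]
    congr 1
    ext i
    fin_cases i <;> simp <;> norm_num
  rw [h, W_one, W_two, Z_one, Z_two]
  fin_cases i <;> rfl

theorem exists_basis_alpha₁ : ∃ B : Module.Basis (Fin 5) ℝ (m {alpha₁}),
    IsOrthonormalBasisOf B ![Z 2, W 1, W 2, Z 1, -Z 0] := by
  refine exists_isOrthonormalBasisOf_compactElt compactElt_basisAlpha₁ (fun i => ?_)
    (fun i j => ?_) fun x hx => ?_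
  · rw [mem_m_alpha₁, LinearEquiv.apply_symm_apply]
    fin_cases i <;> simp [basisAlpha₁]
    norm_num
  · rw [inn_eq, LinearEquiv.apply_symm_apply, LinearEquiv.apply_symm_apply]
    fin_cases i <;> fin_cases j <;> simp [basisAlpha₁] <;> norm_num
  · rw [mem_m_alpha₁] at hx
    generalize compactCoord x = c at hx ⊢
    refine ⟨![8 / 3 * c 5, 2 * c 1 - 4 / 3 * c 4, 2 * c 2 + 4 / 3 * c 3, 8 / 3 * c 4,
      -(8 / 3) * c 3], ?_⟩
    ext i
    fin_cases i <;> simp [Fin.sum_univ_succ, basisAlpha₁] <;> linarith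

/-- The two matrices are those by which `e^{π ad X₃}` and `e^{(π/2) ad X₁}` act on `𝔪_{α₁}`. -/
theorem matrix_form_alpha₁ {M : Matrix (Fin 5) (Fin 5) ℝ} (hsymm : Mᵀ = M)
    (h₃ : M * Matrix.diagonal ![-1, -1, 1, -1, 1] = Matrix.diagonal ![-1, -1, 1, -1, 1] * M)
    (hJ : M * !![1, 0, 0, 0, 0; 0, 0, -1, 0, 0; 0, 1, 0, 0, 0; 0, 0, 0, 0, -1; 0, 0, 0, 1, 0] =
      !![1, 0, 0, 0, 0; 0, 0, -1, 0, 0; 0, 1, 0, 0, 0; 0, 0, 0, 0, -1; 0, 0, 0, 1, 0] * M) :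
    M = !![M 0 0, 0, 0, 0, 0;
           0, M 1 1, 0, M 1 3, 0;
           0, 0, M 1 1, 0, M 1 3;
           0, M 1 3, 0, M 3 3, 0;
           0, 0, M 1 3, 0, M 3 3] := by
  have hs : ∀ i j, M i j = M j i := fun i j => congrFun (congrFun hsymm j) i
  have hne : (-1 : ℝ) ≠ 1 := by norm_num
  have e02 : M 0 2 = 0 := Matrix.apply_eq_zero_of_commute_diagonal h₃ hne
  have e04 : M 0 4 = 0 := Matrix.apply_eq_zero_of_commute_diagonal h₃ hne
  have e01 : M 0 1 = 0 := by
    have := congrFun (congrFun hJ 0) 2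
    simpa [Matrix.mul_apply, Fin.sum_univ_succ, e02] using this
  have e03 : M 0 3 = 0 := by
    have := congrFun (congrFun hJ 0) 4
    simpa [Matrix.mul_apply, Fin.sum_univ_succ, e04] using this
  have e22 : M 2 2 = M 1 1 := by
    have := congrFun (congrFun hJ 2) 1
    simpa [Matrix.mul_apply, Fin.sum_univ_succ] using this
  have e24 : M 2 4 = M 1 3 := by
    have := congrFun (congrFun hJ 2) 3
    simpa [Matrix.mul_apply, Fin.sum_univ_succ] using this
  have e44 : M 4 4 = M 3 3 := by
    have := congrFun (congrFun hJ 4) 3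
    simpa [Matrix.mul_apply, Fin.sum_univ_succ] using this
  ext i j
  fin_cases i <;> fin_cases j <;>
    first
    | rfl
    | assumption
    | exact hs _ _
    | exact (hs _ _).trans e01
    | exact (hs _ _).trans e03
    | exact (hs _ _).trans e24
    | exact Matrix.apply_eq_zero_of_commute_diagonal h₃ hne.symm
    | exact Matrix.apply_eq_zero_of_commute_diagonal h₃ hne

theorem isMetricOperator_alpha₁_iff {B : Module.Basis (Fin 5) ℝ (m {alpha₁})}
    (hB : IsOrthonormalBasisOf B ![Z 2, W 1, W 2, Z 1, -Z 0]) (A : m {alpha₁} →ₗ[ℝ] m {alpha₁}) :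
    IsMetricOperator {alpha₁} A ↔
      ∃ μ₁ μ₂ μ₃ a : ℝ, 0 < μ₁ ∧ 0 < μ₂ ∧ 0 < μ₃ ∧
        a ∈ Set.Ioo (-√(μ₂ * μ₃)) (√(μ₂ * μ₃)) ∧
        LinearMap.toMatrix B B A =
          !![μ₁, 0, 0, 0, 0;
             0, μ₂, 0, a, 0;
             0, 0, μ₂, 0, a;
             0, a, 0, μ₃, 0;
             0, 0, a, 0, μ₃] := by
  rw [hB.isMetricOperator_iff]
  generalize LinearMap.toMatrix B B A = M
  constructor
  · rintro ⟨hsymm, hpos, hcomm⟩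
    obtain ⟨g₃, hg₃, hg₃c⟩ := exists_isotropy_X₃
    obtain ⟨g, hg, hgc⟩ := exists_isotropy_alpha₁
    have h₃ := hcomm g₃ (hg₃ _) (Matrix.diagonal ![-1, -1, 1, -1, 1])
      (apply_eq_sum_diagonal fun j => by
        rw [compactElt_basisAlpha₁, hg₃c, ← compactElt_smul]
        congr 1
        ext i
        fin_cases j <;> fin_cases i <;> simp [basisAlpha₁])
    have hJ := hcomm g hg
      !![1, 0, 0, 0, 0; 0, 0, -1, 0, 0; 0, 1, 0, 0, 0; 0, 0, 0, 0, -1; 0, 0, 0, 1, 0] fun j => by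
        simp only [compactElt_basisAlpha₁, hgc, Fin.sum_univ_five, ← compactElt_smul,
          ← compactElt_add]
        congr 1
        ext i
        fin_cases j <;> fin_cases i <;> simp [basisAlpha₁] <;> norm_num
    have hd := Matrix.diag_pos_of_forall_pos hpos
    exact ⟨_, _, _, _, hd 0, hd 1, hd 3,
      Matrix.mem_Ioo_of_forall_pos hsymm hpos (by decide), matrix_form_alpha₁ hsymm h₃ hJ⟩
  · rintro ⟨μ₁, μ₂, μ₃, b, h₁, h₂, h₃, hb, rfl⟩
    refine ⟨?_, fun v hv => ?_, fun a ha R hR => ?_⟩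
    · ext i j
      fin_cases i <;> fin_cases j <;> rfl
    · have e : v ⬝ᵥ !![μ₁, 0, 0, 0, 0; 0, μ₂, 0, b, 0; 0, 0, μ₂, 0, b; 0, b, 0, μ₃, 0;
          0, 0, b, 0, μ₃] *ᵥ v = μ₁ * v 0 ^ 2 +
          (μ₂ * v 1 ^ 2 + 2 * b * v 1 * v 3 + μ₃ * v 3 ^ 2) +
          (μ₂ * v 2 ^ 2 + 2 * b * v 2 * v 4 + μ₃ * v 4 ^ 2) := by
        simp [Matrix.mulVec, dotProduct, Fin.sum_univ_succ]
        ring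
      rw [e]
      have n₀ : 0 ≤ μ₁ * v 0 ^ 2 := by positivity
      have n₁ := quadratic_nonneg h₂ hb (v 1) (v 3)
      have n₂ := quadratic_nonneg h₂ hb (v 2) (v 4)
      by_cases k₀ : v 0 ≠ 0
      · have : 0 < μ₁ * v 0 ^ 2 := by positivity
        linarith
      by_cases k₁ : v 1 ≠ 0 ∨ v 3 ≠ 0
      · linarith [quadratic_pos h₂ hb _ _ k₁]
      by_cases k₂ : v 2 ≠ 0 ∨ v 4 ≠ 0
      · linarith [quadratic_pos h₂ hb _ _ k₂]
      push Not at k₀ k₁ k₂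
      refine absurd ?_ hv
      ext i
      fin_cases i
      exacts [k₀, k₁.1, k₂.1, k₁.2, k₂.2]
    · obtain ⟨δ, p, q, hr⟩ := isotropy_alpha₁_apply ha
      have hR' : ∀ j, a (![Z 2, W 1, W 2, Z 1, -Z 0] j) = ∑ i,
          !![δ, 0, 0, 0, 0; 0, p, -(δ * q), 0, 0; 0, q, δ * p, 0, 0; 0, 0, 0, p, -(δ * q);
            0, 0, 0, q, δ * p] i j • ![Z 2, W 1, W 2, Z 1, -Z 0] i := fun j => by
        simp only [compactElt_basisAlpha₁, hr, Fin.sum_univ_five, ← compactElt_smul,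
          ← compactElt_add]
        congr 1
        ext i
        fin_cases j <;> fin_cases i <;> simp [basisAlpha₁] <;> ring
      rw [hB.matrix_unique hR hR']
      ext i j
      fin_cases i <;> fin_cases j <;> simp [Matrix.mul_apply, Fin.sum_univ_succ] <;> ring

end SplitG2

namespace SplitG2

/-- The coordinates of `√5`, `√2`, `√2`, `√2`, `√2` times the basis of `𝔪_{α₂}`. -/
noncomputable def basisAlpha₂ : Fin 5 → Fin 6 → ℝ :=
  ![![0, 5 / 4, 0, 0, 3 / 8, 0], ![1 / 4, 0, 0, 0, 0, 3 / 8], ![0, 0, 1 / 4, 3 / 8, 0, 0],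
    ![3 / 4, 0, 0, 0, 0, -(3 / 8)], ![0, 0, 3 / 4, -(3 / 8), 0, 0]]

/-- The factors that normalize `basisAlpha₂`. -/
noncomputable def scaleAlpha₂ : Fin 5 → ℝ := ![(√5)⁻¹, (√2)⁻¹, (√2)⁻¹, (√2)⁻¹, (√2)⁻¹]

/-- The basis of `𝔪_{α₂}`. -/
noncomputable def vectorsAlpha₂ : Fin 5 → SplitG2 :=
  ![(√5)⁻¹ • ((2 : ℝ) • W 1 + Z 1), (√2)⁻¹ • (W 0 + Z 2), (√2)⁻¹ • (W 2 + Z 0),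
    (√2)⁻¹ • (W 0 - Z 2), (√2)⁻¹ • (W 2 - Z 0)]

theorem vectorsAlpha₂_eq (i : Fin 5) :
    vectorsAlpha₂ i = scaleAlpha₂ i • compactElt (basisAlpha₂ i) := by
  rw [← compactElt_smul, vectorsAlpha₂, W_zero, W_one, W_two, Z_zero, Z_one, Z_two]
  simp only [sub_eq_add_neg, ← neg_one_smul ℝ (compactElt _), ← compactElt_smul, ← compactElt_add]
  fin_cases i <;>
  · refine congrArg compactElt ?_
    ext i
    fin_cases i <;> simp [scaleAlpha₂, basisAlpha₂]
    try ring

theorem exists_basis_alpha₂ : ∃ B : Module.Basis (Fin 5) ℝ (m {alpha₂}),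
    IsOrthonormalBasisOf B vectorsAlpha₂ := by
  have h2 : (√2)⁻¹ * (√2)⁻¹ = 1 / 2 := by
    rw [← mul_inv, Real.mul_self_sqrt (by norm_num), one_div]
  have h5 : (√5)⁻¹ * (√5)⁻¹ = 1 / 5 := by
    rw [← mul_inv, Real.mul_self_sqrt (by norm_num), one_div]
  have e2 : √2 * (√2)⁻¹ = 1 := mul_inv_cancel₀ (by positivity)
  have e5 : √5 * (√5)⁻¹ = 1 := mul_inv_cancel₀ (by positivity)
  have hsub (i : Fin 5) : compactCoord.symm (basisAlpha₂ i) ∈ m {alpha₂} := by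
    rw [mem_m_alpha₂, LinearEquiv.apply_symm_apply]
    fin_cases i <;> simp [basisAlpha₂]
    norm_num
  refine exists_isOrthonormalBasisOf_compactElt (v := fun i => scaleAlpha₂ i • basisAlpha₂ i)
    (fun i => by rw [vectorsAlpha₂_eq, compactElt_smul]) (fun i => ?_) (fun i j => ?_)
    fun x hx => ?_
  · rw [map_smul]
    exact Submodule.smul_mem _ _ (hsub i)
  · have hB : inn (compactCoord.symm (basisAlpha₂ i)) (compactCoord.symm (basisAlpha₂ j)) =
        if i = j then ![5, 2, 2, 2, 2] i else 0 := by
      rw [inn_eq, LinearEquiv.apply_symm_apply, LinearEquiv.apply_symm_apply]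
      fin_cases i <;> fin_cases j <;> simp [basisAlpha₂] <;> norm_num
    simp only [map_smul, LinearMap.smul_apply, smul_eq_mul]
    rw [hB]
    split_ifs with hij
    · subst hij
      fin_cases i <;> simp [scaleAlpha₂] <;> linarith
    · rw [mul_zero, mul_zero]
  · rw [mem_m_alpha₂] at hx
    generalize compactCoord x = c at hx ⊢
    refine ⟨![√5 * (4 / 5 * c 1), √2 * (c 0 + 2 * c 5), √2 * (c 2 + 2 * c 3),
      √2 * (c 0 - 2 / 3 * c 5), √2 * (c 2 - 2 / 3 * c 3)], ?_⟩
    ext i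
    fin_cases i <;> simp [Fin.sum_univ_succ, basisAlpha₂, scaleAlpha₂]
    · linear_combination -c 0 * e2
    · linear_combination -c 1 * e5
    · linear_combination -c 2 * e2
    · linear_combination -c 3 * e2
    · linear_combination -(3 / 10) * c 1 * e5 + 1 / 10 * hx
    · linear_combination -c 5 * e2

/-- For `s = √2 / 2` the two matrices are those by which `e^{π ad X₁}` and `e^{(3π/8) ad Y₂}` act on
`𝔪_{α₂}`: the second one turns the two planes by different angles `3π/4` and `-π/4`, so these planes
are not coupled. -/
theorem matrix_form_alpha₂ {M : Matrix (Fin 5) (Fin 5) ℝ} (hsymm : Mᵀ = M) {s : ℝ} (hs0 : 0 < s)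
    (h₁ : M * Matrix.diagonal ![-1, 1, -1, 1, -1] = Matrix.diagonal ![-1, 1, -1, 1, -1] * M)
    (hR : M * !![1, 0, 0, 0, 0; 0, -s, -s, 0, 0; 0, s, -s, 0, 0; 0, 0, 0, s, s; 0, 0, 0, -s, s] =
      !![1, 0, 0, 0, 0; 0, -s, -s, 0, 0; 0, s, -s, 0, 0; 0, 0, 0, s, s; 0, 0, 0, -s, s] * M) :
    M = !![M 0 0, 0, 0, 0, 0;
           0, M 1 1, 0, 0, 0;
           0, 0, M 1 1, 0, 0;
           0, 0, 0, M 3 3, 0;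
           0, 0, 0, 0, M 3 3] := by
  have hs : ∀ i j, M i j = M j i := fun i j => congrFun (congrFun hsymm j) i
  have hne : (-1 : ℝ) ≠ 1 := by norm_num
  have e01 : M 0 1 = 0 := Matrix.apply_eq_zero_of_commute_diagonal h₁ hne
  have e03 : M 0 3 = 0 := Matrix.apply_eq_zero_of_commute_diagonal h₁ hne
  have e12 : M 1 2 = 0 := Matrix.apply_eq_zero_of_commute_diagonal h₁ hne.symm
  have e14 : M 1 4 = 0 := Matrix.apply_eq_zero_of_commute_diagonal h₁ hne.symm
  have e23 : M 2 3 = 0 := Matrix.apply_eq_zero_of_commute_diagonal h₁ hne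
  have e34 : M 3 4 = 0 := Matrix.apply_eq_zero_of_commute_diagonal h₁ hne.symm
  have cancel : ∀ {x : ℝ}, s * x = 0 → x = 0 := fun h =>
    (mul_eq_zero.1 h).resolve_left hs0.ne'
  have e02 : M 0 2 = 0 := by
    have h := congrFun (congrFun hR 0) 1
    simp [Matrix.mul_apply, Fin.sum_univ_succ, e01] at h
    exact h.resolve_right hs0.ne'
  have e04 : M 0 4 = 0 := by
    have h := congrFun (congrFun hR 0) 3
    simp [Matrix.mul_apply, Fin.sum_univ_succ, e03] at h
    exact h.resolve_right hs0.ne'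
  have e22 : M 2 2 = M 1 1 := by
    have h := congrFun (congrFun hR 1) 2
    simp [Matrix.mul_apply, Fin.sum_univ_succ, e12] at h
    exact sub_eq_zero.1 (cancel (by linarith))
  have e44 : M 4 4 = M 3 3 := by
    have h := congrFun (congrFun hR 3) 4
    simp [Matrix.mul_apply, Fin.sum_univ_succ, e34] at h
    exact sub_eq_zero.1 (cancel (by linarith))
  have e13 : M 1 3 = 0 := by
    have h := congrFun (congrFun hR 1) 3
    simp [Matrix.mul_apply, Fin.sum_univ_succ, e14, e23] at h
    exact cancel (by linarith)
  have e24 : M 2 4 = 0 := by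
    have h := congrFun (congrFun hR 2) 4
    simp [Matrix.mul_apply, Fin.sum_univ_succ, e14, e23] at h
    exact cancel (by linarith)
  ext i j
  fin_cases i <;> fin_cases j <;> first | rfl | assumption | exact (hs _ _).trans ‹_›

/-- The isotropy group of `{α₂}` acts on `𝔪_{α₂}` by block matrices. -/
theorem isotropy_alpha₂_matrix {a : SplitG2 ≃ₗ[ℝ] SplitG2} (ha : a ∈ isotropy {alpha₂}) :
    ∃ δ p q r t p' q' r' t' : ℝ, ∀ j, a (vectorsAlpha₂ j) = ∑ i,
      !![δ, 0, 0, 0, 0; 0, p, r, 0, 0; 0, q, t, 0, 0; 0, 0, 0, p', r'; 0, 0, 0, q', t'] i j •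
        vectorsAlpha₂ i := by
  obtain ⟨⟨δ, h₀⟩, h, h'⟩ := isotropy_alpha₂_apply ha
  obtain ⟨p, q, h₁⟩ := h 1 0
  obtain ⟨r, t, h₂⟩ := h 0 1
  obtain ⟨p', q', h₃⟩ := h' 1 0
  obtain ⟨r', t', h₄⟩ := h' 0 1
  simp only [mul_one, mul_zero, neg_zero] at h₁ h₂ h₃ h₄
  refine ⟨δ, p, q, r, t, p', q', r', t', fun j => ?_⟩
  rw [vectorsAlpha₂_eq, map_smul, Fin.sum_univ_five]
  simp only [vectorsAlpha₂_eq]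
  fin_cases j <;> simp [-one_div, basisAlpha₂, scaleAlpha₂, h₀, h₁, h₂, h₃, h₄, smul_comm (√2)⁻¹,
    smul_comm (√5)⁻¹]

theorem isMetricOperator_alpha₂_iff {B : Module.Basis (Fin 5) ℝ (m {alpha₂})}
    (hB : IsOrthonormalBasisOf B vectorsAlpha₂) (A : m {alpha₂} →ₗ[ℝ] m {alpha₂}) :
    IsMetricOperator {alpha₂} A ↔
      ∃ μ₁ μ₂ μ₃ : ℝ, 0 < μ₁ ∧ 0 < μ₂ ∧ 0 < μ₃ ∧
        LinearMap.toMatrix B B A =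
          !![μ₁, 0, 0, 0, 0;
             0, μ₂, 0, 0, 0;
             0, 0, μ₂, 0, 0;
             0, 0, 0, μ₃, 0;
             0, 0, 0, 0, μ₃] := by
  rw [hB.isMetricOperator_iff]
  generalize LinearMap.toMatrix B B A = M
  constructor
  · rintro ⟨hsymm, hpos, hcomm⟩
    obtain ⟨g₁, hg₁, hg₁c⟩ := exists_isotropy_X₁
    obtain ⟨g, hg, g₀, gU, gU', gV, gV'⟩ := exists_isotropy_alpha₂
    have h₁ := hcomm g₁ (hg₁ _) (Matrix.diagonal ![-1, 1, -1, 1, -1])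
      (apply_eq_sum_diagonal fun j => by
        rw [vectorsAlpha₂_eq, map_smul, hg₁c, ← compactElt_smul, ← compactElt_smul,
          ← compactElt_smul]
        refine congrArg compactElt ?_
        ext i
        fin_cases j <;> fin_cases i <;> simp [basisAlpha₂])
    have hR := hcomm g hg !![1, 0, 0, 0, 0; 0, -(√2 / 2), -(√2 / 2), 0, 0;
        0, √2 / 2, -(√2 / 2), 0, 0; 0, 0, 0, √2 / 2, √2 / 2; 0, 0, 0, -(√2 / 2), √2 / 2] fun j => by
      rw [vectorsAlpha₂_eq, map_smul, Fin.sum_univ_five]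
      simp only [vectorsAlpha₂_eq]
      fin_cases j <;> simp [-one_div, basisAlpha₂, scaleAlpha₂, g₀, gU, gU', gV, gV',
        smul_comm (√2)⁻¹]
    have hd := Matrix.diag_pos_of_forall_pos hpos
    exact ⟨_, _, _, hd 0, hd 1, hd 3, matrix_form_alpha₂ hsymm (by positivity) h₁ hR⟩
  · rintro ⟨μ₁, μ₂, μ₃, h₁, h₂, h₃, rfl⟩
    refine ⟨?_, fun v hv => ?_, fun a ha R hR => ?_⟩
    · ext i j
      fin_cases i <;> fin_cases j <;> rfl
    · have e : v ⬝ᵥ !![μ₁, 0, 0, 0, 0; 0, μ₂, 0, 0, 0; 0, 0, μ₂, 0, 0; 0, 0, 0, μ₃, 0;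
          0, 0, 0, 0, μ₃] *ᵥ v = ∑ i, ![μ₁, μ₂, μ₂, μ₃, μ₃] i * v i ^ 2 := by
        simp [Matrix.mulVec, dotProduct, Fin.sum_univ_succ]
        ring
      obtain ⟨k, hk⟩ := Function.ne_iff.1 hv
      have hμ : ∀ i, 0 < ![μ₁, μ₂, μ₂, μ₃, μ₃] i := fun i => by
        fin_cases i <;> assumption
      rw [e]
      exact Finset.sum_pos' (fun i _ => mul_nonneg (hμ i).le (sq_nonneg _))
        ⟨k, Finset.mem_univ _, mul_pos (hμ k) (sq_pos_of_ne_zero hk)⟩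
    · obtain ⟨δ, p, q, r, t, p', q', r', t', hR'⟩ := isotropy_alpha₂_matrix ha
      rw [hB.matrix_unique hR hR']
      ext i j
      fin_cases i <;> fin_cases j <;> simp [Matrix.mul_apply, Fin.sum_univ_succ, mul_comm]

end SplitG2

theorem theorem3p1 :
    -- The isotropy representation on `𝔪_Θ` is well defined, and every invariant inner product
    -- has exactly one metric operator.
    (∀ Θ : Set (Module.Dual ℝ SplitG2.cartan), Θ ⊂ SplitG2.simpleRoots →
      (∀ a ∈ SplitG2.isotropy Θ, ∀ x : SplitG2.m Θ, ∃ x' : SplitG2.m Θ, SplitG2.AdEq a x x') ∧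
      ∀ b : LinearMap.BilinForm ℝ (SplitG2.m Θ), SplitG2.IsInvariantInner Θ b →
        ∃! A : SplitG2.m Θ →ₗ[ℝ] SplitG2.m Θ, SplitG2.IsMetricOperatorOf b A) ∧
    -- The case `Θ = ∅`.
    (∃ B : Module.Basis (Fin 6) ℝ (SplitG2.m ∅),
      SplitG2.IsOrthonormalBasisOf B
        ![SplitG2.W 0, SplitG2.Z 2, SplitG2.W 1, SplitG2.Z 1, SplitG2.W 2, SplitG2.Z 0] ∧
      ∀ A : SplitG2.m ∅ →ₗ[ℝ] SplitG2.m ∅, SplitG2.IsMetricOperator ∅ A ↔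
        ∃ μ₁ μ₂ μ₃ μ₄ μ₅ μ₆ a₁ a₂ a₃ : ℝ,
          0 < μ₁ ∧ 0 < μ₂ ∧ 0 < μ₃ ∧ 0 < μ₄ ∧ 0 < μ₅ ∧ 0 < μ₆ ∧
          a₁ ∈ Set.Ioo (-√(μ₁ * μ₂)) (√(μ₁ * μ₂)) ∧
          a₂ ∈ Set.Ioo (-√(μ₃ * μ₄)) (√(μ₃ * μ₄)) ∧
          a₃ ∈ Set.Ioo (-√(μ₅ * μ₆)) (√(μ₅ * μ₆)) ∧
          LinearMap.toMatrix B B A =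
            !![μ₁, a₁, 0, 0, 0, 0;
               a₁, μ₂, 0, 0, 0, 0;
               0, 0, μ₃, a₂, 0, 0;
               0, 0, a₂, μ₄, 0, 0;
               0, 0, 0, 0, μ₅, a₃;
               0, 0, 0, 0, a₃, μ₆]) ∧
    -- The case `Θ = {α₁}`.
    (∃ B : Module.Basis (Fin 5) ℝ (SplitG2.m {SplitG2.alpha₁}),
      SplitG2.IsOrthonormalBasisOf B
        ![SplitG2.Z 2, SplitG2.W 1, SplitG2.W 2, SplitG2.Z 1, -SplitG2.Z 0] ∧
      ∀ A : SplitG2.m {SplitG2.alpha₁} →ₗ[ℝ] SplitG2.m {SplitG2.alpha₁},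
        SplitG2.IsMetricOperator {SplitG2.alpha₁} A ↔
        ∃ μ₁ μ₂ μ₃ a : ℝ, 0 < μ₁ ∧ 0 < μ₂ ∧ 0 < μ₃ ∧
          a ∈ Set.Ioo (-√(μ₂ * μ₃)) (√(μ₂ * μ₃)) ∧
          LinearMap.toMatrix B B A =
            !![μ₁, 0, 0, 0, 0;
               0, μ₂, 0, a, 0;
               0, 0, μ₂, 0, a;
               0, a, 0, μ₃, 0;
               0, 0, a, 0, μ₃]) ∧
    -- The case `Θ = {α₂}`.
    (∃ B : Module.Basis (Fin 5) ℝ (SplitG2.m {SplitG2.alpha₂}),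
      SplitG2.IsOrthonormalBasisOf B
        ![(√5)⁻¹ • ((2 : ℝ) • SplitG2.W 1 + SplitG2.Z 1),
          (√2)⁻¹ • (SplitG2.W 0 + SplitG2.Z 2),
          (√2)⁻¹ • (SplitG2.W 2 + SplitG2.Z 0),
          (√2)⁻¹ • (SplitG2.W 0 - SplitG2.Z 2),
          (√2)⁻¹ • (SplitG2.W 2 - SplitG2.Z 0)] ∧
      ∀ A : SplitG2.m {SplitG2.alpha₂} →ₗ[ℝ] SplitG2.m {SplitG2.alpha₂},
        SplitG2.IsMetricOperator {SplitG2.alpha₂} A ↔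
        ∃ μ₁ μ₂ μ₃ : ℝ, 0 < μ₁ ∧ 0 < μ₂ ∧ 0 < μ₃ ∧
          LinearMap.toMatrix B B A =
            !![μ₁, 0, 0, 0, 0;
               0, μ₂, 0, 0, 0;
               0, 0, μ₂, 0, 0;
               0, 0, 0, μ₃, 0;
               0, 0, 0, 0, μ₃]) := by
  refine ⟨fun Θ _ => ⟨fun a ha x => SplitG2.exists_adEq ha x,
    fun b _ => SplitG2.existsUnique_isMetricOperatorOf b⟩, ?_, ?_, ?_⟩
  · obtain ⟨B, hB⟩ := SplitG2.exists_basis_empty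
    exact ⟨B, hB, SplitG2.isMetricOperator_empty_iff hB⟩
  · obtain ⟨B, hB⟩ := SplitG2.exists_basis_alpha₁
    exact ⟨B, hB, SplitG2.isMetricOperator_alpha₁_iff hB⟩
  · obtain ⟨B, hB⟩ := SplitG2.exists_basis_alpha₂
    exact ⟨B, hB, SplitG2.isMetricOperator_alpha₂_iff hB⟩
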